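/- For a positive integer $n$ let $E^{(n)}: y^2=x^3-n^2x$ over $\mathbb{Q}$, and identify its $2$-Selmer group $\mathrm{Sel}_2(E^{(n)})$ with the set of triples $\Lambda=(\delta_1,\delta_2,\delta_3)\in(\mathbb{Q}^\times/\mathbb{Q}^{\times 2})^3$ with $\delta_1\delta_2\delta_3=1$ such that the curve $D_\Lambda\subset\mathbb{P}^3$, $$H_1:\ -nt^2+\delta_2u_2^2-\delta_3u_3^2=0,\qquad H_2:\ -nt^2+\delta_3u_3^2-\delta_1u_1^2=0,\qquad H_3:\ 2nt^2+\delta_1u_1^2-\delta_2u_2^2=0,$$ has points over all completions of $\mathbb{Q}$. For $\Lambda,\Lambda'=(\delta_1',\delta_2',\delta_3')$ in $\mathrm{Sel}_2(E^{(n)})$ the Cassels pairing is $$\langle\Lambda,\Lambda'\rangle=\prod_v\prod_{i=1}^3\bigl(L_i(P_v),\delta_i'\bigr)_v\in\{\pm1\},$$ where $v$ runs over all places of $\mathbb{Q}$, $(\cdot,\cdot)_v$ is the Hilbert symbol, $L_i$ is a linear form defining the tangent line at a rational point $Q_i$ of the conic $H_i$, and $(P_v)_v$ is an adelic point of $D_\Lambda$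 with $L_i(P_v)\neq 0$ for all $i$ and $v$. Saying that $\langle\Lambda,\Lambda'\rangle$ has a given value includes that $\Lambda$ and $\Lambda'$ lie in $\mathrm{Sel}_2(E^{(n)})$, that such $Q_i$ and $(P_v)_v$ exist, and that, whatever representatives of the classes $\delta_i,\delta_i'$, points $Q_i$ and $(P_v)_v$ are chosen, almost all factors are $1$ and the product has that value. Let $n=d_1\cdots d_k$ be a square-free positive integer, with positive integers $d_i$, all of whose prime factors are congruent to $1$ modulo $8$, such that 1. $h_4(d_i)=1$ for $1\le i\le k$, where $h_4(d)=\operatorname{rank}_{\mathbb{F}_2}2\mathcal{A}/4\mathcal{A}$ for the ideal class group $\mathcal{A}$ of $\mathbb{Q}(\sqrt{-d})$; 2. $\left(\frac{p}{q}\right)=1$ for all primes $p\mid d_i$, $q\mid d_j$ with $i\ne j$. Put $d_i'=n/d_i$, $\Lambda_i=(1,d_i,d_i)$ and $\Lambda_i'=(d_i,d_i,1)$. For a prime $p\equiv1\pmod 8$ let $\delta_p=1$ if $1+\sqrt2$ is not a square in $\mathbb{Q}_p$ and $\delta_p=0$ otherwise, and let $\delta_m=\sum_{p\mid m}\delta_p$.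 For each $i$ let $(a_i,b_i,c_i)$, $(\alpha_i,\beta_i,\gamma_i)$, $(\bar a_i,\bar b_i,\bar c_i)$ be any primitive solutions in positive integers of $$c_i^2=d_ia_i^2+d_i'b_i^2,\qquad \gamma_i^2=d_i\alpha_i^2+2d_i'\beta_i^2,\qquad \bar c_i^2=d_i\bar a_i^2-d_i'\bar b_i^2$$ such that $d_i'$ divides both $a_i\gamma_i+c_i\alpha_i$ and $a_i\bar c_i+c_i\bar a_i$. Then, with Jacobi symbols on the right, $$\langle\Lambda_i,\Lambda_j\rangle=\left(\frac{c_i\gamma_i}{d_j}\right)\ (i\neq j),\qquad \langle\Lambda_i,\Lambda_j'\rangle=\left(\frac{c_i}{d_j}\right)=\left(\frac{\bar c_j}{d_i}\right)\ (i\ne j),$$ $$\langle\Lambda_i,\Lambda_i'\rangle=(-1)^{\delta_{d_i}}\left(\frac{c_i}{d_i}\right)=(-1)^{\delta_{d_i}}\left(\frac{\bar c_i}{d_i}\right),\qquad \langle\Lambda_i',\Lambda_j'\rangle=\left(\frac{c_i\bar c_i}{d_j}\right)\ (i\neq j).$$ -/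

import Mathlib

namespace CongruentCurve

/-! ### Ideal class groups of imaginary quadratic fields -/

/-- For a commutative group `A` (written multiplicatively), the rank over `𝔽₂` of the elementary
abelian 2-group `2^(i-1) A / 2^i A` (in multiplicative notation `A^(2^(i-1)) / A^(2^i)`), for
`i ≥ 1`. -/
noncomputable def twoPowRank (A : Type*) [CommGroup A] (i : ℕ) : ℕ :=
  letI H : Subgroup A := (powMonoidHom (2 ^ (i - 1)) : A →* A).range
  letI V : Type _ := Additive (H ⧸ ((powMonoidHom 2 : H →* H).range))
  letI : Module (ZMod 2) V := AddCommGroup.zmodModule (n := 2) (by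
    intro x
    induction x using Additive.rec with
    | ofMul y =>
      rw [← ofMul_pow, ofMul_eq_zero]
      induction y using QuotientGroup.induction_on with
      | H z => exact (QuotientGroup.eq_one_iff _).2 ⟨z, rfl⟩)
  Module.finrank (ZMod 2) V

/-- The field `ℚ(√-n)`, as a subfield of `ℂ`. -/
noncomputable abbrev imagQuadField (n : ℕ) : IntermediateField ℚ ℂ :=
  IntermediateField.adjoin ℚ {x : ℂ | x ^ 2 = -(n : ℂ)}

/-- `h_{2^i}(n)`: the `2^i`-rank of the ideal class group of `ℚ(√-n)`; the 4-rank `h₄(n)` is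
`classRank n 2`. -/
noncomputable def classRank (n i : ℕ) : ℕ :=
  twoPowRank (ClassGroup (NumberField.RingOfIntegers (imagQuadField n))) i

/-! ### The invariant `δ` -/

open Classical in
/-- For a prime `p ≡ 1 (mod 8)`: `δ_p = 1` if `1 + √2` is not a square in `ℚ_p`, and `δ_p = 0`
otherwise (this does not depend on the square root of 2 chosen, as
`(1 + √2) (1 - √2) = -1` is a square in `ℚ_p`). -/
noncomputable def deltaPrime (p : ℕ) [Fact p.Prime] : ℕ :=
  if ∃ j : ℚ_[p], j ^ 2 = 2 ∧ ¬ IsSquare (1 + j) then 1 else 0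

/-- `δ_m`, the sum of `δ_p` over the prime divisors `p` of `m`. -/
noncomputable def delta (m : ℕ) : ℕ :=
  ∑ p ∈ m.primeFactors.attach,
    haveI : Fact (p : ℕ).Prime := ⟨Nat.prime_of_mem_primeFactors p.2⟩
    deltaPrime p

/-! ### Places of `ℚ` and Hilbert symbols -/

/-- A place of `ℚ`: infinity or a prime number. -/
inductive Place : Type
  | infinite : Place
  | finite (p : ℕ) (hp : p.Prime) : Place

/-- The completion of `ℚ` at a place. -/
def Place.Completion : Place → Type
  | .infinite => ℝ
  | .finite p hp => haveI : Fact p.Prime := ⟨hp⟩; ℚ_[p]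

noncomputable instance Place.instFieldCompletion : (v : Place) → Field v.Completion
  | .infinite => inferInstanceAs (Field ℝ)
  | .finite p hp => haveI : Fact p.Prime := ⟨hp⟩; inferInstanceAs (Field ℚ_[p])

open Classical in
/-- The Hilbert symbol `(a, b)` of non-zero elements of a (local) field `F`: it is `1` if
`z² = a x² + b y²` has a non-zero solution in `F`, and `-1` otherwise. -/
noncomputable def hilbertSymbol {F : Type*} [Field F] (a b : F) : ℤ :=
  if ∃ x y z : F, (x, y, z) ≠ (0, 0, 0) ∧ z ^ 2 = a * x ^ 2 + b * y ^ 2 then 1 else -1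

/-! ### The curves `D_Λ` -/

/-- The group `ℚˣ / ℚˣ²`. -/
abbrev SqClass : Type := ℚˣ ⧸ (powMonoidHom 2 : ℚˣ →* ℚˣ).range

/-- The class of a non-zero rational number in `ℚˣ / ℚˣ²` (and the trivial class for `0`). -/
noncomputable def sqClass (q : ℚ) : SqClass :=
  if h : q = 0 then 1 else QuotientGroup.mk (Units.mk0 q h)

/-- The coefficients of the three quadrics, for a triple `D = (d₁, d₂, d₃)` (indexed by
`0, 1, 2`):
`H₁ : -n t² + d₂ u₂² - d₃ u₃² = 0`, `H₂ : -n t² + d₃ u₃² - d₁ u₁² = 0`,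
`H₃ : 2 n t² + d₁ u₁² - d₂ u₂² = 0`. -/
def quadricCoeff (n : ℕ) (D : Fin 3 → ℚˣ) : Fin 3 → Fin 3 → ℚ :=
  ![![-(n : ℚ), D 1, -(D 2 : ℚ)],
    ![-(n : ℚ), D 2, -(D 0 : ℚ)],
    ![2 * (n : ℚ), D 0, -(D 1 : ℚ)]]

/-- The coordinates that occur in `H₁`, `H₂`, `H₃`, in the order of `quadricCoeff`. The
coordinates `(t, u₁, u₂, u₃)` of projective 3-space are indexed by `0, 1, 2, 3`. -/
def quadricVars : Fin 3 → Fin 3 → Fin 4 :=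
  ![![0, 2, 3], ![0, 3, 1], ![0, 1, 2]]

/-- The symmetric bilinear form of the diagonal quadratic form with coefficients `a`. -/
def diagForm {F : Type*} [Field F] (a : Fin 3 → ℚ) (x y : Fin 3 → F) : F :=
  ∑ j, (a j : F) * x j * y j

/-- `x` is a vector of homogeneous coordinates of a point of `D_Λ(F)`, where `Λ` is represented
by `D`. -/
def IsCurvePoint (n : ℕ) (D : Fin 3 → ℚˣ) {F : Type*} [Field F] (x : Fin 4 → F) : Prop :=
  x ≠ 0 ∧ ∀ i, diagForm (quadricCoeff n D i) (x ∘ quadricVars i) (x ∘ quadricVars i) = 0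

/-- `q` is a vector of homogeneous coordinates of a rational point of the conic `H_i`. -/
def IsConicPoint (n : ℕ) (D : Fin 3 → ℚˣ) (i : Fin 3) (q : Fin 3 → ℚ) : Prop :=
  q ≠ 0 ∧ diagForm (quadricCoeff n D i) q q = 0

/-- The linear form `L_i` defining the tangent line of `H_i` at its rational point `q`, viewed as a
form in the four coordinates of projective 3-space and evaluated at `x`. -/
def tangentForm (n : ℕ) (D : Fin 3 → ℚˣ) (i : Fin 3) (q : Fin 3 → ℚ)
    {F : Type*} [Field F] (x : Fin 4 → F) : F :=
  diagForm (quadricCoeff n D i) (fun j => (q j : F)) (x ∘ quadricVars i)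

/-! ### The 2-Selmer group and the Cassels pairing -/

/-- The 2-Selmer group of `y² = x³ - n² x`: the triples `Λ` of classes in `ℚˣ / ℚˣ²` with trivial
product for which `D_Λ` has an adelic point, i.e. (the curve being projective) a point over every
completion of `ℚ`. -/
def Sel2 (n : ℕ) : Set (Fin 3 → SqClass) :=
  {Λ | Λ 0 * Λ 1 * Λ 2 = 1 ∧
    ∃ D : Fin 3 → ℚˣ, (∀ i, (D i : SqClass) = Λ i) ∧
      ∀ v : Place, ∃ x : Fin 4 → v.Completion, IsCurvePoint n D x}

/-- The choices made in Cassels' definition of `⟨Λ, Λ'⟩`: representatives of the two triples, a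
rational point `Q_i` on each conic `H_i`, and an adelic point `P` on `D_Λ` at which the tangent
forms `L_i` do not vanish. -/
structure CasselsDatum (n : ℕ) (Λ Λ' : Fin 3 → SqClass) where
  D : Fin 3 → ℚˣ
  D' : Fin 3 → ℚˣ
  hD : ∀ i, (D i : SqClass) = Λ i
  hD' : ∀ i, (D' i : SqClass) = Λ' i
  Q : Fin 3 → Fin 3 → ℚ
  hQ : ∀ i, IsConicPoint n D i (Q i)
  P : (v : Place) → Fin 4 → v.Completion
  hP : ∀ v, IsCurvePoint n D (P v)
  hL : ∀ v i, tangentForm n D i (Q i) (P v) ≠ 0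

/-- The local Cassels pairing `∏ i, (L_i(P_v), d_i')_v` at the place `v`. -/
noncomputable def CasselsDatum.localPairing {n : ℕ} {Λ Λ' : Fin 3 → SqClass}
    (C : CasselsDatum n Λ Λ') (v : Place) : ℤ :=
  ∏ i, hilbertSymbol (tangentForm n C.D i (C.Q i) (C.P v)) (((C.D' i : ℚ)) : v.Completion)

/-- `⟨Λ, Λ'⟩ = s` for the Cassels pairing of the curve `y² = x³ - n² x`: both triples lie in the
2-Selmer group, the choices in the definition of the pairing can be made, and for all such choices
almost all local pairings are `1` and the product of the local pairings over all places is `s`. -/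
def HasCasselsPairing (n : ℕ) (Λ Λ' : Fin 3 → SqClass) (s : ℤ) : Prop :=
  Λ ∈ Sel2 n ∧ Λ' ∈ Sel2 n ∧ Nonempty (CasselsDatum n Λ Λ') ∧
    ∀ C : CasselsDatum n Λ Λ',
      {v : Place | C.localPairing v ≠ 1}.Finite ∧ ∏ᶠ v : Place, C.localPairing v = s

/-- The triple `(1, d, d)`. -/
noncomputable def Lam (d : ℕ) : Fin 3 → SqClass := ![1, sqClass d, sqClass d]

/-- The triple `(d, d, 1)`. -/
noncomputable def Lam' (d : ℕ) : Fin 3 → SqClass := ![sqClass d, sqClass d, 1]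

/-- `(x, y, z)` is a primitive positive integer solution of `z² = A x² + B y²`. -/
def IsPrimPosSol (A B x y z : ℤ) : Prop :=
  0 < x ∧ 0 < y ∧ 0 < z ∧ Int.gcd (Int.gcd x y) z = 1 ∧ z ^ 2 = A * x ^ 2 + B * y ^ 2

end CongruentCurve

namespace CongruentCurve

/-! ### Squares in `ℚ_[p]` -/

section PadicSquares

variable {p : ℕ} [hp : Fact p.Prime]

/-! Let m be one of the d_j. All prime factors of n are 1 modulo 8, and primes from different d_i
are residues of each other, so m is a square in ℝ, in ℚ_2, and in ℚ_p for every p dividing n but not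
m (`LocallyGood`). In a pairing whose second class is built from m, only the primes dividing m and
the primes of good reduction can therefore contribute. Symbols at 2 and ∞ need not be computed: the
product formula is used over odd primes alone (`hasPlaceProd_oddHilbert`).

After a change of coordinates each conic reads z² = A x² + B y², and its tangent form is, up to a
constant, the polar form T between the rational point and the local point. At p ∤ 2n, T has even
valuation once both points are primitive (`exists_norm_diag_eq_sq`). At p ∣ m one coefficient is a
unit and the other a uniformizer, and T may be replaced by 2zz' (`hilbertSymbol_polar_tame`), which
gives (z/p) times the symbol of the local coordinate z'. Exactly two of the three tangent forms are
paired with m, both at the same point P_v, so their scaling factors cancel; off the diagonal the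
coordinates z' agree modulo p up to sign and cancel too. Jacobi symbols of c, γ, c̄ remain. They
depend only on the conic, by the product formula for the polar form of two rational points
(`jacobiSym_eq_of_primitive`).

On the diagonal ⟨Λ_i, Λ_i'⟩ the conic u² = r² + d't² has good reduction at p ∣ d. A Gram determinant
compares its tangent form with the one at (1, 0, 1), which is u − r. There u ≡ r√2, so (u − r)r
equals 1 + √2 up to squares, and δ appears (`hilbertSymbol_mul_sub`).

The equality of (c_i/d_i) and (c̄_i/d_i) comes from reducing both equations modulo p ∣ d_i. For
(c_i/d_j) = (c̄_j/d_i), put A = d_i and B = d_j and take a primitive solution of x² = A y² + B z²,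
which exists by Legendre's theorem. Then (c_i/B) = (x/B)(a_i/B), (c_j/A) = (x/A)(a_j/A), (a_i/B) =
(a_j/A), (x/A)(x/B) = (−1/x), and (c_j c̄_j/A) = (−1/x). The last equality is the hardest: composing
the two solutions for d_j gives a point on X² + Z² = B Y², which is then compared with the auxiliary
conic (`ConicPair`, `jacobiSym_mul_conj`).

Selmer membership is local solubility. It is explicit except at good primes where d is not a square;
there a character sum over 𝔽_p yields a point (`exists_quadraticChar_pattern`). -/

theorem norm_two_eq_one (h2 : p ≠ 2) : ‖(2 : ℚ_[p])‖ = 1 := by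
  have : ‖((2 : ℕ) : ℚ_[p])‖ = 1 := by
    rw [Padic.norm_natCast_eq_one_iff]
    exact (Nat.coprime_primes hp.out Nat.prime_two).2 h2
  simpa using this

/-- Hensel's lemma for X² − u at the approximate root 1, where the derivative is 2. Keeping ‖2‖² in
the bound also covers p = 2, where the condition means u ≡ 1 (mod 8). -/
theorem isSquare_of_norm_sub_one_lt {u : ℚ_[p]} (h : ‖u - 1‖ < ‖(2 : ℚ_[p])‖ ^ 2) :
    IsSquare u := by
  have h2le : ‖(2 : ℚ_[p])‖ ≤ 1 := by
    simpa using Padic.norm_int_le_one (p := p) 2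
  have hu1 : ‖u - 1‖ < 1 := lt_of_lt_of_le h (pow_le_one₀ (norm_nonneg _) h2le)
  have hu : ‖u‖ ≤ 1 := by
    have := Padic.nonarchimedean (u - 1) 1
    rw [sub_add_cancel] at this
    exact this.trans (max_le hu1.le (by simp))
  let v : ℤ_[p] := ⟨u, hu⟩
  let F : Polynomial ℤ_[p] := Polynomial.X ^ 2 - Polynomial.C v
  have hF1 : Polynomial.aeval (1 : ℤ_[p]) F = 1 - v := by simp [F]
  have hF2 : Polynomial.aeval (1 : ℤ_[p]) (Polynomial.derivative F) = 2 := by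
    simp [F]; norm_num
  have key : ‖Polynomial.aeval (1 : ℤ_[p]) F‖ <
      ‖Polynomial.aeval (1 : ℤ_[p]) (Polynomial.derivative F)‖ ^ 2 := by
    rw [hF1, hF2]
    have e1 : ‖(1 - v : ℤ_[p])‖ = ‖u - 1‖ := by
      rw [norm_sub_rev, PadicInt.norm_def, PadicInt.coe_sub, PadicInt.coe_one]
    have e2 : ‖(2 : ℤ_[p])‖ = ‖(2 : ℚ_[p])‖ := by
      rw [PadicInt.norm_def]; rfl
    rw [e1, e2]; exact h
  obtain ⟨z, hz, -⟩ := hensels_lemma (F := F) (a := (1 : ℤ_[p])) key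
  refine ⟨(z : ℚ_[p]), ?_⟩
  have hz' : z ^ 2 - v = 0 := by simpa [F] using hz
  have : (v : ℚ_[p]) = (z : ℚ_[p]) * z := by
    rw [sub_eq_zero] at hz'
    rw [← hz']; push_cast; ring
  exact this

/-- An element close to `y` differs from `y` by a square factor (`p` odd). -/
theorem exists_eq_mul_sq_of_norm_sub_lt (h2 : p ≠ 2) {x y : ℚ_[p]} (h : ‖x - y‖ < ‖y‖) :
    ∃ c : ℚ_[p], c ≠ 0 ∧ x = y * c ^ 2 := by
  have hy : y ≠ 0 := by
    rintro rfl
    simp only [norm_zero] at h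
    exact absurd h (not_lt.2 (norm_nonneg _))
  have hy' : 0 < ‖y‖ := norm_pos_iff.2 hy
  have : ‖x / y - 1‖ < ‖(2 : ℚ_[p])‖ ^ 2 := by
    rw [norm_two_eq_one h2, one_pow, div_sub_one hy, norm_div, div_lt_one hy']
    exact h
  obtain ⟨c, hc⟩ := isSquare_of_norm_sub_one_lt this
  refine ⟨c, ?_, ?_⟩
  · rintro rfl
    have hx : x = 0 := by
      rw [mul_zero, div_eq_zero_iff] at hc
      exact hc.resolve_right hy
    rw [hx, zero_sub, norm_neg] at h
    exact lt_irrefl _ h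
  · rw [sq, ← hc]; field_simp

theorem exists_int_norm_sub_lt {u : ℚ_[p]} (hu : ‖u‖ ≤ 1) : ∃ k : ℤ, ‖u - k‖ < 1 := by
  obtain ⟨v, rfl⟩ : ∃ v : ℤ_[p], (v : ℚ_[p]) = u := ⟨⟨u, hu⟩, rfl⟩
  obtain ⟨n, -, hn⟩ := PadicInt.exists_mem_range v
  refine ⟨n, ?_⟩
  rw [PadicInt.maximalIdeal_eq_span_p, Ideal.mem_span_singleton, ← PadicInt.norm_lt_one_iff_dvd,
    PadicInt.norm_def, PadicInt.coe_sub, PadicInt.coe_natCast] at hn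
  simpa using hn

theorem isSquare_intCast_iff (h2 : p ≠ 2) {k : ℤ} (hk : ¬ (p : ℤ) ∣ k) :
    IsSquare (k : ℚ_[p]) ↔ legendreSym p k = 1 := by
  have hk' : ((k : ℤ) : ZMod p) ≠ 0 := by
    rwa [Ne, ZMod.intCast_zmod_eq_zero_iff_dvd]
  have hkn : ‖(k : ℚ_[p])‖ = 1 :=
    le_antisymm (Padic.norm_int_le_one k) (not_lt.1 fun h => hk (Padic.norm_intCast_lt_one_iff.1 h))
  rw [legendreSym.eq_one_iff p hk']
  constructor
  · rintro ⟨r, hr⟩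
    have hr1 : ‖r‖ ≤ 1 := by
      by_contra hcon
      rw [hr, norm_mul] at hkn
      nlinarith
    obtain ⟨m, hm⟩ := exists_int_norm_sub_lt hr1
    have : ‖((k - m * m : ℤ) : ℚ_[p])‖ < 1 := by
      push_cast
      rw [hr, show r * r - (m : ℚ_[p]) * m = (r - m) * (r + m) by ring, norm_mul]
      have : ‖r + m‖ ≤ 1 := (Padic.nonarchimedean _ _).trans
        (max_le hr1 (Padic.norm_int_le_one m))
      nlinarith [norm_nonneg (r - (m : ℚ_[p])), norm_nonneg (r + (m : ℚ_[p]))]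
    rw [Padic.norm_intCast_lt_one_iff, ← ZMod.intCast_zmod_eq_zero_iff_dvd] at this
    push_cast at this
    exact ⟨m, sub_eq_zero.1 this⟩
  · rintro ⟨r, hr⟩
    obtain ⟨m, rfl⟩ := ZMod.intCast_surjective r
    have h1 : ‖(((m * m : ℤ)) : ℚ_[p])  - k‖ < ‖(k : ℚ_[p])‖ := by
      rw [hkn, ← Int.cast_sub, Padic.norm_intCast_lt_one_iff, ← ZMod.intCast_zmod_eq_zero_iff_dvd]
      push_cast
      rw [hr, sub_self]
    rw [norm_sub_rev] at h1
    have hm : ‖((m * m : ℤ) : ℚ_[p])‖ = 1 := by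
      have := Padic.norm_eq_of_norm_sub_lt_left h1
      rw [← this, hkn]
    obtain ⟨c, hc, h⟩ := exists_eq_mul_sq_of_norm_sub_lt h2 (hm.symm ▸ hkn ▸ h1)
    exact ⟨m * c, by rw [h]; push_cast; ring⟩

theorem exists_int_eq_mul_sq (h2 : p ≠ 2) {u : ℚ_[p]} (hu : ‖u‖ = 1) :
    ∃ (k : ℤ) (c : ℚ_[p]), ¬ (p : ℤ) ∣ k ∧ c ≠ 0 ∧ u = k * c ^ 2 := by
  obtain ⟨k, hk⟩ := exists_int_norm_sub_lt hu.le
  have hk1 : ‖u‖ = ‖(k : ℚ_[p])‖ := Padic.norm_eq_of_norm_sub_lt_left (hu.symm ▸ hk)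
  have hkp : ¬ (p : ℤ) ∣ k := by
    rw [← Padic.norm_intCast_lt_one_iff, ← hk1, hu]; exact lt_irrefl _
  obtain ⟨c, hc, h⟩ := exists_eq_mul_sq_of_norm_sub_lt h2 (y := (k : ℚ_[p])) (x := u)
    (by rw [← hk1, hu]; exact hk)
  exact ⟨k, c, hkp, hc, h⟩

/-- Squares have index two among the units, as seen from the Legendre symbol. -/
theorem isSquare_mul_of_not_isSquare (h2 : p ≠ 2) {u v : ℚ_[p]} (hu : ‖u‖ = 1) (hv : ‖v‖ = 1)
    (hu' : ¬ IsSquare u) (hv' : ¬ IsSquare v) : IsSquare (u * v) := by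
  obtain ⟨k, c, hk, hc, rfl⟩ := exists_int_eq_mul_sq h2 hu
  obtain ⟨l, e, hl, he, rfl⟩ := exists_int_eq_mul_sq h2 hv
  have aux : ∀ {k : ℤ} {c : ℚ_[p]}, ¬ (p : ℤ) ∣ k → ¬ IsSquare ((k : ℚ_[p]) * c ^ 2) →
      legendreSym p k = -1 := by
    intro k c hk h
    have hk' : ((k : ℤ) : ZMod p) ≠ 0 := by
      rwa [Ne, ZMod.intCast_zmod_eq_zero_iff_dvd]
    refine (legendreSym.eq_one_or_neg_one p hk').resolve_left fun h1 => h ?_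
    exact ((isSquare_intCast_iff h2 hk).2 h1).mul (IsSquare.sq c)
  have hkl : ¬ (p : ℤ) ∣ k * l := fun h =>
    ((Nat.prime_iff_prime_int.1 hp.out).dvd_or_dvd h).elim hk hl
  have h1 : legendreSym p (k * l) = 1 := by
    rw [legendreSym.mul, aux hk hu', aux hl hv']; norm_num
  have := ((isSquare_intCast_iff h2 hkl).2 h1).mul (IsSquare.sq (c * e))
  rwa [Int.cast_mul, show (k : ℚ_[p]) * l * (c * e) ^ 2 = k * c ^ 2 * (l * e ^ 2) by ring] at this

theorem exists_unit_mul_sq {x : ℚ_[p]} (hx : x ≠ 0) :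
    (∃ u c : ℚ_[p], ‖u‖ = 1 ∧ c ≠ 0 ∧ x = u * c ^ 2) ∨
      ∃ u c : ℚ_[p], ‖u‖ = 1 ∧ c ≠ 0 ∧ x = p * u * c ^ 2 := by
  have hp0 : (p : ℚ_[p]) ≠ 0 := by exact_mod_cast hp.out.ne_zero
  have hpr : (p : ℝ) ≠ 0 := by exact_mod_cast hp.out.ne_zero
  have hn := Padic.norm_eq_zpow_neg_valuation hx
  rcases Int.even_or_odd' x.valuation with ⟨k, hk | hk⟩
  · left
    refine ⟨x * (p : ℚ_[p]) ^ (-(2 * k)), (p : ℚ_[p]) ^ k, ?_, zpow_ne_zero _ hp0, ?_⟩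
    · rw [norm_mul, hn, hk, Padic.norm_p_zpow, ← zpow_add₀ hpr]; simp
    · rw [← zpow_natCast, ← zpow_mul, mul_assoc, ← zpow_add₀ hp0]; simp [mul_comm]
  · right
    refine ⟨x * (p : ℚ_[p]) ^ (-(2 * k + 1)), (p : ℚ_[p]) ^ k, ?_, zpow_ne_zero _ hp0, ?_⟩
    · rw [norm_mul, hn, hk, Padic.norm_p_zpow, ← zpow_add₀ hpr]; simp
    · have : (p : ℚ_[p]) * (x * (p : ℚ_[p]) ^ (-(2 * k + 1))) * ((p : ℚ_[p]) ^ k) ^ 2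
          = x * ((p : ℚ_[p]) ^ (1 : ℤ) * (p : ℚ_[p]) ^ (-(2 * k + 1)) * ((p : ℚ_[p]) ^ (k * 2))) := by
        rw [← zpow_natCast, ← zpow_mul, zpow_one]; push_cast; ring
      rw [this, ← zpow_add₀ hp0, ← zpow_add₀ hp0]
      rw [show (1 + -(2 * k + 1) + k * 2 : ℤ) = 0 by ring]; simp

/-- One side has even valuation and the other odd. -/
theorem norm_sq_ne_norm_p_mul_sq {c y : ℚ_[p]} (hc : c ≠ 0) (hy : y ≠ 0) :
    ‖c‖ ^ 2 ≠ ‖(p : ℚ_[p])‖ * ‖y‖ ^ 2 := by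
  intro h
  have hpr : (p : ℝ) ≠ 0 := by exact_mod_cast hp.out.ne_zero
  have h1 : (1 : ℝ) < p := by exact_mod_cast hp.out.one_lt
  rw [Padic.norm_eq_zpow_neg_valuation hc, Padic.norm_eq_zpow_neg_valuation hy, Padic.norm_p,
    ← zpow_natCast, ← zpow_mul, ← zpow_natCast, ← zpow_mul, ← zpow_neg_one,
    ← zpow_add₀ hpr] at h
  have := zpow_right_injective₀ (by linarith) h1.ne' h
  push_cast at this
  omega

theorem exists_unit_mul_sq_of_norm_eq {x c : ℚ_[p]} (hc : c ≠ 0) (h : ‖x‖ = ‖c‖ ^ 2) :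
    ∃ u : ℚ_[p], ‖u‖ = 1 ∧ x = u * c ^ 2 := by
  have : ‖c‖ ≠ 0 := norm_ne_zero_iff.2 hc
  refine ⟨x / c ^ 2, ?_, by field_simp⟩
  rw [norm_div, norm_pow, h]; field_simp

/-- A binary form `z² - a x²` with a non-square unit `a` is anisotropic. -/
theorem norm_sq_sub_mul_sq (h2 : p ≠ 2) {a : ℚ_[p]} (ha : ‖a‖ = 1) (hsq : ¬ IsSquare a)
    (z x : ℚ_[p]) : ‖z ^ 2 - a * x ^ 2‖ = max ‖z‖ ‖x‖ ^ 2 := by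
  by_cases hzx : ‖z‖ = ‖x‖
  · by_cases hx : x = 0
    · subst hx
      have : z = 0 := by simpa using hzx
      subst this; simp
    have hax : ‖a * x ^ 2‖ = ‖x‖ ^ 2 := by rw [norm_mul, ha, norm_pow, one_mul]
    rw [hzx, max_self]
    refine le_antisymm ?_ (not_lt.1 fun h => hsq ?_)
    · rw [sub_eq_add_neg]
      refine (Padic.nonarchimedean _ _).trans (max_le ?_ ?_)
      · rw [norm_pow, hzx]
      · rw [norm_neg, hax]
    -- If z² and a x² were closer than ‖a x²‖, they would differ by a square factor and a would be a
    -- square.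
    · rw [← hax] at h
      obtain ⟨c, hc, e⟩ := exists_eq_mul_sq_of_norm_sub_lt h2 h
      refine ⟨z / (x * c), ?_⟩
      field_simp
      rw [e]
  · have : ‖z ^ 2‖ ≠ ‖-(a * x ^ 2)‖ := by
      rw [norm_neg, norm_mul, ha, one_mul, norm_pow, norm_pow]
      intro h
      exact hzx ((pow_left_inj₀ (norm_nonneg _) (norm_nonneg _) two_ne_zero).1 h)
    rw [sub_eq_add_neg, Padic.add_eq_max_of_ne this, norm_neg, norm_mul, ha, one_mul, norm_pow,
      norm_pow]
    rcases le_total ‖z‖ ‖x‖ with h | h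
    · rw [max_eq_right h, max_eq_right (pow_le_pow_left₀ (norm_nonneg _) h 2)]
    · rw [max_eq_left h, max_eq_left (pow_le_pow_left₀ (norm_nonneg _) h 2)]

end PadicSquares

/-! ### Hilbert symbols -/

section HilbertField

variable {F : Type*} [Field F]

theorem hilbertSymbol_eq_one_iff {a b : F} : hilbertSymbol a b = 1 ↔
    ∃ x y z : F, (x, y, z) ≠ (0, 0, 0) ∧ z ^ 2 = a * x ^ 2 + b * y ^ 2 := by
  constructor
  · intro h
    unfold hilbertSymbol at h
    split_ifs at h with h'
    exact h'
  · intro h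
    unfold hilbertSymbol
    exact if_pos h

theorem hilbertSymbol_eq_one_or (a b : F) : hilbertSymbol a b = 1 ∨ hilbertSymbol a b = -1 := by
  unfold hilbertSymbol; split_ifs <;> simp

theorem hilbertSymbol_congr {a b a' b' : F} (h : hilbertSymbol a b = 1 ↔ hilbertSymbol a' b' = 1) :
    hilbertSymbol a b = hilbertSymbol a' b' := by
  rcases hilbertSymbol_eq_one_or a b with h1 | h1 <;>
    rcases hilbertSymbol_eq_one_or a' b' with h2 | h2 <;> simp_all

theorem hilbertSymbol_comm (a b : F) : hilbertSymbol a b = hilbertSymbol b a := by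
  have key : ∀ a b : F, (∃ x y z : F, (x, y, z) ≠ (0, 0, 0) ∧ z ^ 2 = a * x ^ 2 + b * y ^ 2) →
      ∃ x y z : F, (x, y, z) ≠ (0, 0, 0) ∧ z ^ 2 = b * x ^ 2 + a * y ^ 2 := by
    rintro a b ⟨x, y, z, h0, h⟩
    refine ⟨y, x, z, fun h' => h0 ?_, by rw [h]; ring⟩
    simp only [Prod.mk.injEq] at h' ⊢
    tauto
  have e : (∃ x y z : F, (x, y, z) ≠ (0, 0, 0) ∧ z ^ 2 = a * x ^ 2 + b * y ^ 2) ↔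
      ∃ x y z : F, (x, y, z) ≠ (0, 0, 0) ∧ z ^ 2 = b * x ^ 2 + a * y ^ 2 := ⟨key a b, key b a⟩
  exact hilbertSymbol_congr (by rw [hilbertSymbol_eq_one_iff, hilbertSymbol_eq_one_iff, e])

theorem hilbertSymbol_ne_one_iff {a b : F} : hilbertSymbol a b ≠ 1 ↔ hilbertSymbol a b = -1 := by
  rcases hilbertSymbol_eq_one_or a b with h | h <;> rw [h] <;> norm_num

theorem hilbertSymbol_mul_self (a b : F) : hilbertSymbol a b * hilbertSymbol a b = 1 := by
  rcases hilbertSymbol_eq_one_or a b with h | h <;> rw [h] <;> norm_num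

theorem hilbertSymbol_eq_one_of {a b : F} (x y z : F) (h0 : (x, y, z) ≠ (0, 0, 0))
    (h : z ^ 2 = a * x ^ 2 + b * y ^ 2) : hilbertSymbol a b = 1 := by
  unfold hilbertSymbol; exact if_pos ⟨x, y, z, h0, h⟩

theorem hilbertSymbol_of_isSquare_left {a : F} (b : F) (ha : IsSquare a) :
    hilbertSymbol a b = 1 := by
  obtain ⟨r, rfl⟩ := ha
  exact hilbertSymbol_eq_one_of 1 0 r (by simp) (by ring)

theorem hilbertSymbol_of_isSquare_right (a : F) {b : F} (hb : IsSquare b) :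
    hilbertSymbol a b = 1 := by
  rw [hilbertSymbol_comm]; exact hilbertSymbol_of_isSquare_left a hb

theorem hilbertSymbol_neg_self (b : F) : hilbertSymbol (-b) b = 1 :=
  hilbertSymbol_eq_one_of 1 1 0 (by simp) (by ring)

theorem hilbertSymbol_mul_sq_left (a b : F) {c : F} (hc : c ≠ 0) :
    hilbertSymbol (a * c ^ 2) b = hilbertSymbol a b := by
  suffices e : (∃ x y z : F, (x, y, z) ≠ (0, 0, 0) ∧ z ^ 2 = a * c ^ 2 * x ^ 2 + b * y ^ 2) ↔
      ∃ x y z : F, (x, y, z) ≠ (0, 0, 0) ∧ z ^ 2 = a * x ^ 2 + b * y ^ 2 by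
    exact hilbertSymbol_congr (by rw [hilbertSymbol_eq_one_iff, hilbertSymbol_eq_one_iff, e])
  constructor
  · rintro ⟨x, y, z, h0, h⟩
    refine ⟨c * x, y, z, fun h' => h0 ?_, by rw [h]; ring⟩
    simpa [hc] using h'
  · rintro ⟨x, y, z, h0, h⟩
    refine ⟨x / c, y, z, fun h' => h0 ?_, by rw [h]; field_simp⟩
    simpa [hc] using h'

theorem hilbertSymbol_mul_sq_right (a b : F) {c : F} (hc : c ≠ 0) :
    hilbertSymbol a (b * c ^ 2) = hilbertSymbol a b := by
  rw [hilbertSymbol_comm, hilbertSymbol_mul_sq_left _ _ hc, hilbertSymbol_comm]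

/-- For non-square b the symbol detects norms from F(√b): a solution with x = 0 would make b a
square, so x can be scaled to 1. -/
theorem hilbertSymbol_eq_one_iff_of_not_isSquare {a b : F} (ha : a ≠ 0) (hb : ¬ IsSquare b) :
    hilbertSymbol a b = 1 ↔ ∃ z y : F, z ^ 2 - b * y ^ 2 = a := by
  constructor
  · intro h
    unfold hilbertSymbol at h
    split_ifs at h with h'
    · obtain ⟨x, y, z, h0, e⟩ := h'
      by_cases hx : x = 0
      · subst hx
        exfalso
        have hy : y ≠ 0 := by
          rintro rfl
          apply h0
          have : z = 0 := by simpa using e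
          simp [this]
        refine hb ⟨z / y, ?_⟩
        field_simp
        rw [e]; ring
      · refine ⟨z / x, y / x, ?_⟩
        field_simp
        rw [e]; ring
  · rintro ⟨z, y, rfl⟩
    exact hilbertSymbol_eq_one_of 1 y z (by simp) (by ring)

/-- Norms from F(√b) are closed under products, by Brahmagupta's identity. -/
theorem hilbertSymbol_mul_eq_one {a a' b : F} (ha : a ≠ 0) (ha' : a' ≠ 0)
    (h : hilbertSymbol a b = 1) (h' : hilbertSymbol a' b = 1) : hilbertSymbol (a * a') b = 1 := by
  by_cases hb : IsSquare b
  · exact hilbertSymbol_of_isSquare_right _ hb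
  rw [hilbertSymbol_eq_one_iff_of_not_isSquare ha hb] at h
  rw [hilbertSymbol_eq_one_iff_of_not_isSquare ha' hb] at h'
  rw [hilbertSymbol_eq_one_iff_of_not_isSquare (mul_ne_zero ha ha') hb]
  obtain ⟨z, y, rfl⟩ := h
  obtain ⟨z', y', rfl⟩ := h'
  exact ⟨z * z' + b * y * y', z * y' + z' * y, by ring⟩

theorem hilbertSymbol_mul_of_eq_one {a a' b : F} (ha : a ≠ 0) (ha' : a' ≠ 0)
    (h : hilbertSymbol a b = 1) : hilbertSymbol (a * a') b = hilbertSymbol a' b := by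
  rcases hilbertSymbol_eq_one_or a' b with h' | h'
  · rw [h', hilbertSymbol_mul_eq_one ha ha' h h']
  · rw [h', ← hilbertSymbol_ne_one_iff]
    intro h2
    have := hilbertSymbol_mul_eq_one ha (mul_ne_zero ha ha') h h2
    rw [← mul_assoc, mul_comm, ← sq, hilbertSymbol_mul_sq_left _ _ ha, h'] at this
    norm_num at this

/-- Multiplicativity in the first argument follows once the norm group has index at most 2. -/
theorem hilbertSymbol_mul_left_of {a a' b : F} (ha : a ≠ 0) (ha' : a' ≠ 0)
    (h : hilbertSymbol a b = -1 → hilbertSymbol a' b = -1 → hilbertSymbol (a * a') b = 1) :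
    hilbertSymbol (a * a') b = hilbertSymbol a b * hilbertSymbol a' b := by
  rcases hilbertSymbol_eq_one_or a b with h1 | h1
  · rw [hilbertSymbol_mul_of_eq_one ha ha' h1, h1, one_mul]
  rcases hilbertSymbol_eq_one_or a' b with h2 | h2
  · rw [mul_comm a, hilbertSymbol_mul_of_eq_one ha' ha h2, h2, mul_one]
  rw [h h1 h2, h1, h2]; norm_num

end HilbertField

section HilbertPadic

variable {p : ℕ} [hp : Fact p.Prime]

/-- Over 𝔽_p the two quadratics k x² and 1 − l y² have a common value by counting, and Hensel's
lemma lifts the solution. -/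
theorem hilbertSymbol_units (h2 : p ≠ 2) {a b : ℚ_[p]} (ha : ‖a‖ = 1) (hb : ‖b‖ = 1) :
    hilbertSymbol a b = 1 := by
  obtain ⟨k, c, hk, hc, rfl⟩ := exists_int_eq_mul_sq h2 ha
  obtain ⟨l, e, hl, he, rfl⟩ := exists_int_eq_mul_sq h2 hb
  rw [hilbertSymbol_mul_sq_left _ _ hc, hilbertSymbol_mul_sq_right _ _ he]
  have hk' : ((k : ℤ) : ZMod p) ≠ 0 := by rwa [Ne, ZMod.intCast_zmod_eq_zero_iff_dvd]
  have hl' : ((l : ℤ) : ZMod p) ≠ 0 := by rwa [Ne, ZMod.intCast_zmod_eq_zero_iff_dvd]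
  obtain ⟨x, y, hxy⟩ := FiniteField.exists_root_sum_quadratic (R := ZMod p)
    (f := Polynomial.C (k : ZMod p) * Polynomial.X ^ 2 + Polynomial.C 0 * Polynomial.X
      + Polynomial.C 0)
    (g := Polynomial.C (l : ZMod p) * Polynomial.X ^ 2 + Polynomial.C 0 * Polynomial.X
      + Polynomial.C (-1))
    (Polynomial.degree_quadratic hk') (Polynomial.degree_quadratic hl')
    (by rw [ZMod.card]; exact (hp.out.eq_two_or_odd).resolve_left h2)
  obtain ⟨m, rfl⟩ := ZMod.intCast_surjective x
  obtain ⟨n, rfl⟩ := ZMod.intCast_surjective y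
  simp only [map_zero, zero_mul, add_zero, Polynomial.eval_add, Polynomial.eval_mul,
    Polynomial.eval_C, Polynomial.eval_pow, Polynomial.eval_X] at hxy
  have h1 : ‖((k * m ^ 2 + l * n ^ 2 : ℤ) : ℚ_[p]) - 1‖ < ‖(1 : ℚ_[p])‖ := by
    have : ((k * m ^ 2 + l * n ^ 2 : ℤ) : ℚ_[p]) - 1 = ((k * m ^ 2 + l * n ^ 2 - 1 : ℤ) : ℚ_[p]) := by
      push_cast; ring
    rw [norm_one, this, Padic.norm_intCast_lt_one_iff, ← ZMod.intCast_zmod_eq_zero_iff_dvd]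
    push_cast
    rw [← hxy]; ring
  obtain ⟨r, hr, e⟩ := exists_eq_mul_sq_of_norm_sub_lt h2 h1
  rw [one_mul] at e
  push_cast at e
  refine hilbertSymbol_eq_one_of (m : ℚ_[p]) n r ?_ e.symm
  simp [hr]

theorem hilbertSymbol_eq_one_of_norm_eq (h2 : p ≠ 2) {a b c e : ℚ_[p]} (hc : c ≠ 0)
    (ha : ‖a‖ = ‖c‖ ^ 2) (he : e ≠ 0) (hb : ‖b‖ = ‖e‖ ^ 2) : hilbertSymbol a b = 1 := by
  obtain ⟨u, hu, rfl⟩ := exists_unit_mul_sq_of_norm_eq hc ha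
  obtain ⟨v, hv, rfl⟩ := exists_unit_mul_sq_of_norm_eq he hb
  rw [hilbertSymbol_mul_sq_left _ _ hc, hilbertSymbol_mul_sq_right _ _ he,
    hilbertSymbol_units h2 hu hv]

/-- Norms from the unramified extension ℚ_p(√a) have even valuation. -/
theorem hilbertSymbol_p_mul_unit (h2 : p ≠ 2) {a u : ℚ_[p]} (ha : ‖a‖ = 1) (hu : ‖u‖ = 1)
    (hsq : ¬ IsSquare a) : hilbertSymbol a (p * u) = -1 := by
  rw [← hilbertSymbol_ne_one_iff]
  have hp0 : (p : ℚ_[p]) ≠ 0 := by exact_mod_cast hp.out.ne_zero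
  have hu0 : u ≠ 0 := by rintro rfl; simp at hu
  intro h
  rw [hilbertSymbol_comm, hilbertSymbol_eq_one_iff_of_not_isSquare (mul_ne_zero hp0 hu0) hsq] at h
  obtain ⟨z, y, h⟩ := h
  have h1 := norm_sq_sub_mul_sq h2 ha hsq z y
  rw [h, norm_mul, hu] at h1
  have hpn : ‖(p : ℚ_[p])‖ ≠ 0 := norm_ne_zero_iff.2 hp0
  rcases le_total ‖z‖ ‖y‖ with hzy | hzy
  · rw [max_eq_right hzy] at h1
    refine norm_sq_ne_norm_p_mul_sq (c := y) (y := 1) ?_ one_ne_zero ?_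
    · rintro rfl; simp [hp.out.ne_zero] at h1
    · simp only [norm_one]; rw [← h1]; ring
  · rw [max_eq_left hzy] at h1
    refine norm_sq_ne_norm_p_mul_sq (c := z) (y := 1) ?_ one_ne_zero ?_
    · rintro rfl; simp [hp.out.ne_zero] at h1
    · simp only [norm_one]; rw [← h1]; ring

/-- It suffices that the product of two non-norms is a norm. If b has even valuation, non-norms have
odd valuation and their product is a unit times a square. If b has odd valuation, −b is a norm and
reduces everything to units; the unit parts of non-norms are non-squares, and two of them multiply
to a square. -/
theorem hilbertSymbol_mul_left (h2 : p ≠ 2) {a a' b : ℚ_[p]} (ha : a ≠ 0) (ha' : a' ≠ 0)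
    (hb : b ≠ 0) : hilbertSymbol (a * a') b = hilbertSymbol a b * hilbertSymbol a' b := by
  have hp0 : (p : ℚ_[p]) ≠ 0 := by exact_mod_cast hp.out.ne_zero
  refine hilbertSymbol_mul_left_of ha ha' fun h h' => ?_
  rcases exists_unit_mul_sq hb with ⟨v, e, hv, he, rfl⟩ | ⟨v, e, hv, he, rfl⟩
  · rw [hilbertSymbol_mul_sq_right _ _ he] at h h' ⊢
    have aux : ∀ {a : ℚ_[p]}, a ≠ 0 → hilbertSymbol a v = -1 →
        ∃ u c : ℚ_[p], ‖u‖ = 1 ∧ c ≠ 0 ∧ a = p * u * c ^ 2 := by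
      intro a ha h
      rcases exists_unit_mul_sq ha with ⟨u, c, hu, hc, rfl⟩ | h'
      · rw [hilbertSymbol_mul_sq_left _ _ hc, hilbertSymbol_units h2 hu hv] at h
        norm_num at h
      · exact h'
    obtain ⟨u, c, hu, hc, rfl⟩ := aux ha h
    obtain ⟨u', c', hu', hc', rfl⟩ := aux ha' h'
    rw [show (p : ℚ_[p]) * u * c ^ 2 * (p * u' * c' ^ 2) = (u * u') * (p * c * c') ^ 2 by ring,
      hilbertSymbol_mul_sq_left _ _ (mul_ne_zero (mul_ne_zero hp0 hc) hc'),
      hilbertSymbol_units h2 (by rw [norm_mul, hu, hu', one_mul]) hv]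
  · rw [hilbertSymbol_mul_sq_right _ _ he] at h h' ⊢
    have hv0 : v ≠ 0 := by rintro rfl; simp at hv
    have hneg : hilbertSymbol (-(p * v)) (p * v : ℚ_[p]) = 1 := hilbertSymbol_neg_self _
    have hpv : -(p * v) ≠ (0 : ℚ_[p]) := neg_ne_zero.2 (mul_ne_zero hp0 hv0)
    -- up to norms, every element is a unit
    have aux : ∀ {a : ℚ_[p]}, a ≠ 0 → hilbertSymbol a (p * v) = -1 →
        ∃ u w : ℚ_[p], ‖u‖ = 1 ∧ ¬ IsSquare u ∧ w ≠ 0 ∧ hilbertSymbol w (p * v) = 1 ∧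
          a = w * u := by
      intro a ha h
      have key : ∃ u w : ℚ_[p], ‖u‖ = 1 ∧ w ≠ 0 ∧ hilbertSymbol w (p * v) = 1 ∧ a = w * u := by
        rcases exists_unit_mul_sq ha with ⟨u, c, hu, hc, rfl⟩ | ⟨u, c, hu, hc, rfl⟩
        · exact ⟨u, c ^ 2, hu, pow_ne_zero _ hc,
            hilbertSymbol_of_isSquare_left _ (IsSquare.sq c), mul_comm _ _⟩
        · refine ⟨-u / v, -(p * v) * c ^ 2, ?_, mul_ne_zero hpv (pow_ne_zero _ hc), ?_, ?_⟩
          · rw [norm_div, norm_neg, hu, hv, div_one]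
          · rw [hilbertSymbol_mul_sq_left _ _ hc, hneg]
          · field_simp
      obtain ⟨u, w, hu, hw, h1, rfl⟩ := key
      refine ⟨u, w, hu, fun hsq => ?_, hw, h1, rfl⟩
      rw [hilbertSymbol_mul_of_eq_one hw (right_ne_zero_of_mul ha) h1,
        hilbertSymbol_of_isSquare_left _ hsq] at h
      norm_num at h
    obtain ⟨u, w, hu, hsu, hw, hw1, rfl⟩ := aux ha h
    obtain ⟨u', w', hu', hsu', hw', hw1', rfl⟩ := aux ha' h'
    rw [show w * u * (w' * u') = (w * w') * (u * u') by ring]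
    have hu0 := right_ne_zero_of_mul ha
    have hu0' := right_ne_zero_of_mul ha'
    rw [hilbertSymbol_mul_of_eq_one (mul_ne_zero hw hw') (mul_ne_zero hu0 hu0')
      (hilbertSymbol_mul_eq_one hw hw' hw1 hw1')]
    exact hilbertSymbol_of_isSquare_left _ (isSquare_mul_of_not_isSquare h2 hu hu' hsu hsu')

theorem norm_intCast_eq_one {k : ℤ} (hk : ¬ (p : ℤ) ∣ k) : ‖(k : ℚ_[p])‖ = 1 :=
  le_antisymm (Padic.norm_int_le_one k)
    (not_lt.1 fun h => hk (Padic.norm_intCast_lt_one_iff.1 h))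

theorem hilbertSymbol_intCast (h2 : p ≠ 2) {k : ℤ} (hk : ¬ (p : ℤ) ∣ k) {u : ℚ_[p]}
    (hu : ‖u‖ = 1) : hilbertSymbol (k : ℚ_[p]) (p * u) = jacobiSym k p := by
  rw [← jacobiSym.legendreSym.to_jacobiSym]
  have hk' : ((k : ℤ) : ZMod p) ≠ 0 := by rwa [Ne, ZMod.intCast_zmod_eq_zero_iff_dvd]
  rcases legendreSym.eq_one_or_neg_one p hk' with h | h
  · rw [h, hilbertSymbol_of_isSquare_left _ ((isSquare_intCast_iff h2 hk).2 h)]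
  · rw [h, hilbertSymbol_p_mul_unit h2 (norm_intCast_eq_one hk) hu]
    rw [isSquare_intCast_iff h2 hk, h]; norm_num

end HilbertPadic

/-! ### Products over all places -/

/-- The function `f` on the places of `ℚ` is almost everywhere `1` and has product `s`. -/
structure HasPlaceProd (f : Place → ℤ) (s : ℤ) : Prop where
  finite : {v : Place | f v ≠ 1}.Finite
  prod_eq : ∏ᶠ v : Place, f v = s

theorem HasPlaceProd.mul {f g : Place → ℤ} {s t : ℤ} (hf : HasPlaceProd f s)
    (hg : HasPlaceProd g t) : HasPlaceProd (fun v => f v * g v) (s * t) := by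
  refine ⟨(hf.finite.union hg.finite).subset fun v hv => ?_, ?_⟩
  · by_contra hcon
    simp only [Set.mem_union, Set.mem_ofPred_eq, not_or, not_not] at hcon
    exact hv (by rw [hcon.1, hcon.2, one_mul])
  · rw [finprod_mul_distrib hf.finite hg.finite, hf.prod_eq, hg.prod_eq]

theorem HasPlaceProd.congr {f g : Place → ℤ} {s : ℤ} (hf : HasPlaceProd f s)
    (h : ∀ v, g v = f v) : HasPlaceProd g s := by
  rwa [show g = f from funext h]

theorem HasPlaceProd.unique {f : Place → ℤ} {s t : ℤ} (hs : HasPlaceProd f s)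
    (ht : HasPlaceProd f t) : s = t := hs.prod_eq.symm.trans ht.prod_eq

theorem hasPlaceProd_of_primes (S : Finset ℕ) {f : Place → ℤ} (G : ℕ → ℤ)
    (hS : ∀ p ∈ S, p.Prime)
    (h0 : f .infinite = 1) (h1 : ∀ p hp, p ∉ S → f (.finite p hp) = 1)
    (h2 : ∀ p hp, p ∈ S → f (.finite p hp) = G p) : HasPlaceProd f (∏ p ∈ S, G p) := by
  classical
  let e : S → Place := fun p => .finite p (hS p p.2)
  have he : Function.Injective e := by
    intro a b hab
    simp only [e, Place.finite.injEq] at hab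
    exact Subtype.ext hab
  have hsub : Function.mulSupport f ⊆ ((Finset.univ.image e : Finset Place) : Set Place) := by
    intro v hv
    cases v with
    | infinite => exact absurd h0 hv
    | finite p hp =>
      by_cases hpS : p ∈ S
      · simp only [Finset.coe_image, Finset.coe_univ, Set.image_univ, Set.mem_range]
        exact ⟨⟨p, hpS⟩, rfl⟩
      · exact absurd (h1 p hp hpS) hv
  refine ⟨(Finset.finite_toSet _).subset hsub, ?_⟩
  rw [finprod_eq_prod_of_mulSupport_subset f hsub, Finset.prod_image fun a _ b _ h => he h,
    ← Finset.prod_coe_sort S]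
  exact Finset.prod_congr rfl fun p _ => h2 p (hS p p.2) p.2

theorem hasPlaceProd_one {f : Place → ℤ} (h : ∀ v, f v = 1) : HasPlaceProd f 1 := by
  have := hasPlaceProd_of_primes ∅ (f := f) (fun _ => 1) (by simp) (h _) (fun p hp _ => h _)
    (by simp)
  simpa using this

/-! ### Product formula -/

/-- The Hilbert symbol at the odd primes, and `1` at the places `2` and `∞`. -/
noncomputable def oddHilbert (v : Place) (a b : ℚ) : ℤ :=
  match v with
  | .infinite => 1
  | .finite p hp =>
    haveI : Fact p.Prime := ⟨hp⟩
    if p = 2 then 1 else hilbertSymbol (a : ℚ_[p]) (b : ℚ_[p])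

theorem oddHilbert_finite {p : ℕ} (hp : p.Prime) (h2 : p ≠ 2) (a b : ℚ) :
    haveI : Fact p.Prime := ⟨hp⟩
    oddHilbert (.finite p hp) a b = hilbertSymbol (a : ℚ_[p]) (b : ℚ_[p]) := by
  unfold oddHilbert; exact if_neg h2

theorem oddHilbert_two (hp : Nat.Prime 2) (a b : ℚ) : oddHilbert (.finite 2 hp) a b = 1 := by
  unfold oddHilbert; exact if_pos rfl

theorem oddHilbert_infinite (a b : ℚ) : oddHilbert .infinite a b = 1 := rfl

theorem oddHilbert_mul_left (v : Place) {a a' b : ℚ} (ha : a ≠ 0) (ha' : a' ≠ 0) (hb : b ≠ 0) :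
    oddHilbert v (a * a') b = oddHilbert v a b * oddHilbert v a' b := by
  cases v with
  | infinite => simp [oddHilbert_infinite]
  | finite p hp =>
    have : Fact p.Prime := ⟨hp⟩
    by_cases h2 : p = 2
    · subst h2; simp [oddHilbert_two]
    · rw [oddHilbert_finite hp h2, oddHilbert_finite hp h2, oddHilbert_finite hp h2, Rat.cast_mul]
      exact hilbertSymbol_mul_left h2 (by exact_mod_cast ha) (by exact_mod_cast ha')
        (by exact_mod_cast hb)

theorem oddHilbert_comm (v : Place) (a b : ℚ) : oddHilbert v a b = oddHilbert v b a := by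
  cases v with
  | infinite => simp [oddHilbert_infinite]
  | finite p hp =>
    have : Fact p.Prime := ⟨hp⟩
    by_cases h2 : p = 2
    · subst h2; simp [oddHilbert_two]
    · rw [oddHilbert_finite hp h2, oddHilbert_finite hp h2, hilbertSymbol_comm]

theorem oddHilbert_mul_right (v : Place) {a b b' : ℚ} (ha : a ≠ 0) (hb : b ≠ 0) (hb' : b' ≠ 0) :
    oddHilbert v a (b * b') = oddHilbert v a b * oddHilbert v a b' := by
  rw [oddHilbert_comm, oddHilbert_mul_left v hb hb' ha, oddHilbert_comm v b, oddHilbert_comm v b']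

theorem oddHilbert_one_left (v : Place) (b : ℚ) : oddHilbert v 1 b = 1 := by
  cases v with
  | infinite => simp [oddHilbert_infinite]
  | finite p hp =>
    have : Fact p.Prime := ⟨hp⟩
    by_cases h2 : p = 2
    · subst h2; simp [oddHilbert_two]
    · rw [oddHilbert_finite hp h2]
      exact hilbertSymbol_of_isSquare_left _ (by simp)

theorem oddHilbert_mul_sq_left (v : Place) (a b : ℚ) {c : ℚ} (hc : c ≠ 0) :
    oddHilbert v (a * c ^ 2) b = oddHilbert v a b := by
  cases v with
  | infinite => simp [oddHilbert_infinite]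
  | finite p hp =>
    have : Fact p.Prime := ⟨hp⟩
    by_cases h2 : p = 2
    · subst h2; simp [oddHilbert_two]
    · rw [oddHilbert_finite hp h2, oddHilbert_finite hp h2]
      push_cast
      exact hilbertSymbol_mul_sq_left _ _ (by exact_mod_cast hc)

theorem oddHilbert_units {p : ℕ} (hp : p.Prime) {a b : ℤ} (ha : ¬ (p : ℤ) ∣ a)
    (hb : ¬ (p : ℤ) ∣ b) : oddHilbert (.finite p hp) a b = 1 := by
  have : Fact p.Prime := ⟨hp⟩
  by_cases h2 : p = 2
  · subst h2; simp [oddHilbert_two]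
  · rw [oddHilbert_finite hp h2]
    push_cast
    exact hilbertSymbol_units h2 (norm_intCast_eq_one ha) (norm_intCast_eq_one hb)

theorem oddHilbert_prime {q : ℕ} (hq : q.Prime) (h2 : q ≠ 2) {a : ℤ} (ha : ¬ (q : ℤ) ∣ a) :
    oddHilbert (.finite q hq) a q = jacobiSym a q := by
  have : Fact q.Prime := ⟨hq⟩
  rw [oddHilbert_finite hq h2]
  have := hilbertSymbol_intCast h2 ha (u := 1) norm_one
  rw [mul_one] at this
  exact_mod_cast this

theorem hasPlaceProd_oddHilbert_unit_prime {a : ℤ} {q : ℕ} (hq : q.Prime) (h2 : q ≠ 2)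
    (ha : ∀ p : ℕ, p.Prime → p ≠ 2 → ¬ (p : ℤ) ∣ a) :
    HasPlaceProd (fun v => oddHilbert v a q) (jacobiSym a q) := by
  have := hasPlaceProd_of_primes {q} (f := fun v => oddHilbert v a q) (fun q => jacobiSym a q)
    (by simpa using hq) (oddHilbert_infinite _ _) (fun p hp hpq => ?_) (fun p hp hpq => ?_)
  · simpa using this
  · by_cases hp2 : p = 2
    · subst hp2; exact oddHilbert_two _ _ _
    have := oddHilbert_units hp (ha p hp hp2) (b := q) (fun h => hpq ?_)
    · simpa using this
    · rw [Int.natCast_dvd_natCast, Nat.prime_dvd_prime_iff_eq hp hq] at h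
      simp [h]
  · rw [Finset.mem_singleton] at hpq
    subst hpq
    exact oddHilbert_prime hp h2 (ha p hp h2)

theorem hasPlaceProd_oddHilbert_prime_prime {l q : ℕ} (hl : l.Prime) (hq : q.Prime) (hl2 : l ≠ 2)
    (h2 : q ≠ 2) (hne : l ≠ q) :
    HasPlaceProd (fun v => oddHilbert v l q) (jacobiSym l q * jacobiSym q l) := by
  have hlq : ¬ (l : ℤ) ∣ q := fun h => hne <| by
    rwa [Int.natCast_dvd_natCast, Nat.prime_dvd_prime_iff_eq hl hq] at h
  have hql : ¬ (q : ℤ) ∣ l := fun h => hne.symm <| by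
    rwa [Int.natCast_dvd_natCast, Nat.prime_dvd_prime_iff_eq hq hl] at h
  have := hasPlaceProd_of_primes {q, l} (f := fun v => oddHilbert v l q)
    (fun p => if p = q then jacobiSym l q else jacobiSym q l)
    (by simp [hl, hq]) (oddHilbert_infinite _ _) (fun p hp hpq => ?_) (fun p hp hpq => ?_)
  · rwa [Finset.prod_pair (Ne.symm hne), if_pos rfl, if_neg hne] at this
  · simp only [Finset.mem_insert, Finset.mem_singleton, not_or] at hpq
    have := oddHilbert_units hp (a := l) (b := q) (fun h => hpq.2 ?_) (fun h => hpq.1 ?_)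
    · exact_mod_cast this
    · rwa [Int.natCast_dvd_natCast, Nat.prime_dvd_prime_iff_eq hp hl] at h
    · rwa [Int.natCast_dvd_natCast, Nat.prime_dvd_prime_iff_eq hp hq] at h
  · simp only [Finset.mem_insert, Finset.mem_singleton] at hpq
    rcases hpq with rfl | rfl
    · rw [if_pos rfl]; exact_mod_cast oddHilbert_prime hp h2 hql
    · rw [if_neg hne, oddHilbert_comm]; exact_mod_cast oddHilbert_prime hp hl2 hlq

/-- For q ≡ 1 (mod 8) the supplementary laws and quadratic reciprocity give product 1 over the odd
primes for a = −1, for a = 2 and for a an odd prime; multiplicativity does the rest. -/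
theorem hasPlaceProd_oddHilbert_prime {q : ℕ} (hq : q.Prime) (hq8 : q % 8 = 1) {a : ℚ}
    (ha : a ≠ 0) : HasPlaceProd (fun v => oddHilbert v a q) 1 := by
  have h2 : q ≠ 2 := by rintro rfl; norm_num at hq8
  have hodd : Odd q := Nat.odd_iff.2 (by omega)
  have hq0 : (q : ℚ) ≠ 0 := by exact_mod_cast hq.ne_zero
  have hneg : HasPlaceProd (fun v => oddHilbert v (-1) q) 1 := by
    have := hasPlaceProd_oddHilbert_unit_prime (a := -1) hq h2 fun p hp _ h => by
      rw [Int.dvd_neg] at h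
      exact hp.one_lt.ne' (by exact_mod_cast Int.eq_one_of_dvd_one (by positivity) h)
    rw [jacobiSym.at_neg_one hodd, ZMod.χ₄_nat_one_mod_four (by omega)] at this
    simpa using this
  have hprime : ∀ l : ℕ, l.Prime → HasPlaceProd (fun v => oddHilbert v l q) 1 := by
    intro l hl
    by_cases hl2 : l = 2
    · subst hl2
      have := hasPlaceProd_oddHilbert_unit_prime (a := 2) hq h2 fun p hp hp2 h => hp2 <| by
        have h : (p : ℤ) ∣ (2 : ℕ) := h
        rwa [Int.natCast_dvd_natCast, Nat.prime_dvd_prime_iff_eq hp Nat.prime_two] at h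
      rw [jacobiSym.at_two hodd, ZMod.χ₈_nat_eq_if_mod_eight] at this
      simpa [hq8, show q % 2 ≠ 0 by omega] using this
    by_cases hlq : l = q
    · subst hlq
      -- For l = q the symbol (−q, q) is trivial, so (q, q) = (−1, q).
      refine hneg.congr fun v => ?_
      have : oddHilbert v (-l) l = 1 := by
        cases v with
        | infinite => rfl
        | finite p hp =>
          have : Fact p.Prime := ⟨hp⟩
          by_cases h2 : p = 2
          · subst h2; simp [oddHilbert_two]
          · rw [oddHilbert_finite hp h2, Rat.cast_neg]; exact hilbertSymbol_neg_self _
      rw [show (l : ℚ) = -1 * (-l) by ring] 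
      nth_rw 1 [oddHilbert_mul_left v (by norm_num) (neg_ne_zero.2 hq0)
        (by simpa using hl.ne_zero)]
      rw [show (-1 : ℚ) * (-l) = l by ring, this, mul_one]
    · have := hasPlaceProd_oddHilbert_prime_prime hl hq hl2 h2 hlq
      rwa [jacobiSym.quadratic_reciprocity_one_mod_four' (hl.odd_of_ne_two hl2) (by omega),
        ← sq, jacobiSym.sq_one] at this
      rw [Int.gcd_natCast_natCast]
      exact (Nat.coprime_primes hq hl).2 (Ne.symm hlq)
  have hnat : ∀ m : ℕ, m ≠ 0 → HasPlaceProd (fun v => oddHilbert v m q) 1 := by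
    intro m
    induction m using induction_on_primes with
    | zero => intro h; exact absurd rfl h
    | one => intro _; exact hasPlaceProd_one fun v => by
              rw [Nat.cast_one]; exact oddHilbert_one_left v _
    | prime_mul p m hp ih =>
      intro h
      have hm : m ≠ 0 := right_ne_zero_of_mul h
      refine ((hprime p hp).mul (ih hm)).congr fun v => ?_
      rw [Nat.cast_mul, oddHilbert_mul_left v (by exact_mod_cast hp.ne_zero)
        (by exact_mod_cast hm) hq0]
  have hint : ∀ m : ℤ, m ≠ 0 → HasPlaceProd (fun v => oddHilbert v m q) 1 := by
    intro m hm
    obtain ⟨k, rfl | rfl⟩ := Int.eq_nat_or_neg m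
    · exact_mod_cast hnat k (by simpa using hm)
    · have hk : k ≠ 0 := by simpa using hm
      refine (hneg.mul (hnat k hk)).congr fun v => ?_
      rw [← oddHilbert_mul_left v (by norm_num) (by exact_mod_cast hk) hq0]
      push_cast
      rw [neg_one_mul]
  refine (hint (a.num * a.den) (mul_ne_zero (Rat.num_ne_zero.2 ha) (by simp))).congr fun v => ?_
  have hden : (a.den : ℚ) ≠ 0 := by simp
  rw [← oddHilbert_mul_sq_left v a q hden]
  congr 1
  push_cast
  nth_rw 1 [← Rat.num_div_den a]
  field_simp

/-- The product formula, for second arguments with prime factors `≡ 1 (mod 8)`. -/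
theorem hasPlaceProd_oddHilbert {m : ℕ} (hm : m ≠ 0) (hm8 : ∀ p : ℕ, p.Prime → p ∣ m → p % 8 = 1)
    {a : ℚ} (ha : a ≠ 0) : HasPlaceProd (fun v => oddHilbert v a m) 1 := by
  induction m using induction_on_primes with
  | zero => exact absurd rfl hm
  | one => exact hasPlaceProd_one fun v => by
            rw [oddHilbert_comm, Nat.cast_one]; exact oddHilbert_one_left v _
  | prime_mul p m hp ih =>
    have hm' : m ≠ 0 := right_ne_zero_of_mul hm
    refine ((hasPlaceProd_oddHilbert_prime hp (hm8 p hp (dvd_mul_right _ _)) ha).mul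
      (ih hm' fun q hq h => hm8 q hq (h.mul_left _))).congr fun v => ?_
    rw [Nat.cast_mul, oddHilbert_mul_right v ha (by exact_mod_cast hp.ne_zero)
        (by exact_mod_cast hm')]

/-- Against −1 the odd primes alone do not multiply to 1: the value left over is the missing symbol
at 2, which sees only the odd part modulo 4. -/
theorem hasPlaceProd_oddHilbert_neg_one (s : ℕ) {m : ℕ} (hm : Odd m) :
    HasPlaceProd (fun v => oddHilbert v ((2 ^ s * m : ℕ) : ℚ) (-1)) (jacobiSym (-1) m) := by
  have key : ∀ l : ℕ, l.Prime → l ≠ 2 →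
      HasPlaceProd (fun v => oddHilbert v l (-1)) (jacobiSym (-1) l) := by
    intro l hl hl2
    have := hasPlaceProd_oddHilbert_unit_prime (a := -1) hl hl2 fun p hp _ h => by
      rw [Int.dvd_neg] at h
      exact hp.one_lt.ne' (by exact_mod_cast Int.eq_one_of_dvd_one (by positivity) h)
    refine this.congr fun v => ?_
    rw [oddHilbert_comm]; norm_num
  have h2 : ∀ v, oddHilbert v 2 (-1) = 1 := by
    intro v
    cases v with
    | infinite => rfl
    | finite p hp =>
      by_cases hp2 : p = 2
      · subst hp2; exact oddHilbert_two _ _ _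
      have := oddHilbert_units hp (a := 2) (b := -1) (fun h => hp2 ?_) (fun h => ?_)
      · exact_mod_cast this
      · have h : (p : ℤ) ∣ (2 : ℕ) := h
        rwa [Int.natCast_dvd_natCast, Nat.prime_dvd_prime_iff_eq hp Nat.prime_two] at h
      · rw [Int.dvd_neg] at h
        exact hp.one_lt.ne' (by exact_mod_cast Int.eq_one_of_dvd_one (by positivity) h)
  have hpow : ∀ v, oddHilbert v (2 ^ s) (-1) = 1 := by
    intro v
    induction s with
    | zero => rw [pow_zero]; exact oddHilbert_one_left _ _
    | succ s ih =>
      rw [pow_succ, oddHilbert_mul_left v (by positivity) (by norm_num) (by norm_num), ih, h2,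
        one_mul]
  have hodd : HasPlaceProd (fun v => oddHilbert v m (-1)) (jacobiSym (-1) m) := by
    induction m using induction_on_primes with
    | zero => simp at hm
    | one => rw [jacobiSym.one_right]
             exact hasPlaceProd_one fun v => by
              rw [Nat.cast_one]; exact oddHilbert_one_left v _
    | prime_mul p m hp ih =>
      obtain ⟨hpo, hmo⟩ := Nat.odd_mul.1 hm
      have hm0 : m ≠ 0 := by rintro rfl; exact Nat.not_odd_zero hmo
      have hp2 : p ≠ 2 := by rintro rfl; exact absurd hpo (by decide)
      rw [jacobiSym.mul_right' _ hp.ne_zero hm0]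
      refine ((key p hp hp2).mul (ih hmo)).congr fun v => ?_
      rw [Nat.cast_mul, oddHilbert_mul_left v (by exact_mod_cast hp.ne_zero)
        (by exact_mod_cast hm0) (by norm_num)]
  refine hodd.congr fun v => ?_
  have hm0 : (m : ℚ) ≠ 0 := by
    have : m ≠ 0 := by rintro rfl; exact Nat.not_odd_zero hm
    exact_mod_cast this
  push_cast
  rw [oddHilbert_mul_left v (by positivity) hm0 (by norm_num), hpow, one_mul]

/-! ### Tangent forms of conics `z² = A x² + B y²` over `ℚ_[p]` -/

/-- The polar form of `z² - A x² - B y²`. -/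
def polar {F : Type*} [Field F] (A B x y z x' y' z' : F) : F := z * z' - A * x * x' - B * y * y'

section Local

variable {p : ℕ} [hp : Fact p.Prime]

theorem Padic.norm_add_lt_of_lt {x y : ℚ_[p]} {r : ℝ} (hx : ‖x‖ < r) (hy : ‖y‖ < r) :
    ‖x + y‖ < r := (Padic.nonarchimedean x y).trans_lt (max_lt hx hy)

theorem Padic.norm_add_le_of_le {x y : ℚ_[p]} {r : ℝ} (hx : ‖x‖ ≤ r) (hy : ‖y‖ ≤ r) :
    ‖x + y‖ ≤ r := (Padic.nonarchimedean x y).trans (max_le hx hy)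

theorem Padic.norm_sub_le_of_le {x y : ℚ_[p]} {r : ℝ} (hx : ‖x‖ ≤ r) (hy : ‖y‖ ≤ r) :
    ‖x - y‖ ≤ r := by
  rw [sub_eq_add_neg]; exact Padic.norm_add_le_of_le hx (by rwa [norm_neg])

/-- Good reduction: if the points `q`, `x` of a conic have a common unit coordinate, then the
tangent form at `q` has even valuation at `x`. -/
theorem exists_norm_diag_eq_sq_of_unit (h2 : p ≠ 2) {e₀ e₁ e₂ q₀ q₁ q₂ x₀ x₁ x₂ : ℚ_[p]}
    (he₀ : ‖e₀‖ = 1) (he₁ : ‖e₁‖ = 1) (he₂ : ‖e₂‖ = 1)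
    (hq : e₀ * q₀ ^ 2 + e₁ * q₁ ^ 2 + e₂ * q₂ ^ 2 = 0)
    (hx : e₀ * x₀ ^ 2 + e₁ * x₁ ^ 2 + e₂ * x₂ ^ 2 = 0)
    (hq₀ : ‖q₀‖ ≤ 1) (hq₁ : ‖q₁‖ ≤ 1) (hq₂ : ‖q₂‖ = 1)
    (hx₀ : ‖x₀‖ ≤ 1) (hx₁ : ‖x₁‖ ≤ 1) (hx₂ : ‖x₂‖ = 1)
    (hT : e₀ * q₀ * x₀ + e₁ * q₁ * x₁ + e₂ * q₂ * x₂ ≠ 0) :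
    ∃ c : ℚ_[p], c ≠ 0 ∧ ‖e₀ * q₀ * x₀ + e₁ * q₁ * x₁ + e₂ * q₂ * x₂‖ = ‖c‖ ^ 2 := by
  set T := e₀ * q₀ * x₀ + e₁ * q₁ * x₁ + e₂ * q₂ * x₂ with hTdef
  have hle : ‖T‖ ≤ 1 := by
    refine Padic.norm_add_le_of_le (Padic.norm_add_le_of_le ?_ ?_) ?_ <;>
      simp only [norm_mul, he₀, he₁, he₂, hq₂, hx₂, one_mul, mul_one, le_refl]
    · exact mul_le_one₀ hq₀ (norm_nonneg _) hx₀
    · exact mul_le_one₀ hq₁ (norm_nonneg _) hx₁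
  rcases hle.lt_or_eq with h | h
  -- T times its conjugate T − 2e₂q₂x₂ is a unit times the square of a minor. If T is not a unit,
  -- the conjugate is one, so the valuation of T is even.
  · have h1 : ‖T - 2 * (e₂ * q₂ * x₂)‖ = 1 := by
      have hY : ‖2 * (e₂ * q₂ * x₂)‖ = 1 := by
        simp [norm_mul, norm_two_eq_one h2, he₂, hq₂, hx₂]
      have h3 : ‖T‖ ≠ ‖-(2 * (e₂ * q₂ * x₂))‖ := by rw [norm_neg, hY]; exact h.ne
      rw [sub_eq_add_neg, Padic.add_eq_max_of_ne h3, norm_neg, hY, max_eq_right h.le]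
    have h2 : T * (T - 2 * (e₂ * q₂ * x₂)) = -(e₀ * e₁) * (q₀ * x₁ - q₁ * x₀) ^ 2 := by
      rw [hTdef]
      linear_combination (e₀ * x₀ ^ 2 + e₁ * x₁ ^ 2) * hq - e₂ * q₂ ^ 2 * hx
    have h3 : ‖T‖ = ‖q₀ * x₁ - q₁ * x₀‖ ^ 2 := by
      have := congrArg norm h2
      simpa [norm_mul, h1, he₀, he₁] using this
    refine ⟨_, ?_, h3⟩
    intro h0
    rw [h0] at h3
    exact hT (by simpa using h3)
  · exact ⟨1, one_ne_zero, by simp [h]⟩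

theorem norm_lt_one_of_diag {e₀ e₁ e₂ q₀ q₁ q₂ : ℚ_[p]}
    (he₀ : ‖e₀‖ = 1) (he₁ : ‖e₁‖ = 1) (he₂ : ‖e₂‖ = 1)
    (hq : e₀ * q₀ ^ 2 + e₁ * q₁ ^ 2 + e₂ * q₂ ^ 2 = 0)
    (h0 : ‖q₀‖ < 1) (h1 : ‖q₁‖ < 1) : ‖q₂‖ < 1 := by
  have : e₂ * q₂ ^ 2 = -(e₀ * q₀ ^ 2 + e₁ * q₁ ^ 2) := by linear_combination hq
  have h := congrArg norm this
  rw [norm_mul, he₂, one_mul, norm_neg, norm_pow] at h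
  have h3 : ‖e₀ * q₀ ^ 2 + e₁ * q₁ ^ 2‖ < 1 := by
    refine Padic.norm_add_lt_of_lt ?_ ?_
    · rw [norm_mul, he₀, one_mul, norm_pow]; exact pow_lt_one₀ (norm_nonneg _) h0 two_ne_zero
    · rw [norm_mul, he₁, one_mul, norm_pow]; exact pow_lt_one₀ (norm_nonneg _) h1 two_ne_zero
  by_contra hcon
  have : 1 ≤ ‖q₂‖ ^ 2 := one_le_pow₀ (not_lt.1 hcon)
  linarith

/-- The coordinates `x, y, z` have maximal norm `r`. -/
def MaxNorm (x y z : ℚ_[p]) (r : ℝ) : Prop :=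
  ‖x‖ ≤ r ∧ ‖y‖ ≤ r ∧ ‖z‖ ≤ r ∧ (‖x‖ = r ∨ ‖y‖ = r ∨ ‖z‖ = r)

/-- A primitive solution of a diagonal conic with unit coefficients has at least two unit
coordinates, so any two such solutions share one. -/
theorem exists_norm_diag_eq_sq (h2 : p ≠ 2) {e₀ e₁ e₂ q₀ q₁ q₂ x₀ x₁ x₂ : ℚ_[p]}
    (he₀ : ‖e₀‖ = 1) (he₁ : ‖e₁‖ = 1) (he₂ : ‖e₂‖ = 1)
    (hq : e₀ * q₀ ^ 2 + e₁ * q₁ ^ 2 + e₂ * q₂ ^ 2 = 0)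
    (hx : e₀ * x₀ ^ 2 + e₁ * x₁ ^ 2 + e₂ * x₂ ^ 2 = 0)
    (hqm : MaxNorm q₀ q₁ q₂ 1) (hxm : MaxNorm x₀ x₁ x₂ 1)
    (hT : e₀ * q₀ * x₀ + e₁ * q₁ * x₁ + e₂ * q₂ * x₂ ≠ 0) :
    ∃ c : ℚ_[p], c ≠ 0 ∧ ‖e₀ * q₀ * x₀ + e₁ * q₁ * x₁ + e₂ * q₂ * x₂‖ = ‖c‖ ^ 2 := by
  have two : ∀ {q₀ q₁ q₂ : ℚ_[p]}, e₀ * q₀ ^ 2 + e₁ * q₁ ^ 2 + e₂ * q₂ ^ 2 = 0 →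
      MaxNorm q₀ q₁ q₂ 1 → (‖q₀‖ = 1 ∧ ‖q₁‖ = 1) ∨ (‖q₀‖ = 1 ∧ ‖q₂‖ = 1) ∨
        (‖q₁‖ = 1 ∧ ‖q₂‖ = 1) := by
    rintro q₀ q₁ q₂ hq ⟨h0, h1, h2, h⟩
    have a := norm_lt_one_of_diag he₀ he₁ he₂ hq
    have b := norm_lt_one_of_diag (q₀ := q₁) (q₁ := q₂) (q₂ := q₀) he₁ he₂ he₀
      (by linear_combination hq)
    have c := norm_lt_one_of_diag (q₀ := q₀) (q₁ := q₂) (q₂ := q₁) he₀ he₂ he₁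
      (by linear_combination hq)
    rcases h0.lt_or_eq with h0 | h0 <;> rcases h1.lt_or_eq with h1 | h1 <;>
      rcases h2.lt_or_eq with h2 | h2 <;> grind
  obtain ⟨hq0, hq1, hq2, -⟩ := id hqm
  obtain ⟨hx0, hx1, hx2, -⟩ := id hxm
  have c0 : ‖q₀‖ = 1 → ‖x₀‖ = 1 → ∃ c : ℚ_[p], c ≠ 0 ∧
      ‖e₀ * q₀ * x₀ + e₁ * q₁ * x₁ + e₂ * q₂ * x₂‖ = ‖c‖ ^ 2 := by
    intro h h'
    have e : e₀ * q₀ * x₀ + e₁ * q₁ * x₁ + e₂ * q₂ * x₂ =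
      e₁ * q₁ * x₁ + e₂ * q₂ * x₂ + e₀ * q₀ * x₀ := by ring
    rw [e] at hT ⊢
    exact exists_norm_diag_eq_sq_of_unit h2 he₁ he₂ he₀ (by linear_combination hq)
      (by linear_combination hx) hq1 hq2 h hx1 hx2 h' hT
  have c1 : ‖q₁‖ = 1 → ‖x₁‖ = 1 → ∃ c : ℚ_[p], c ≠ 0 ∧
      ‖e₀ * q₀ * x₀ + e₁ * q₁ * x₁ + e₂ * q₂ * x₂‖ = ‖c‖ ^ 2 := by
    intro h h'
    have e : e₀ * q₀ * x₀ + e₁ * q₁ * x₁ + e₂ * q₂ * x₂ =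
      e₀ * q₀ * x₀ + e₂ * q₂ * x₂ + e₁ * q₁ * x₁ := by ring
    rw [e] at hT ⊢
    exact exists_norm_diag_eq_sq_of_unit h2 he₀ he₂ he₁ (by linear_combination hq)
      (by linear_combination hx) hq0 hq2 h hx0 hx2 h' hT
  have c2 : ‖q₂‖ = 1 → ‖x₂‖ = 1 → ∃ c : ℚ_[p], c ≠ 0 ∧
      ‖e₀ * q₀ * x₀ + e₁ * q₁ * x₁ + e₂ * q₂ * x₂‖ = ‖c‖ ^ 2 := fun h h' =>
    exists_norm_diag_eq_sq_of_unit h2 he₀ he₁ he₂ hq hx hq0 hq1 h hx0 hx1 h' hT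
  rcases two hq hqm with h | h | h <;> rcases two hx hxm with h' | h' | h'
  · exact c0 h.1 h'.1
  · exact c0 h.1 h'.1
  · exact c1 h.2 h'.1
  · exact c0 h.1 h'.1
  · exact c0 h.1 h'.1
  · exact c2 h.2 h'.2
  · exact c1 h.1 h'.2
  · exact c2 h.2 h'.2
  · exact c1 h.1 h'.1

/-- Division of the local point by its scale l makes it primitive, and then T/l has even valuation;
so T and l have the same symbol against a unit. -/
theorem hilbertSymbol_polar_good (h2 : p ≠ 2) {A B δ x y z x' y' z' l : ℚ_[p]}
    (hA : ‖A‖ = 1) (hB : ‖B‖ = 1) (hδ : ‖δ‖ = 1)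
    (hQ : z ^ 2 = A * x ^ 2 + B * y ^ 2) (hP : z' ^ 2 = A * x' ^ 2 + B * y' ^ 2)
    (hQm : MaxNorm x y z 1) (hl : l ≠ 0) (hPm : MaxNorm x' y' z' ‖l‖)
    (hT : polar A B x y z x' y' z' ≠ 0) :
    hilbertSymbol (polar A B x y z x' y' z') δ * hilbertSymbol l δ = 1 := by
  have hδ0 : δ ≠ 0 := by rintro rfl; simp at hδ
  have hln : 0 < ‖l‖ := norm_pos_iff.2 hl
  have e : polar A B x y z x' y' z' =
      l * ((-A) * x * (x' / l) + (-B) * y * (y' / l) + 1 * z * (z' / l)) := by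
    unfold polar; field_simp; ring
  have hT' : (-A) * x * (x' / l) + (-B) * y * (y' / l) + 1 * z * (z' / l) ≠ 0 := by
    intro h; rw [e, h, mul_zero] at hT; exact hT rfl
  obtain ⟨c, hc, hcT⟩ := exists_norm_diag_eq_sq h2 (e₀ := -A) (e₁ := -B) (e₂ := 1)
    (by rwa [norm_neg]) (by rwa [norm_neg]) norm_one
    (q₀ := x) (q₁ := y) (q₂ := z) (x₀ := x' / l) (x₁ := y' / l) (x₂ := z' / l)
    (by linear_combination hQ) (by field_simp; linear_combination hP) hQm (by
      obtain ⟨h0, h1, h2, h⟩ := hPm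
      unfold MaxNorm
      simp only [norm_div, div_le_one hln, div_eq_one_iff_eq hln.ne']
      exact ⟨h0, h1, h2, h⟩) hT'
  rw [← hilbertSymbol_mul_left h2 hT hl hδ0]
  refine hilbertSymbol_eq_one_of_norm_eq h2 (mul_ne_zero hl hc) ?_ one_ne_zero (by simp [hδ])
  rw [e, norm_mul, norm_mul, hcT, norm_mul]; ring

/-- Tame reduction: exactly one of the coefficients `A`, `B` is a unit and the other is a
uniformizer. -/
def TameConic (A B : ℚ_[p]) : Prop :=
  (‖A‖ = 1 ∧ ‖B‖ = ‖(p : ℚ_[p])‖) ∨ (‖A‖ = ‖(p : ℚ_[p])‖ ∧ ‖B‖ = 1)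

theorem norm_le_one_of_lt {y : ℚ_[p]} (h : ‖y‖ < p) : ‖y‖ ≤ 1 := by
  have := (Padic.norm_le_pow_iff_norm_lt_pow_add_one y 0).2 (by simpa using h)
  simpa using this

/-- The terms z² and A x² have even valuation and B y² odd, so the two largest terms, which must
balance, are z² and A x². -/
theorem norm_coord_of_tame {A B x y z : ℚ_[p]} (hA : ‖A‖ = 1) (hB : ‖B‖ = ‖(p : ℚ_[p])‖)
    (hQ : z ^ 2 = A * x ^ 2 + B * y ^ 2) (h0 : (x, y, z) ≠ (0, 0, 0)) :
    z ≠ 0 ∧ ‖x‖ = ‖z‖ ∧ ‖y‖ ≤ ‖z‖ := by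
  have hp0 : (p : ℚ_[p]) ≠ 0 := by exact_mod_cast hp.out.ne_zero
  have hpn : 0 < ‖(p : ℚ_[p])‖ := norm_pos_iff.2 hp0
  have hB0 : B ≠ 0 := by rintro rfl; rw [norm_zero] at hB; linarith
  have hBy : B * y ^ 2 = z ^ 2 + -(A * x ^ 2) := by rw [hQ]; ring
  have hBn : ‖B * y ^ 2‖ = ‖(p : ℚ_[p])‖ * ‖y‖ ^ 2 := by rw [norm_mul, hB, norm_pow]
  have hAx : ‖-(A * x ^ 2)‖ = ‖x‖ ^ 2 := by rw [norm_neg, norm_mul, hA, norm_pow, one_mul]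
  have hxz : ‖x‖ = ‖z‖ := by
    by_contra hne
    have hne' : ‖z ^ 2‖ ≠ ‖-(A * x ^ 2)‖ := by
      rw [hAx, norm_pow]
      intro h
      exact hne ((pow_left_inj₀ (norm_nonneg _) (norm_nonneg _) two_ne_zero).1 h).symm
    have key := Padic.add_eq_max_of_ne hne'
    rw [← hBy, hBn, hAx, norm_pow] at key
    have hy : y ≠ 0 := by
      rintro rfl
      simp only [norm_zero, ne_eq, OfNat.ofNat_ne_zero, not_false_eq_true, zero_pow,
        mul_zero] at key
      have h1 := le_max_left (‖z‖ ^ 2) (‖x‖ ^ 2)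
      have h2 := le_max_right (‖z‖ ^ 2) (‖x‖ ^ 2)
      rw [← key] at h1 h2
      have hz : ‖z‖ = 0 := by
        have := le_antisymm h1 (by positivity); exact pow_eq_zero_iff two_ne_zero |>.1 this
      have hx : ‖x‖ = 0 := by
        have := le_antisymm h2 (by positivity); exact pow_eq_zero_iff two_ne_zero |>.1 this
      exact hne (hx.trans hz.symm)
    rcases max_choice (‖z‖ ^ 2) (‖x‖ ^ 2) with h | h
    · rw [h] at key
      refine norm_sq_ne_norm_p_mul_sq (c := z) ?_ hy key.symm
      rintro rfl
      simp only [norm_zero] at key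
      have : ‖y‖ ≠ 0 := norm_ne_zero_iff.2 hy
      simp only [ne_eq, OfNat.ofNat_ne_zero, not_false_eq_true, zero_pow, mul_eq_zero,
        pow_eq_zero_iff] at key
      exact key.elim hpn.ne' this
    · rw [h] at key
      refine norm_sq_ne_norm_p_mul_sq (c := x) ?_ hy key.symm
      rintro rfl
      simp only [norm_zero] at key
      have : ‖y‖ ≠ 0 := norm_ne_zero_iff.2 hy
      simp only [ne_eq, OfNat.ofNat_ne_zero, not_false_eq_true, zero_pow, mul_eq_zero,
        pow_eq_zero_iff] at key
      exact key.elim hpn.ne' this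
  have hz : z ≠ 0 := by
    rintro rfl
    have hx : x = 0 := by simpa using hxz
    subst hx
    have hy : y = 0 := by simpa [hB0] using hQ
    subst hy
    exact h0 rfl
  refine ⟨hz, hxz, ?_⟩
  have hle : ‖(p : ℚ_[p])‖ * ‖y‖ ^ 2 ≤ ‖z‖ ^ 2 := by
    rw [← hBn, hBy]
    exact Padic.norm_add_le_of_le (by rw [norm_pow]) (by rw [hAx, hxz])
  have hzn : 0 < ‖z‖ := norm_pos_iff.2 hz
  have hpos : (1 : ℝ) < p := by exact_mod_cast hp.out.one_lt
  rw [Padic.norm_p] at hle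
  have h1 : ‖y / z‖ < p := by
    rw [norm_div, div_lt_iff₀ hzn]
    have h3 : ‖y‖ ^ 2 ≤ p * ‖z‖ ^ 2 := by
      rw [inv_mul_le_iff₀ (by linarith)] at hle; exact hle
    have h4 : ‖y‖ ^ 2 < (p * ‖z‖) ^ 2 := by
      have : 0 < ‖z‖ ^ 2 := by positivity
      have h5 : (p : ℝ) * 1 < p * p := mul_lt_mul_of_pos_left hpos (by linarith)
      rw [mul_pow, sq (p : ℝ)]
      exact h3.trans_lt (mul_lt_mul_of_pos_right (by linarith) this)
    exact lt_of_pow_lt_pow_left₀ 2 (by positivity) h4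
  have := norm_le_one_of_lt h1
  rwa [norm_div, div_le_one hzn] at this

theorem TameConic.symm {A B : ℚ_[p]} (h : TameConic A B) : TameConic B A :=
  h.elim (fun h => Or.inr ⟨h.2, h.1⟩) (fun h => Or.inl ⟨h.2, h.1⟩)

theorem TameConic.maxNorm {A B x y z : ℚ_[p]} (h : TameConic A B)
    (hQ : z ^ 2 = A * x ^ 2 + B * y ^ 2) (h0 : (x, y, z) ≠ (0, 0, 0)) :
    z ≠ 0 ∧ ‖x‖ ≤ ‖z‖ ∧ ‖y‖ ≤ ‖z‖ := by
  rcases h with ⟨hA, hB⟩ | ⟨hA, hB⟩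
  · obtain ⟨a, b, c⟩ := norm_coord_of_tame hA hB hQ h0
    exact ⟨a, b.le, c⟩
  · obtain ⟨a, b, c⟩ := norm_coord_of_tame (x := y) (y := x) hB hA (by rw [hQ]; ring) (by
      simp only [ne_eq, Prod.mk.injEq] at h0 ⊢; tauto)
    exact ⟨a, c, b.le⟩

/-- The product T(2zz' − T) is AB times the square of a minor, hence smaller than (zz')². So one
factor is small and the other equals 2zz' up to a square. If T is the small one, (AB, δ) = 1
transfers the symbol of its cofactor to T. -/
theorem hilbertSymbol_polar_tame_aux (h2 : p ≠ 2) {A B δ x y z x' y' z' : ℚ_[p]} (hδ : δ ≠ 0)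
    (hA : ‖A‖ = 1) (hB : ‖B‖ = ‖(p : ℚ_[p])‖) (hAB : hilbertSymbol (A * B) δ = 1)
    (hQ : z ^ 2 = A * x ^ 2 + B * y ^ 2) (hP : z' ^ 2 = A * x' ^ 2 + B * y' ^ 2)
    (hQ0 : (x, y, z) ≠ (0, 0, 0)) (hP0 : (x', y', z') ≠ (0, 0, 0))
    (hT : polar A B x y z x' y' z' ≠ 0) :
    hilbertSymbol (polar A B x y z x' y' z') δ = hilbertSymbol (2 * z * z') δ := by
  obtain ⟨hz, hxz, hyz⟩ := norm_coord_of_tame hA hB hQ hQ0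
  obtain ⟨hz', hxz', hyz'⟩ := norm_coord_of_tame hA hB hP hP0
  have hA0 : A ≠ 0 := by rintro rfl; simp at hA
  have hp0 : (p : ℚ_[p]) ≠ 0 := by exact_mod_cast hp.out.ne_zero
  have hB0 : B ≠ 0 := by
    rintro rfl; rw [norm_zero] at hB; exact hp0 (norm_eq_zero.1 hB.symm)
  set T := polar A B x y z x' y' z' with hTdef
  have hY : ‖2 * z * z'‖ = ‖z‖ * ‖z'‖ := by
    rw [norm_mul, norm_mul, norm_two_eq_one h2, one_mul]
  have hYpos : 0 < ‖z‖ * ‖z'‖ := mul_pos (norm_pos_iff.2 hz) (norm_pos_iff.2 hz')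
  have hprod : T * (2 * z * z' - T) = A * B * (x * y' - x' * y) ^ 2 := by
    rw [hTdef]; unfold polar
    linear_combination (z' ^ 2) * hQ + (A * x ^ 2 + B * y ^ 2) * hP
  have hΔ : ‖x * y' - x' * y‖ ≤ ‖z‖ * ‖z'‖ := by
    refine Padic.norm_sub_le_of_le ?_ ?_
    · rw [norm_mul, hxz]; exact mul_le_mul_of_nonneg_left hyz' (norm_nonneg _)
    · rw [norm_mul, hxz', mul_comm]; exact mul_le_mul_of_nonneg_right hyz (norm_nonneg _)
  have hlt : ‖T‖ * ‖2 * z * z' - T‖ < (‖z‖ * ‖z'‖) ^ 2 := by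
    rw [← norm_mul, hprod, norm_mul, norm_mul, norm_pow, hA, hB, one_mul]
    have h1 : ‖x * y' - x' * y‖ ^ 2 ≤ (‖z‖ * ‖z'‖) ^ 2 := pow_le_pow_left₀ (norm_nonneg _) hΔ 2
    have h3 : ‖(p : ℚ_[p])‖ < 1 := Padic.norm_p_lt_one
    have h4 : 0 < (‖z‖ * ‖z'‖) ^ 2 := by positivity
    have h5 := norm_nonneg (p : ℚ_[p])
    nlinarith
  by_cases hc : ‖2 * z * z' - T‖ < ‖z‖ * ‖z'‖
  · obtain ⟨c, hc0, e⟩ := exists_eq_mul_sq_of_norm_sub_lt h2 (x := T) (y := 2 * z * z')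
      (by rw [norm_sub_rev, hY]; exact hc)
    rw [e, hilbertSymbol_mul_sq_left _ _ hc0]
  · have hTlt : ‖T‖ < ‖z‖ * ‖z'‖ := by
      by_contra hcon
      push Not at hc hcon
      nlinarith
    obtain ⟨c, hc0, e⟩ := exists_eq_mul_sq_of_norm_sub_lt h2 (x := 2 * z * z' - T)
      (y := 2 * z * z') (by rw [hY, sub_sub_cancel_left, norm_neg]; exact hTlt)
    have h20 : (2 : ℚ_[p]) ≠ 0 := two_ne_zero
    have hY0 : 2 * z * z' ≠ 0 := mul_ne_zero (mul_ne_zero h20 hz) hz'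
    have hΔ0 : x * y' - x' * y ≠ 0 := by
      intro h0
      rw [h0, e] at hprod
      have : T * (2 * z * z' * c ^ 2) ≠ 0 :=
        mul_ne_zero hT (mul_ne_zero hY0 (pow_ne_zero _ hc0))
      apply this; rw [hprod]; ring
    have h1 : hilbertSymbol (T * (2 * z * z' - T)) δ = 1 := by
      rw [hprod, hilbertSymbol_mul_sq_left _ _ hΔ0, hAB]
    rw [e, ← mul_assoc, hilbertSymbol_mul_sq_left _ _ hc0, hilbertSymbol_mul_left h2 hT hY0 hδ] at h1
    rcases hilbertSymbol_eq_one_or T δ with h | h <;> rw [h] at h1 ⊢ <;> linarith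

theorem hilbertSymbol_polar_tame (h2 : p ≠ 2) {A B δ x y z x' y' z' : ℚ_[p]} (hδ : δ ≠ 0)
    (hAB : TameConic A B) (hAB' : hilbertSymbol (A * B) δ = 1)
    (hQ : z ^ 2 = A * x ^ 2 + B * y ^ 2) (hP : z' ^ 2 = A * x' ^ 2 + B * y' ^ 2)
    (hQ0 : (x, y, z) ≠ (0, 0, 0)) (hP0 : (x', y', z') ≠ (0, 0, 0))
    (hT : polar A B x y z x' y' z' ≠ 0) :
    hilbertSymbol (polar A B x y z x' y' z') δ = hilbertSymbol (2 * z * z') δ := by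
  rcases hAB with ⟨hA, hB⟩ | ⟨hA, hB⟩
  · exact hilbertSymbol_polar_tame_aux h2 hδ hA hB hAB' hQ hP hQ0 hP0 hT
  · have e : polar A B x y z x' y' z' = polar B A y x z y' x' z' := by unfold polar; ring
    rw [e] at hT ⊢
    refine hilbertSymbol_polar_tame_aux h2 hδ hB hA (by rwa [mul_comm]) (by rw [hQ]; ring)
      (by rw [hP]; ring) ?_ ?_ hT
    · simp only [ne_eq, Prod.mk.injEq] at hQ0 ⊢; tauto
    · simp only [ne_eq, Prod.mk.injEq] at hP0 ⊢; tauto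

end Local

/-- The Gram determinant of three isotropic vectors. -/
theorem two_mul_polar_mul_polar_mul_polar {F : Type*} [Field F] {A B x y z x' y' z' x'' y'' z'' : F}
    (h : z ^ 2 = A * x ^ 2 + B * y ^ 2) (h' : z' ^ 2 = A * x' ^ 2 + B * y' ^ 2)
    (h'' : z'' ^ 2 = A * x'' ^ 2 + B * y'' ^ 2) :
    2 * polar A B x y z x' y' z' * polar A B x' y' z' x'' y'' z'' *
      polar A B x y z x'' y'' z'' = A * B * (x * (y' * z'' - y'' * z') - y * (x' * z'' - x'' * z')
        + z * (x' * y'' - x'' * y')) ^ 2 := by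
  unfold polar
  linear_combination ((z' * z'' - A * x' * x'' - B * y' * y'') ^ 2 -
      (z' ^ 2 - A * x' ^ 2 - B * y' ^ 2) * (z'' ^ 2 - A * x'' ^ 2 - B * y'' ^ 2)) * h +
    (z * z'' - A * x * x'' - B * y * y'') ^ 2 * h' + (z * z' - A * x * x' - B * y * y') ^ 2 * h''

/-! ### Local conditions at the bad places and at the primes of good reduction -/

/-- The finite place of a prime number. -/
abbrev primePlace (p : ℕ) [hp : Fact p.Prime] : Place := .finite p hp.out

/-- A non-zero natural number with all prime factors `≡ 1 (mod 8)`. -/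
def OneModEight (m : ℕ) : Prop := m ≠ 0 ∧ ∀ p : ℕ, p.Prime → p ∣ m → p % 8 = 1

theorem OneModEight.mod_eight {m : ℕ} (h : OneModEight m) : m % 8 = 1 := by
  obtain ⟨h0, h⟩ := h
  induction m using induction_on_primes with
  | zero => exact absurd rfl h0
  | one => rfl
  | prime_mul p m hp ih =>
    have h1 := h p hp (dvd_mul_right _ _)
    have h2 := ih (right_ne_zero_of_mul h0) fun q hq hqm => h q hq (hqm.mul_left _)
    rw [Nat.mul_mod, h1, h2]

theorem OneModEight.ne_two {m p : ℕ} (h : OneModEight m) (hp : p.Prime) (hpm : p ∣ m) : p ≠ 2 := by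
  rintro rfl; have := h.2 2 hp hpm; omega

theorem OneModEight.odd {m : ℕ} (h : OneModEight m) : Odd m := by
  have := h.mod_eight; exact Nat.odd_iff.2 (by omega)

theorem OneModEight.jacobiSym_neg_one {m : ℕ} (h : OneModEight m) : jacobiSym (-1) m = 1 := by
  rw [jacobiSym.at_neg_one h.odd, ZMod.χ₄_nat_one_mod_four (by have := h.mod_eight; omega)]

theorem OneModEight.jacobiSym_two {m : ℕ} (h : OneModEight m) : jacobiSym 2 m = 1 := by
  have h8 := h.mod_eight
  rw [jacobiSym.at_two h.odd, ZMod.χ₈_nat_eq_if_mod_eight]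
  simp [h8, show m % 2 ≠ 0 by omega]

theorem OneModEight.isSquare_padic_two {m : ℕ} [Fact (Nat.Prime 2)] (h : OneModEight m) :
    IsSquare (m : ℚ_[2]) := by
  apply isSquare_of_norm_sub_one_lt
  have h8 := h.mod_eight
  have hd : ((2 ^ 3 : ℕ) : ℤ) ∣ (m : ℤ) - 1 := by omega
  have := (Padic.norm_int_le_pow_iff_dvd (p := 2) ((m : ℤ) - 1) 3).2 (by exact_mod_cast hd)
  push_cast at this
  refine this.trans_lt ?_
  have h2 : ‖(2 : ℚ_[2])‖ = 2⁻¹ := by simpa using Padic.norm_p (p := 2)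
  rw [h2]; norm_num

theorem isSquare_two_padic {p : ℕ} [hp : Fact p.Prime] (h8 : p % 8 = 1) :
    IsSquare (2 : ℚ_[p]) := by
  have h2 : p ≠ 2 := by rintro rfl; omega
  have hodd := hp.out.odd_of_ne_two h2
  have hd : ¬ (p : ℤ) ∣ 2 := fun h => h2 <| by
    have h : (p : ℤ) ∣ (2 : ℕ) := h
    rwa [Int.natCast_dvd_natCast, Nat.prime_dvd_prime_iff_eq hp.out Nat.prime_two] at h
  have := (isSquare_intCast_iff h2 hd).2 (by
    rw [jacobiSym.legendreSym.to_jacobiSym, jacobiSym.at_two hodd, ZMod.χ₈_nat_eq_if_mod_eight]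
    simp [h8, show p % 2 ≠ 0 by omega])
  exact_mod_cast this

theorem isSquare_neg_one_padic {p : ℕ} [hp : Fact p.Prime] (h8 : p % 8 = 1) :
    IsSquare (-1 : ℚ_[p]) := by
  have h2 : p ≠ 2 := by rintro rfl; omega
  have hodd := hp.out.odd_of_ne_two h2
  have hd : ¬ (p : ℤ) ∣ -1 := fun h => by
    rw [Int.dvd_neg] at h
    exact hp.out.one_lt.ne' (by exact_mod_cast Int.eq_one_of_dvd_one (by positivity) h)
  have := (isSquare_intCast_iff h2 hd).2 (by
    rw [jacobiSym.legendreSym.to_jacobiSym, jacobiSym.at_neg_one hodd,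
      ZMod.χ₄_nat_one_mod_four (by omega)])
  exact_mod_cast this

/-- The Hilbert symbol `(a, m)_v`. -/
noncomputable def hilbertAt (m : ℕ) (v : Place) (a : v.Completion) : ℤ :=
  hilbertSymbol a ((m : ℚ) : v.Completion)

theorem hilbertAt_prime (m p : ℕ) [Fact p.Prime] (a : ℚ_[p]) :
    hilbertAt m (primePlace p) a = hilbertSymbol a (m : ℚ_[p]) := by
  rw [← Rat.cast_natCast]; rfl

theorem hilbertAt_infinite (m : ℕ) (a : Place.infinite.Completion) :
    hilbertAt m .infinite a = 1 := by
  refine hilbertSymbol_of_isSquare_right _ ?_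
  have h : IsSquare (((m : ℚ) : ℝ)) := ⟨√(m : ℝ), by
    rw [Real.mul_self_sqrt (Nat.cast_nonneg _)]; push_cast; rfl⟩
  exact h

theorem hilbertAt_two {m : ℕ} (hm : OneModEight m) [Fact (Nat.Prime 2)]
    (a : (primePlace 2).Completion) : hilbertAt m (primePlace 2) a = 1 := by
  exact (hilbertAt_prime m 2 a).trans (hilbertSymbol_of_isSquare_right _ hm.isSquare_padic_two)

theorem hilbertAt_mul {m : ℕ} (hm : OneModEight m) (v : Place) {a b : v.Completion} (ha : a ≠ 0)
    (hb : b ≠ 0) : hilbertAt m v (a * b) = hilbertAt m v a * hilbertAt m v b := by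
  cases v with
  | infinite => simp only [hilbertAt_infinite, mul_one]
  | finite p hp =>
    have : Fact p.Prime := ⟨hp⟩
    by_cases h2 : p = 2
    · subst h2
      have h : ∀ a : (primePlace 2).Completion, hilbertAt m (.finite 2 hp) a = 1 :=
        fun a => hilbertAt_two hm a
      rw [h, h, h, one_mul]
    · have h0 : (m : ℚ_[p]) ≠ 0 := by exact_mod_cast hm.1
      have := hilbertSymbol_mul_left (p := p) (a := a) (a' := b) h2 ha hb h0
      exact ((hilbertAt_prime m p _).trans this).trans
        (congrArg₂ (· * ·) (hilbertAt_prime m p a) (hilbertAt_prime m p b)).symm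

theorem hilbertAt_ratCast {m : ℕ} (hm : OneModEight m) (v : Place) (a : ℚ) :
    hilbertAt m v (a : v.Completion) = oddHilbert v a m := by
  cases v with
  | infinite => rw [hilbertAt_infinite, oddHilbert_infinite]
  | finite p hp =>
    have : Fact p.Prime := ⟨hp⟩
    by_cases h2 : p = 2
    · subst h2
      rw [oddHilbert_two]
      exact hilbertAt_two hm _
    · rw [oddHilbert_finite hp h2]; rfl

theorem hilbertAt_mul_self (m : ℕ) (v : Place) (a : v.Completion) :
    hilbertAt m v a * hilbertAt m v a = 1 := hilbertSymbol_mul_self _ _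

theorem jacobiSym_eq_prod_primeFactors {m : ℕ} (hm : Squarefree m) (a : ℤ) :
    jacobiSym a m = ∏ p ∈ m.primeFactors, jacobiSym a p := by
  have key : ∀ S : Finset ℕ, (∀ p ∈ S, p.Prime) →
      jacobiSym a (∏ p ∈ S, p) = ∏ p ∈ S, jacobiSym a p := by
    intro S
    induction S using Finset.cons_induction with
    | empty => simp
    | cons q S hq ih =>
      intro hS
      rw [Finset.prod_cons, Finset.prod_cons, jacobiSym.mul_right', ih]
      · exact fun p hp => hS p (Finset.mem_cons_of_mem hp)
      · exact (hS q (Finset.mem_cons_self _ _)).ne_zero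
      · exact Finset.prod_ne_zero_iff.2 fun p hp => (hS p (Finset.mem_cons_of_mem hp)).ne_zero
  conv_lhs => rw [← Nat.prod_primeFactors_of_squarefree hm]
  exact key _ fun p hp => Nat.prime_of_mem_primeFactors hp

/-- Hypotheses on `m ∣ n`: the local conditions on `m` at the places of bad reduction. -/
structure LocallyGood (n m : ℕ) : Prop where
  oneModEight : OneModEight m
  squarefree : Squarefree m
  dvd : m ∣ n
  isSquare : ∀ (p : ℕ) [Fact p.Prime], p ∣ 2 * n → ¬ p ∣ m → IsSquare (m : ℚ_[p])

theorem LocallyGood.hilbertAt_eq_one {n m : ℕ} (h : LocallyGood n m) {p : ℕ} [hp : Fact p.Prime]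
    (hpn : p ∣ 2 * n) (hpm : ¬ p ∣ m) (a : (primePlace p).Completion) :
    hilbertAt m (primePlace p) a = 1 := by
  exact (hilbertAt_prime m p a).trans (hilbertSymbol_of_isSquare_right _ (h.isSquare p hpn hpm))

theorem not_dvd_two_mul {n p : ℕ} (h : ¬ p ∣ 2 * n) : p ≠ 2 ∧ ¬ p ∣ n :=
  ⟨fun h2 => h (h2 ▸ dvd_mul_right _ _), fun h' => h (h'.mul_left _)⟩

theorem exists_eq_p_mul_unit {m p : ℕ} [hp : Fact p.Prime] (hm : Squarefree m) (hpm : p ∣ m) :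
    ∃ u : ℚ_[p], ‖u‖ = 1 ∧ (m : ℚ_[p]) = p * u := by
  obtain ⟨k, rfl⟩ := hpm
  refine ⟨(k : ℤ), norm_intCast_eq_one ?_, by push_cast; ring⟩
  intro h
  have h : p ∣ k := by exact_mod_cast h
  have : IsUnit p := hm p (by rw [mul_dvd_mul_iff_left hp.out.ne_zero]; exact h)
  exact hp.out.one_lt.ne' (Nat.isUnit_iff.1 this)

theorem hilbertSymbol_intCast_of_dvd {m p : ℕ} [hp : Fact p.Prime] (hm : OneModEight m) (hsq : Squarefree m)
    (hpm : p ∣ m) {k : ℤ} (hk : ¬ (p : ℤ) ∣ k) :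
    hilbertSymbol (k : ℚ_[p]) (m : ℚ_[p]) = jacobiSym k p := by
  obtain ⟨u, hu, e⟩ := exists_eq_p_mul_unit hsq hpm
  rw [e]; exact hilbertSymbol_intCast (hm.ne_two hp.out hpm) hk hu

/-- The local hypotheses on a conic `z² = A x² + B y²`, relative to `n` and `m`. -/
structure GoodConic (n m : ℕ) (A B : ℤ) : Prop where
  left : ∀ p : ℕ, p.Prime → (p : ℤ) ∣ A → p ∣ 2 * n
  right : ∀ p : ℕ, p.Prime → (p : ℤ) ∣ B → p ∣ 2 * n
  left_ne : A ≠ 0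
  right_ne : B ≠ 0
  tame : ∀ (p : ℕ) [Fact p.Prime], p ∣ m → TameConic (A : ℚ_[p]) B ∧
    hilbertSymbol ((A : ℚ_[p]) * B) m = 1

/-- A scaling factor for the local point `(x, y, z)`. -/
structure IsScale (n : ℕ) (x y z l : (v : Place) → v.Completion) : Prop where
  ne_zero : ∀ v, l v ≠ 0
  maxNorm : ∀ (p : ℕ) [Fact p.Prime], ¬ p ∣ 2 * n →
    MaxNorm (p := p) (x (primePlace p)) (y (primePlace p)) (z (primePlace p))
      (@norm ℚ_[p] _ (l (primePlace p)))

theorem maxNorm_intCast {p : ℕ} [hp : Fact p.Prime] {x y z : ℤ}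
    (h : Int.gcd (Int.gcd x y) z = 1) : MaxNorm (x : ℚ_[p]) y z 1 := by
  refine ⟨Padic.norm_int_le_one _, Padic.norm_int_le_one _, Padic.norm_int_le_one _, ?_⟩
  by_contra hcon
  push Not at hcon
  have h1 : ∀ {k : ℤ}, ‖(k : ℚ_[p])‖ ≠ 1 → (p : ℤ) ∣ k := fun hk => by
    by_contra h; exact hk (norm_intCast_eq_one h)
  have := Int.dvd_coe_gcd (Int.dvd_coe_gcd (h1 hcon.1) (h1 hcon.2.1)) (h1 hcon.2.2)
  rw [h] at this
  exact hp.out.one_lt.ne' (by exact_mod_cast Int.eq_one_of_dvd_one (by positivity) this)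

/-- In tame reduction z has the largest norm, so primitivity makes it a unit. -/
theorem GoodConic.not_dvd {n m : ℕ} {A B : ℤ} (h : GoodConic n m A B) {p : ℕ} [hp : Fact p.Prime]
    (hpm : p ∣ m) {x y z : ℤ} (hg : Int.gcd (Int.gcd x y) z = 1)
    (hQ : z ^ 2 = A * x ^ 2 + B * y ^ 2) : ¬ (p : ℤ) ∣ z := by
  intro hz
  have hm := maxNorm_intCast (p := p) hg
  have hQ' : (z : ℚ_[p]) ^ 2 = A * (x : ℚ_[p]) ^ 2 + B * (y : ℚ_[p]) ^ 2 := by exact_mod_cast hQ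
  obtain ⟨-, h1, h2⟩ := (h.tame p hpm).1.maxNorm hQ' (by
    intro h0
    simp only [Prod.mk.injEq] at h0
    obtain ⟨-, -, -, hm⟩ := hm
    rw [h0.1, h0.2.1, h0.2.2] at hm
    simp at hm)
  have h3 := Padic.norm_intCast_lt_one_iff.2 hz
  obtain ⟨-, -, -, hm⟩ := hm
  rcases hm with h | h | h <;> linarith

/-- T has the symbol of 2zZ; since 2 is a square and Zl has trivial symbol, multiplying by the
symbol of l leaves that of z. -/
theorem hilbertSymbol_polar_tame_int {n m : ℕ} {A B : ℤ} (hm : LocallyGood n m)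
    (hAB : GoodConic n m A B) {p : ℕ} [hp : Fact p.Prime] (hpm : p ∣ m) {X Y Z l : ℚ_[p]}
    (hP : Z ^ 2 = A * X ^ 2 + B * Y ^ 2) (hP0 : (X, Y, Z) ≠ (0, 0, 0)) (hl : l ≠ 0)
    (hlm : hilbertSymbol (Z * l) (m : ℚ_[p]) = 1)
    {x y z : ℤ} (hg : Int.gcd (Int.gcd x y) z = 1) (hQ : z ^ 2 = A * x ^ 2 + B * y ^ 2)
    (hT : polar (A : ℚ_[p]) B x y z X Y Z ≠ 0) :
    hilbertSymbol (polar (A : ℚ_[p]) B x y z X Y Z) (m : ℚ_[p]) * hilbertSymbol l (m : ℚ_[p]) =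
      jacobiSym z p := by
  have h2 := hm.oneModEight.ne_two hp.out hpm
  have h8 := hm.oneModEight.2 p hp.out hpm
  have hm0 : (m : ℚ_[p]) ≠ 0 := by exact_mod_cast hm.oneModEight.1
  have hz := hAB.not_dvd hpm hg hQ
  have hQ' : (z : ℚ_[p]) ^ 2 = A * (x : ℚ_[p]) ^ 2 + B * (y : ℚ_[p]) ^ 2 := by exact_mod_cast hQ
  have hz0 : (z : ℚ_[p]) ≠ 0 := by
    intro h; exact hz (by rw [Int.cast_eq_zero.1 h]; exact dvd_zero _)
  obtain ⟨ht, ht'⟩ := hAB.tame p hpm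
  obtain ⟨hZ, -, -⟩ := ht.maxNorm hP hP0
  have e := hilbertSymbol_polar_tame h2 hm0 ht ht' hQ' hP
    (by intro h; simp only [Prod.mk.injEq] at h; exact hz0 h.2.2) hP0 hT
  rw [hilbertSymbol_mul_left h2 hZ hl hm0] at hlm
  rw [hilbertSymbol_mul_left h2 (mul_ne_zero two_ne_zero hz0) hZ hm0,
    hilbertSymbol_mul_left h2 two_ne_zero hz0 hm0,
    hilbertSymbol_of_isSquare_left _ (isSquare_two_padic h8), one_mul,
    hilbertSymbol_intCast_of_dvd hm.oneModEight hm.squarefree hpm hz] at e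
  rw [e, mul_assoc, hlm, mul_one]

/-- The local contributions of a primitive integral point of a conic. -/
theorem hasPlaceProd_polar_int {n m : ℕ} {A B : ℤ} (hm : LocallyGood n m) (hAB : GoodConic n m A B)
    {X Y Z l : (v : Place) → v.Completion}
    (hP : ∀ v, Z v ^ 2 = (A : v.Completion) * X v ^ 2 + (B : v.Completion) * Y v ^ 2)
    (hP0 : ∀ v, (X v, Y v, Z v) ≠ (0, 0, 0)) (hl : IsScale n X Y Z l)
    (hlm : ∀ (p : ℕ) [Fact p.Prime], p ∣ m →
      hilbertAt m (primePlace p) (Z (primePlace p) * l (primePlace p)) = 1)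
    {x y z : ℤ} (hg : Int.gcd (Int.gcd x y) z = 1) (hQ : z ^ 2 = A * x ^ 2 + B * y ^ 2)
    (hT : ∀ v, polar (A : v.Completion) B x y z (X v) (Y v) (Z v) ≠ 0) :
    HasPlaceProd (fun v => hilbertAt m v (polar (A : v.Completion) B x y z (X v) (Y v) (Z v)) *
      hilbertAt m v (l v)) (jacobiSym z m) := by
  rw [jacobiSym_eq_prod_primeFactors hm.squarefree]
  refine hasPlaceProd_of_primes _ _ (fun p hp => Nat.prime_of_mem_primeFactors hp) ?_ ?_ ?_
  · simp only [hilbertAt_infinite, mul_one]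
  · intro p hp hpm
    have : Fact p.Prime := ⟨hp⟩
    have hpm' : ¬ p ∣ m := fun h => hpm (Nat.mem_primeFactors.2 ⟨hp, h, hm.oneModEight.1⟩)
    -- At a bad prime outside m the number m is a square; at a good prime the conic has good
    -- reduction.
    by_cases hpn : p ∣ 2 * n
    · have h1 := fun a => hm.hilbertAt_eq_one hpn hpm' a
      rw [h1, h1, one_mul]
    · obtain ⟨h2, hpn'⟩ := not_dvd_two_mul hpn
      have hA := norm_intCast_eq_one (p := p) fun h => hpn (hAB.left p hp h)
      have hB := norm_intCast_eq_one (p := p) fun h => hpn (hAB.right p hp h)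
      have hδ := norm_intCast_eq_one (p := p) (k := m) fun h => hpm' (by exact_mod_cast h)
      have hQ' : (z : ℚ_[p]) ^ 2 = A * (x : ℚ_[p]) ^ 2 + B * (y : ℚ_[p]) ^ 2 := by exact_mod_cast hQ
      rw [Int.cast_natCast] at hδ
      have := hilbertSymbol_polar_good h2 hA hB hδ hQ' (hP (primePlace p)) (maxNorm_intCast hg)
        (hl.ne_zero _) (hl.maxNorm p hpn) (hT (primePlace p))
      exact (congrArg₂ (· * ·) (hilbertAt_prime m p _) (hilbertAt_prime m p _)).trans this
  · intro p hp hpm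
    have : Fact p.Prime := ⟨hp⟩
    have hpm' := (Nat.mem_primeFactors.1 hpm).2.1
    exact (congrArg₂ (· * ·) (hilbertAt_prime m p _) (hilbertAt_prime m p _)).trans
      (hilbertSymbol_polar_tame_int hm hAB hpm' (hP (primePlace p)) (hP0 (primePlace p))
        (hl.ne_zero (primePlace p)) ((hilbertAt_prime m p _).symm.trans (hlm p hpm')) hg hQ
        (hT (primePlace p)))

instance Place.instCharZeroCompletion : (v : Place) → CharZero v.Completion
  | .infinite => inferInstanceAs (CharZero ℝ)
  | .finite p hp => haveI : Fact p.Prime := ⟨hp⟩; inferInstanceAs (CharZero ℚ_[p])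

theorem exists_primitive_multiple {x y z : ℚ} (h : (x, y, z) ≠ (0, 0, 0)) :
    ∃ (k : ℚ) (a b c : ℤ), k ≠ 0 ∧ Int.gcd (Int.gcd a b) c = 1 ∧ x = k * a ∧ y = k * b ∧
      z = k * c := by
  have hx := x.mul_den_eq_num
  have hy := y.mul_den_eq_num
  have hz := z.mul_den_eq_num
  have hx0 : (x.den : ℚ) ≠ 0 := by simp
  have hy0 : (y.den : ℚ) ≠ 0 := by simp
  have hz0 : (z.den : ℚ) ≠ 0 := by simp
  set a := x.num * y.den * z.den with ha
  set b := x.den * y.num * z.den with hb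
  set c := x.den * y.den * z.num with hc
  set g := Int.gcd (Int.gcd a b) c with hg
  have hD : (x.den * y.den * z.den : ℚ) ≠ 0 := mul_ne_zero (mul_ne_zero hx0 hy0) hz0
  have ha' : x * (x.den * y.den * z.den) = a := by rw [ha]; push_cast; rw [← hx]; ring
  have hb' : y * (x.den * y.den * z.den) = b := by rw [hb]; push_cast; rw [← hy]; ring
  have hc' : z * (x.den * y.den * z.den) = c := by rw [hc]; push_cast; rw [← hz]; ring
  have hg0 : g ≠ 0 := by
    intro h0
    rw [hg, Int.gcd_eq_zero_iff] at h0
    obtain ⟨h1, h2⟩ := h0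
    have h1 : Int.gcd a b = 0 := by exact_mod_cast h1
    rw [Int.gcd_eq_zero_iff] at h1
    rw [h1.1] at ha'; rw [h1.2] at hb'; rw [h2] at hc'
    apply h
    simp only [Int.cast_zero, mul_eq_zero, hD, or_false] at ha' hb' hc'
    rw [ha', hb', hc']
  have hga : (g : ℤ) ∣ a := (Int.gcd_dvd_left ..).trans (Int.gcd_dvd_left ..)
  have hgb : (g : ℤ) ∣ b := (Int.gcd_dvd_left ..).trans (Int.gcd_dvd_right ..)
  have hgc : (g : ℤ) ∣ c := Int.gcd_dvd_right ..
  obtain ⟨a', ea⟩ := hga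
  obtain ⟨b', eb⟩ := hgb
  obtain ⟨c', ec⟩ := hgc
  have hgQ : (g : ℚ) ≠ 0 := by exact_mod_cast hg0
  refine ⟨g / (x.den * y.den * z.den), a', b', c', div_ne_zero hgQ hD, ?_, ?_, ?_, ?_⟩
  · have e1 : Int.gcd (Int.gcd a b) c = g * Int.gcd (Int.gcd a' b') c' := by
      rw [ea, eb, ec]
      simp only [Int.gcd_mul_left, Int.natAbs_natCast, Nat.cast_mul]
    rw [← hg] at e1
    exact (Nat.mul_right_cancel_iff (Nat.pos_of_ne_zero hg0)).1 (by rw [one_mul, mul_comm, ← e1])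
  · rw [div_mul_eq_mul_div, eq_div_iff hD, ha', ea]; push_cast; ring
  · rw [div_mul_eq_mul_div, eq_div_iff hD, hb', eb]; push_cast; ring
  · rw [div_mul_eq_mul_div, eq_div_iff hD, hc', ec]; push_cast; ring

theorem primitive_ne_zero {x y z : ℤ} (hg : Int.gcd (Int.gcd x y) z = 1) :
    (x, y, z) ≠ (0, 0, 0) := by
  intro h
  simp only [Prod.mk.injEq] at h
  rw [h.1, h.2.1, h.2.2] at hg
  simp at hg

theorem eq_or_eq_neg_of_minors {x y z x' y' z' : ℤ} (hg : Int.gcd (Int.gcd x y) z = 1)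
    (hg' : Int.gcd (Int.gcd x' y') z' = 1) (h2 : y * z' = y' * z)
    (h3 : x * z' = x' * z) : z = z' ∨ z = -z' := by
  have key : ∀ {x y z x' y' z' : ℤ}, Int.gcd (Int.gcd x y) z = 1 → y * z' = y' * z →
      x * z' = x' * z → z ∣ z' := by
    intro x y z x' y' z' hg h2 h3
    have a : z ∣ Int.gcd (Int.gcd x y) z * z' := by
      rw [Int.gcd_eq_gcd_ab (Int.gcd x y) z, Int.gcd_eq_gcd_ab x y]
      exact ⟨x' * Int.gcdA x y * Int.gcdA (x.gcd y) z + y' * Int.gcdB x y * Int.gcdA (x.gcd y) z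
        + z' * Int.gcdB (x.gcd y) z, by
          rw [← Int.gcd_eq_gcd_ab x y]
          have e := Int.gcd_eq_gcd_ab x y
          linear_combination (Int.gcdA x y * Int.gcdA (x.gcd y) z) * h3 +
            (Int.gcdB x y * Int.gcdA (x.gcd y) z) * h2 + Int.gcdA (x.gcd y) z * z' * e⟩
    rw [hg] at a
    simpa using a
  have a := key hg h2 h3
  have b := key hg' (x' := x) (y' := y) (z' := z) h2.symm h3.symm
  exact Int.natAbs_eq_natAbs_iff.1 (Nat.dvd_antisymm (Int.natAbs_dvd_natAbs.2 a)
    (Int.natAbs_dvd_natAbs.2 b))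

/-- Mutually orthogonal isotropic vectors of a nondegenerate ternary form are proportional: each
squared minor, times a nonzero coefficient, vanishes. -/
theorem minors_of_polar_eq_zero {A B x y z x' y' z' : ℤ} (hA : A ≠ 0) (hB : B ≠ 0)
    (hQ : z ^ 2 = A * x ^ 2 + B * y ^ 2) (hQ' : z' ^ 2 = A * x' ^ 2 + B * y' ^ 2)
    (h : z * z' - A * x * x' - B * y * y' = 0) :
    x * y' = x' * y ∧ y * z' = y' * z ∧ x * z' = x' * z := by
  have aux : ∀ {k e : ℤ}, k ≠ 0 → k * e ^ 2 = 0 → e = 0 := fun hk he =>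
    pow_eq_zero_iff two_ne_zero |>.1 ((mul_eq_zero.1 he).resolve_left hk)
  refine ⟨sub_eq_zero.1 (aux (mul_ne_zero hA hB) ?_), sub_eq_zero.1 (aux hB ?_),
    sub_eq_zero.1 (aux hA ?_)⟩
  · linear_combination (z' ^ 2) * (-hQ) - (A * x ^ 2 + B * y ^ 2) * hQ'
      + (z * z' + A * x * x' + B * y * y') * h
  · linear_combination (z * z' - B * y * y' + A * x * x') * h - (z' ^ 2 - B * y' ^ 2) * hQ
      - A * x ^ 2 * hQ'
  · linear_combination (z * z' - A * x * x' + B * y * y') * h - (z' ^ 2 - A * x' ^ 2) * hQ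
      - B * y ^ 2 * hQ'

theorem isScale_one {n : ℕ} {x y z : ℤ} (hg : Int.gcd (Int.gcd x y) z = 1)
    {q : Place → ℚ} (hq : ∀ v, q v ≠ 0)
    (hq1 : ∀ (p : ℕ) [Fact p.Prime], ¬ p ∣ 2 * n → q (primePlace p) = 1) :
    IsScale n (fun v => (x : v.Completion)) (fun v => (y : v.Completion))
      (fun v => (z : v.Completion)) (fun v => (q v : v.Completion)) := by
  refine ⟨fun v => by exact_mod_cast hq v, fun p hp hpn => ?_⟩
  have e : @norm ℚ_[p] _ ((q (primePlace p) : ℚ) : ℚ_[p]) = 1 := by rw [hq1 p hpn]; simp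
  have := maxNorm_intCast (p := p) hg
  rw [← e] at this
  exact this

/-- The second point serves as local point at every place. The polar form of the two points is then
one rational number: if it is nonzero the product formula removes it and equates the two symbols; if
it is zero, the points agree up to sign, and −1 is a residue. -/
theorem jacobiSym_eq_of_primitive {n m : ℕ} {A B : ℤ} (hm : LocallyGood n m)
    (hAB : GoodConic n m A B) {x y z x' y' z' : ℤ} (hg : Int.gcd (Int.gcd x y) z = 1)
    (hQ : z ^ 2 = A * x ^ 2 + B * y ^ 2) (hg' : Int.gcd (Int.gcd x' y') z' = 1)
    (hQ' : z' ^ 2 = A * x' ^ 2 + B * y' ^ 2) : jacobiSym z m = jacobiSym z' m := by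
  by_cases h0 : z * z' - A * x * x' - B * y * y' = 0
  · obtain ⟨-, h2, h3⟩ := minors_of_polar_eq_zero hAB.left_ne hAB.right_ne hQ hQ' h0
    rcases eq_or_eq_neg_of_minors hg hg' h2 h3 with h | h
    · rw [h]
    · rw [h, ← neg_one_mul, jacobiSym.mul_left, hm.oneModEight.jacobiSym_neg_one, one_mul]
  have hz' : ∀ (p : ℕ) [Fact p.Prime], p ∣ m → z' ≠ 0 := fun p _ hpm h =>
    hAB.not_dvd hpm hg' hQ' (h ▸ dvd_zero _)
  -- At p ∣ m the scale is z' itself, which makes z' times the scale a square; elsewhere it is 1,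
  -- the point being primitive.
  let q : Place → ℚ := fun v => match v with
    | .infinite => 1
    | .finite p _ => if p ∣ m then z' else 1
  have hq : ∀ (p : ℕ) [Fact p.Prime], p ∣ m → q (primePlace p) = z' := fun p _ h => if_pos h
  have hq' : ∀ (p : ℕ) [Fact p.Prime], ¬ p ∣ m → q (primePlace p) = 1 := fun p _ h => if_neg h
  have hq0 : ∀ v, q v ≠ 0 := by
    intro v
    cases v with
    | infinite => exact one_ne_zero
    | finite p hp =>
      have : Fact p.Prime := ⟨hp⟩
      by_cases h : p ∣ m
      · rw [hq p h]; exact_mod_cast hz' p h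
      · rw [hq' p h]; exact one_ne_zero
  have hcast : ∀ v : Place, polar (A : v.Completion) B x y z x' y' z' =
      (((z * z' - A * x * x' - B * y * y' : ℤ) : ℚ) : v.Completion) := fun v => by
    unfold polar; push_cast; ring
  have h1 := hasPlaceProd_polar_int hm hAB (X := fun v => (x' : v.Completion))
    (Y := fun v => (y' : v.Completion)) (Z := fun v => (z' : v.Completion))
    (l := fun v => (q v : v.Completion)) (fun v => by exact_mod_cast hQ')
    (fun v h => primitive_ne_zero hg' (by
      simp only [Prod.mk.injEq, Int.cast_eq_zero] at h ⊢; exact h))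
    (isScale_one hg' hq0 fun p _ hp => hq' p fun h => hp ((h.trans hm.dvd).mul_left _))
    (fun p _ hp => by
      rw [hilbertAt_mul hm.oneModEight _ (by exact_mod_cast hz' p hp)
          (by exact_mod_cast hq0 (primePlace p)),
        hq p hp, Rat.cast_intCast]
      exact hilbertAt_mul_self _ _ _) hg hQ
    (fun v => by rw [hcast]; exact_mod_cast h0)
  have h2 : HasPlaceProd (fun v => hilbertAt m v (q v : v.Completion)) (jacobiSym z' m) := by
    rw [jacobiSym_eq_prod_primeFactors hm.squarefree]
    refine hasPlaceProd_of_primes _ _ (fun p hp => Nat.prime_of_mem_primeFactors hp)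
      (hilbertAt_infinite _ _) (fun p hp hpm => ?_) (fun p hp hpm => ?_)
    · have : Fact p.Prime := ⟨hp⟩
      have hpm' : ¬ p ∣ m := fun h => hpm (Nat.mem_primeFactors.2 ⟨hp, h, hm.oneModEight.1⟩)
      have e : q (.finite p hp) = 1 := hq' p hpm'
      rw [e, hilbertAt_ratCast hm.oneModEight]
      exact oddHilbert_one_left _ _
    · have : Fact p.Prime := ⟨hp⟩
      have hpm' := (Nat.mem_primeFactors.1 hpm).2.1
      have e : q (.finite p hp) = z' := hq p hpm'
      rw [e, hilbertAt_ratCast hm.oneModEight, oddHilbert_finite hp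
        (hm.oneModEight.ne_two hp hpm')]
      push_cast
      exact hilbertSymbol_intCast_of_dvd hm.oneModEight hm.squarefree hpm'
        (hAB.not_dvd hpm' hg' hQ')
  have h3 := ((hasPlaceProd_oddHilbert hm.oneModEight.1 hm.oneModEight.2
    (a := ((z * z' - A * x * x' - B * y * y' : ℤ) : ℚ)) (by exact_mod_cast h0)).mul h2).congr
    (g := fun v => hilbertAt m v (polar (A : v.Completion) B x y z x' y' z') *
      hilbertAt m v (q v : v.Completion)) (fun v => by
      rw [hcast, hilbertAt_ratCast hm.oneModEight])
  rw [one_mul] at h3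
  exact h1.unique h3

/-- The total contribution of a rational point of a conic. -/
theorem hasPlaceProd_polar {n m : ℕ} {A B : ℤ} (hm : LocallyGood n m) (hAB : GoodConic n m A B)
    {X Y Z l : (v : Place) → v.Completion}
    (hP : ∀ v, Z v ^ 2 = (A : v.Completion) * X v ^ 2 + (B : v.Completion) * Y v ^ 2)
    (hP0 : ∀ v, (X v, Y v, Z v) ≠ (0, 0, 0)) (hl : IsScale n X Y Z l)
    (hlm : ∀ (p : ℕ) [Fact p.Prime], p ∣ m →
      hilbertAt m (primePlace p) (Z (primePlace p) * l (primePlace p)) = 1)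
    {x y z : ℚ} (h0 : (x, y, z) ≠ (0, 0, 0)) (hQ : z ^ 2 = A * x ^ 2 + B * y ^ 2)
    {x₀ y₀ z₀ : ℤ} (hg₀ : Int.gcd (Int.gcd x₀ y₀) z₀ = 1)
    (hQ₀ : z₀ ^ 2 = A * x₀ ^ 2 + B * y₀ ^ 2)
    (hT : ∀ v, polar (A : v.Completion) B x y z (X v) (Y v) (Z v) ≠ 0) :
    HasPlaceProd (fun v => hilbertAt m v (polar (A : v.Completion) B x y z (X v) (Y v) (Z v)) *
      hilbertAt m v (l v)) (jacobiSym z₀ m) := by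
  obtain ⟨k, a, b, c, hk, hg, rfl, rfl, rfl⟩ := exists_primitive_multiple h0
  have hQ' : c ^ 2 = A * a ^ 2 + B * b ^ 2 := by
    have : (k ^ 2 : ℚ) * c ^ 2 = k ^ 2 * (A * a ^ 2 + B * b ^ 2) := by linear_combination hQ
    exact_mod_cast mul_left_cancel₀ (pow_ne_zero 2 hk) this
  have e : ∀ v, polar (A : v.Completion) B ((k * a : ℚ) : v.Completion) ((k * b : ℚ) : v.Completion)
      ((k * c : ℚ) : v.Completion) (X v) (Y v) (Z v) =
      (k : v.Completion) * polar (A : v.Completion) B a b c (X v) (Y v) (Z v) := fun v => by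
    unfold polar; push_cast; ring
  have hT' : ∀ v, polar (A : v.Completion) B a b c (X v) (Y v) (Z v) ≠ 0 := fun v h =>
    hT v (by rw [e, h, mul_zero])
  have h1 := hasPlaceProd_polar_int hm hAB hP hP0 hl hlm hg hQ' hT'
  have h2 := (hasPlaceProd_oddHilbert hm.oneModEight.1 hm.oneModEight.2 hk).mul h1
  rw [one_mul, jacobiSym_eq_of_primitive hm hAB hg hQ' hg₀ hQ₀] at h2
  refine h2.congr fun v => ?_
  rw [e, hilbertAt_mul hm.oneModEight v (by exact_mod_cast hk) (hT' v),
    hilbertAt_ratCast hm.oneModEight, mul_assoc]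

/-- The Gram determinant of (a, b, c), (X, Y, Z) and (1, 0, 1) shows that 2T(Z − X)(c − a) is m'
times a square, and both 2 and m' are squares in ℚ_p. -/
theorem hilbertSymbol_polar_one {m m' p : ℕ} [hp : Fact p.Prime] (hm : OneModEight m)
    (hpm : p ∣ m) (hsq : IsSquare (m' : ℚ_[p])) {X Y Z l : ℚ_[p]} (hl : l ≠ 0)
    (hP : Z ^ 2 = ((1 : ℤ) : ℚ_[p]) * X ^ 2 + ((m' : ℤ) : ℚ_[p]) * Y ^ 2) (hZX : Z - X ≠ 0)
    (hlm : hilbertSymbol ((Z - X) * l) (m : ℚ_[p]) = 1) {a b c : ℤ}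
    (hQ : c ^ 2 = 1 * a ^ 2 + (m' : ℤ) * b ^ 2) (hca : c - a ≠ 0)
    (hT : polar ((1 : ℤ) : ℚ_[p]) (m' : ℤ) a b c X Y Z ≠ 0) :
    hilbertSymbol (polar ((1 : ℤ) : ℚ_[p]) (m' : ℤ) a b c X Y Z) (m : ℚ_[p]) *
      hilbertSymbol l (m : ℚ_[p]) = hilbertSymbol ((c - a : ℤ) : ℚ_[p]) (m : ℚ_[p]) := by
  have h2 := hm.ne_two hp.out hpm
  have hm0 : (m : ℚ_[p]) ≠ 0 := by exact_mod_cast hm.1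
  have hca' : ((c - a : ℤ) : ℚ_[p]) ≠ 0 := by exact_mod_cast hca
  have hQ' : (c : ℚ_[p]) ^ 2 = ((1 : ℤ) : ℚ_[p]) * (a : ℚ_[p]) ^ 2 +
    ((m' : ℤ) : ℚ_[p]) * (b : ℚ_[p]) ^ 2 := by exact_mod_cast hQ
  have key := two_mul_polar_mul_polar_mul_polar hQ' hP (x'' := 1) (y'' := 0) (z'' := 1) (by simp)
  have e1 : polar ((1 : ℤ) : ℚ_[p]) (m' : ℤ) X Y Z 1 0 1 = Z - X := by unfold polar; simp
  have e2 : polar ((1 : ℤ) : ℚ_[p]) (m' : ℤ) a b c 1 0 1 = ((c - a : ℤ) : ℚ_[p]) := by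
    unfold polar; simp
  rw [e1, e2] at key
  set T := polar ((1 : ℤ) : ℚ_[p]) (m' : ℤ) a b c X Y Z
  have h : hilbertSymbol (2 * T * (Z - X) * ((c - a : ℤ) : ℚ_[p])) (m : ℚ_[p]) = 1 := by
    rw [key]
    refine hilbertSymbol_of_isSquare_left _ (IsSquare.mul ?_ (IsSquare.sq _))
    simpa using hsq
  rw [hilbertSymbol_mul_left h2 (mul_ne_zero (mul_ne_zero two_ne_zero hT) hZX) hca' hm0,
    hilbertSymbol_mul_left h2 (mul_ne_zero two_ne_zero hT) hZX hm0,
    hilbertSymbol_mul_left h2 two_ne_zero hT hm0,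
    hilbertSymbol_of_isSquare_left _ (isSquare_two_padic (hm.2 p hp.out hpm)), one_mul] at h
  rw [hilbertSymbol_mul_left h2 hZX hl hm0] at hlm
  rcases hilbertSymbol_eq_one_or T (m : ℚ_[p]) with h1 | h1 <;>
  rcases hilbertSymbol_eq_one_or l (m : ℚ_[p]) with h3 | h3 <;>
  rcases hilbertSymbol_eq_one_or (Z - X) (m : ℚ_[p]) with h4 | h4 <;>
  rcases hilbertSymbol_eq_one_or ((c - a : ℤ) : ℚ_[p]) (m : ℚ_[p]) with h5 | h5 <;>
  rw [h1, h4, h5] at h <;> rw [h4, h3] at hlm <;> rw [h1, h3, h5] <;> omega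

/-- The conic `z² = x² + d' y²` at the primes dividing `d`, where it has good reduction and the
rational point `(1, 0, 1)` serves as a reference point. -/
theorem hasPlaceProd_polar_one {n m m' : ℕ} (hm : LocallyGood n m) (hmm : n = m * m') (hn : n ≠ 0)
    (hsq : ∀ (p : ℕ) [Fact p.Prime], p ∣ m → IsSquare (m' : ℚ_[p]))
    {X Y Z l : (v : Place) → v.Completion}
    (hP : ∀ v, Z v ^ 2 = ((1 : ℤ) : v.Completion) * X v ^ 2 + ((m' : ℤ) : v.Completion) * Y v ^ 2)
    (hl : IsScale n X Y Z l)
    (hlm : ∀ (p : ℕ) [Fact p.Prime], p ∣ m → Z (primePlace p) - X (primePlace p) ≠ 0 ∧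
      hilbertAt m (primePlace p) ((Z (primePlace p) - X (primePlace p)) * l (primePlace p)) = 1)
    {x y z : ℚ} (h0 : (x, y, z) ≠ (0, 0, 0)) (hQ : z ^ 2 = (1 : ℤ) * x ^ 2 + (m' : ℤ) * y ^ 2)
    (hT : ∀ v, polar ((1 : ℤ) : v.Completion) (m' : ℤ) x y z (X v) (Y v) (Z v) ≠ 0) :
    HasPlaceProd (fun v => hilbertAt m v
      (polar ((1 : ℤ) : v.Completion) (m' : ℤ) x y z (X v) (Y v) (Z v)) *
        hilbertAt m v (l v)) 1 := by
  obtain ⟨k, a, b, c, hk, hg, rfl, rfl, rfl⟩ := exists_primitive_multiple h0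
  have hQ' : c ^ 2 = 1 * a ^ 2 + (m' : ℤ) * b ^ 2 := by
    have : (k ^ 2 : ℚ) * c ^ 2 = k ^ 2 * (1 * a ^ 2 + (m' : ℤ) * b ^ 2) := by
      push_cast at hQ ⊢; linear_combination hQ
    exact_mod_cast mul_left_cancel₀ (pow_ne_zero 2 hk) this
  have hm' : m' ≠ 0 := by rintro rfl; exact hn (by rw [hmm, mul_zero])
  have e : ∀ v, polar ((1 : ℤ) : v.Completion) (m' : ℤ) ((k * a : ℚ) : v.Completion)
      ((k * b : ℚ) : v.Completion) ((k * c : ℚ) : v.Completion) (X v) (Y v) (Z v) =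
      (k : v.Completion) * polar ((1 : ℤ) : v.Completion) (m' : ℤ) a b c (X v) (Y v) (Z v) :=
    fun v => by unfold polar; push_cast; ring
  have hT' : ∀ v, polar ((1 : ℤ) : v.Completion) (m' : ℤ) a b c (X v) (Y v) (Z v) ≠ 0 :=
    fun v h => hT v (by rw [e, h, mul_zero])
  suffices h : HasPlaceProd (fun v => hilbertAt m v
      (polar ((1 : ℤ) : v.Completion) (m' : ℤ) a b c (X v) (Y v) (Z v)) *
        hilbertAt m v (l v)) 1 by
    have h2 := (hasPlaceProd_oddHilbert hm.oneModEight.1 hm.oneModEight.2 hk).mul h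
    rw [one_mul] at h2
    refine h2.congr fun v => ?_
    rw [e, hilbertAt_mul hm.oneModEight v (by exact_mod_cast hk) (hT' v),
      hilbertAt_ratCast hm.oneModEight, mul_assoc]
  have good : ∀ (p : ℕ) [Fact p.Prime], ¬ p ∣ 2 * n → ∀ {X Y Z l : ℚ_[p]},
      Z ^ 2 = ((1 : ℤ) : ℚ_[p]) * X ^ 2 + ((m' : ℤ) : ℚ_[p]) * Y ^ 2 → l ≠ 0 →
      MaxNorm X Y Z ‖l‖ → polar ((1 : ℤ) : ℚ_[p]) (m' : ℤ) a b c X Y Z ≠ 0 →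
      hilbertSymbol (polar ((1 : ℤ) : ℚ_[p]) (m' : ℤ) a b c X Y Z) (m : ℚ_[p]) *
        hilbertSymbol l (m : ℚ_[p]) = 1 := by
    intro p hp hpn X Y Z l hP hl hlP hT
    obtain ⟨h2, hpn'⟩ := not_dvd_two_mul hpn
    have hA : ‖((1 : ℤ) : ℚ_[p])‖ = 1 := by simp
    have hB := norm_intCast_eq_one (p := p) (k := (m' : ℤ)) fun h => hpn' (by
      rw [hmm]; exact (Int.natCast_dvd_natCast.1 h).mul_left _)
    have hδ := norm_intCast_eq_one (p := p) (k := (m : ℤ)) fun h => hpn' (by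
      rw [hmm]; exact (Int.natCast_dvd_natCast.1 h).mul_right _)
    rw [Int.cast_natCast] at hδ
    exact hilbertSymbol_polar_good h2 hA hB hδ (by exact_mod_cast hQ') hP (maxNorm_intCast hg)
      hl hlP hT
  -- Equality c = a happens only for ±(1, 0, 1), whose polar form with the local point is ±(Z − X).
  by_cases hca : c - a = 0
  · have hca : c = a := sub_eq_zero.1 hca
    subst hca
    have hb : b = 0 := by simpa [hm'] using hQ'
    subst hb
    have hc : c = 1 ∨ c = -1 := by
      rw [Int.gcd_zero_right] at hg
      have : Int.gcd c.natAbs c = c.natAbs := by simp [Int.gcd, Int.natAbs_abs]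
      rw [this] at hg
      exact Int.natAbs_eq_iff.1 hg
    refine hasPlaceProd_one fun v => ?_
    cases v with
    | infinite => simp only [hilbertAt_infinite, mul_one]
    | finite p hp =>
      have : Fact p.Prime := ⟨hp⟩
      by_cases hpm : p ∣ m
      · obtain ⟨h1, h2⟩ := hlm p hpm
        rw [hilbertAt_mul hm.oneModEight _ h1 (hl.ne_zero _)] at h2
        have h3 : polar (((1 : ℤ) : (primePlace p).Completion)) (m' : ℤ) c ((0 : ℤ)) c
            (X (primePlace p)) (Y (primePlace p)) (Z (primePlace p)) =
            ((c : ℚ) : (primePlace p).Completion) * (Z (primePlace p) - X (primePlace p)) := by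
          unfold polar; push_cast; ring
        have h4 : hilbertAt m (primePlace p) ((c : ℚ) : (primePlace p).Completion) = 1 := by
          rw [hilbertAt_ratCast hm.oneModEight,
            oddHilbert_finite hp (hm.oneModEight.ne_two hp hpm)]
          apply hilbertSymbol_of_isSquare_left
          rcases hc with rfl | rfl
          · simp
          · simpa using isSquare_neg_one_padic (hm.oneModEight.2 p hp hpm)
        have hc0 : ((c : ℚ) : (primePlace p).Completion) ≠ 0 := by
          have : c ≠ 0 := by rintro rfl; simp at hc
          exact_mod_cast this
        rw [h3, hilbertAt_mul hm.oneModEight _ hc0 h1, h4, one_mul]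
        exact h2
      · by_cases hpn : p ∣ 2 * n
        · have h1 := fun a => hm.hilbertAt_eq_one hpn hpm a
          rw [h1, h1, one_mul]
        · exact (congrArg₂ (· * ·) (hilbertAt_prime m p _) (hilbertAt_prime m p _)).trans
            (good p hpn (hP (primePlace p)) (hl.ne_zero (primePlace p)) (hl.maxNorm p hpn)
              (hT' (primePlace p)))
  · have hca' : ((c - a : ℤ) : ℚ) ≠ 0 := by exact_mod_cast hca
    -- The local factor is compared at every place with the symbol of the rational number c − a, for
    -- which the product formula holds.
    refine (hasPlaceProd_oddHilbert hm.oneModEight.1 hm.oneModEight.2 hca').congr fun v => ?_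
    rw [← hilbertAt_ratCast hm.oneModEight]
    cases v with
    | infinite => simp only [hilbertAt_infinite, mul_one]
    | finite p hp =>
      have : Fact p.Prime := ⟨hp⟩
      have e3 : hilbertAt m (primePlace p) (((c - a : ℤ) : ℚ) : (primePlace p).Completion) =
        hilbertSymbol ((c - a : ℤ) : ℚ_[p]) (m : ℚ_[p]) := by
          rw [Rat.cast_intCast]; exact hilbertAt_prime _ _ _
      by_cases hpm : p ∣ m
      · obtain ⟨h1, h2⟩ := hlm p hpm
        refine ((congrArg₂ (· * ·) (hilbertAt_prime m p _) (hilbertAt_prime m p _)).trans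
            (hilbertSymbol_polar_one hm.oneModEight hpm (hsq p hpm) (hl.ne_zero (primePlace p))
              (hP (primePlace p)) h1 ((hilbertAt_prime m p _).symm.trans h2) hQ' hca
              (hT' (primePlace p)))).trans e3.symm
      · by_cases hpn : p ∣ 2 * n
        · have h1 := fun a => hm.hilbertAt_eq_one hpn hpm a
          rw [h1, h1, h1, one_mul]
        · refine ((congrArg₂ (· * ·) (hilbertAt_prime m p _) (hilbertAt_prime m p _)).trans
            (good p hpn (hP (primePlace p)) (hl.ne_zero (primePlace p)) (hl.maxNorm p hpn)
              (hT' (primePlace p)))).trans (Eq.trans ?_ e3.symm)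
          have e2 : polar ((1 : ℤ) : ℚ_[p]) (m' : ℤ) a b c 1 0 1 = ((c - a : ℤ) : ℚ_[p]) := by
            unfold polar; simp
          -- With (1, 0, 1) as local point of scale 1, good reduction shows that c − a has trivial
          -- symbol.
          have := good p hpn (X := 1) (Y := 0) (Z := 1) (l := 1) (by simp) one_ne_zero
            (by simp [MaxNorm]) (by rw [e2]; exact_mod_cast hca)
          rw [e2, hilbertSymbol_of_isSquare_left _ (show IsSquare (1 : ℚ_[p]) by simp), mul_one] at this
          exact this.symm

/-! ### Coordinates on the curves `D_Λ` -/

section Coordinates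

variable {n d d' : ℕ} {D : Fin 3 → ℚˣ} {F : Type*} [Field F]

theorem isCurvePoint_iff [CharZero F] {x : Fin 4 → F} : IsCurvePoint n D x ↔ x ≠ 0 ∧
    -(n : F) * x 0 ^ 2 + ((D 1 : ℚ) : F) * x 2 ^ 2 - ((D 2 : ℚ) : F) * x 3 ^ 2 = 0 ∧
    -(n : F) * x 0 ^ 2 + ((D 2 : ℚ) : F) * x 3 ^ 2 - ((D 0 : ℚ) : F) * x 1 ^ 2 = 0 ∧
    2 * (n : F) * x 0 ^ 2 + ((D 0 : ℚ) : F) * x 1 ^ 2 - ((D 1 : ℚ) : F) * x 2 ^ 2 = 0 := by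
  simp only [IsCurvePoint, diagForm, quadricCoeff, quadricVars, Fin.sum_univ_three,
    Fin.forall_fin_succ]
  simp [sub_eq_add_neg, sq, mul_assoc]

theorem isConicPoint_iff_zero {q : Fin 3 → ℚ} : IsConicPoint n D 0 q ↔ q ≠ 0 ∧
    -(n : ℚ) * q 0 ^ 2 + (D 1 : ℚ) * q 1 ^ 2 - (D 2 : ℚ) * q 2 ^ 2 = 0 := by
  simp [IsConicPoint, diagForm, quadricCoeff, Fin.sum_univ_three, sub_eq_add_neg, sq, mul_assoc]

theorem isConicPoint_iff_one {q : Fin 3 → ℚ} : IsConicPoint n D 1 q ↔ q ≠ 0 ∧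
    -(n : ℚ) * q 0 ^ 2 + (D 2 : ℚ) * q 1 ^ 2 - (D 0 : ℚ) * q 2 ^ 2 = 0 := by
  simp [IsConicPoint, diagForm, quadricCoeff, Fin.sum_univ_three, sub_eq_add_neg, sq, mul_assoc]

theorem isConicPoint_iff_two {q : Fin 3 → ℚ} : IsConicPoint n D 2 q ↔ q ≠ 0 ∧
    2 * (n : ℚ) * q 0 ^ 2 + (D 0 : ℚ) * q 1 ^ 2 - (D 1 : ℚ) * q 2 ^ 2 = 0 := by
  simp [IsConicPoint, diagForm, quadricCoeff, Fin.sum_univ_three, sub_eq_add_neg, sq, mul_assoc]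

theorem tangentForm_zero (q : Fin 3 → ℚ) (x : Fin 4 → F) : tangentForm n D 0 q x =
    -(n : F) * q 0 * x 0 + ((D 1 : ℚ) : F) * q 1 * x 2 - ((D 2 : ℚ) : F) * q 2 * x 3 := by
  simp [tangentForm, diagForm, quadricCoeff, quadricVars, Fin.sum_univ_three, sub_eq_add_neg]

theorem tangentForm_one (q : Fin 3 → ℚ) (x : Fin 4 → F) : tangentForm n D 1 q x =
    -(n : F) * q 0 * x 0 + ((D 2 : ℚ) : F) * q 1 * x 3 - ((D 0 : ℚ) : F) * q 2 * x 1 := by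
  simp [tangentForm, diagForm, quadricCoeff, quadricVars, Fin.sum_univ_three, sub_eq_add_neg]

theorem tangentForm_two [CharZero F] (q : Fin 3 → ℚ) (x : Fin 4 → F) : tangentForm n D 2 q x =
    2 * (n : F) * q 0 * x 0 + ((D 0 : ℚ) : F) * q 1 * x 1 - ((D 1 : ℚ) : F) * q 2 * x 2 := by
  simp [tangentForm, diagForm, quadricCoeff, quadricVars, Fin.sum_univ_three, sub_eq_add_neg]

theorem exists_eq_mul_sq_of_class {u : ℚˣ} {q : ℚ} (hq : q ≠ 0) (h : (u : SqClass) = sqClass q) :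
    ∃ s : ℚ, s ≠ 0 ∧ (u : ℚ) = q * s ^ 2 := by
  rw [sqClass, dif_neg hq, eq_comm, QuotientGroup.eq] at h
  obtain ⟨s, hs⟩ := h
  refine ⟨s, s.ne_zero, ?_⟩
  have := congrArg (Units.val) hs
  simp only [powMonoidHom_apply, Units.val_pow_eq_pow_val, Units.val_mul, Units.val_inv_eq_inv_val,
    Units.val_mk0] at this
  rw [this]; field_simp

theorem exists_eq_sq_of_class {u : ℚˣ} (h : (u : SqClass) = 1) :
    ∃ s : ℚ, s ≠ 0 ∧ (u : ℚ) = s ^ 2 := by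
  rw [QuotientGroup.eq_one_iff] at h
  obtain ⟨s, hs⟩ := h
  refine ⟨s, s.ne_zero, ?_⟩
  have := congrArg (Units.val) hs
  simpa using this.symm

/-- Representatives of the class `(1, d, d)`. -/
def IsRep (d : ℕ) (D : Fin 3 → ℚˣ) (s : Fin 3 → ℚ) : Prop :=
  (∀ i, s i ≠ 0) ∧ (D 0 : ℚ) = s 0 ^ 2 ∧ (D 1 : ℚ) = d * s 1 ^ 2 ∧ (D 2 : ℚ) = d * s 2 ^ 2

/-- Representatives of the class `(d, d, 1)`. -/
def IsRep' (d : ℕ) (D : Fin 3 → ℚˣ) (s : Fin 3 → ℚ) : Prop :=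
  (∀ i, s i ≠ 0) ∧ (D 0 : ℚ) = d * s 0 ^ 2 ∧ (D 1 : ℚ) = d * s 1 ^ 2 ∧ (D 2 : ℚ) = s 2 ^ 2

theorem exists_isRep (hd : d ≠ 0) (h : ∀ i, (D i : SqClass) = Lam d i) : ∃ s, IsRep d D s := by
  have hd' : (d : ℚ) ≠ 0 := by exact_mod_cast hd
  obtain ⟨s0, h0, e0⟩ := exists_eq_sq_of_class (u := D 0) (by rw [h]; rfl)
  obtain ⟨s1, h1, e1⟩ := exists_eq_mul_sq_of_class (u := D 1) hd' (by rw [h]; rfl)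
  obtain ⟨s2, h2, e2⟩ := exists_eq_mul_sq_of_class (u := D 2) hd' (by rw [h]; rfl)
  refine ⟨![s0, s1, s2], ?_, e0, e1, e2⟩
  intro i; fin_cases i <;> assumption

theorem exists_isRep' (hd : d ≠ 0) (h : ∀ i, (D i : SqClass) = Lam' d i) : ∃ s, IsRep' d D s := by
  have hd' : (d : ℚ) ≠ 0 := by exact_mod_cast hd
  obtain ⟨s0, h0, e0⟩ := exists_eq_mul_sq_of_class (u := D 0) hd' (by rw [h]; rfl)
  obtain ⟨s1, h1, e1⟩ := exists_eq_mul_sq_of_class (u := D 1) hd' (by rw [h]; rfl)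
  obtain ⟨s2, h2, e2⟩ := exists_eq_sq_of_class (u := D 2) (by rw [h]; rfl)
  refine ⟨![s0, s1, s2], ?_, e0, e1, e2⟩
  intro i; fin_cases i <;> assumption

variable [CharZero F]

/-- Absorbing the square factors of the representatives and dividing u₁ by d cancels the common
factor d, so the coefficients become those of the ternary equations for c and γ. -/
theorem IsRep.curve {s : Fin 3 → ℚ} (hs : IsRep d D s) (hn : n = d * d') (hd : d ≠ 0)
    {x : Fin 4 → F} (hx : IsCurvePoint n D x) :
    (x 0, s 0 * x 1 / d, s 1 * x 2, s 2 * x 3) ≠ (0, 0, 0, 0) ∧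
    (s 1 * x 2) ^ 2 = (s 2 * x 3) ^ 2 + d' * x 0 ^ 2 ∧
    (s 2 * x 3) ^ 2 = d * (s 0 * x 1 / d) ^ 2 + d' * x 0 ^ 2 := by
  obtain ⟨h0, e1, e2, -⟩ := isCurvePoint_iff.1 hx
  obtain ⟨hs0, a, b, c⟩ := hs
  have hd' : (d : F) ≠ 0 := by exact_mod_cast hd
  have hs' : ∀ i, ((s i : ℚ) : F) ≠ 0 := fun i => by exact_mod_cast hs0 i
  simp only [a, b, c, hn] at e1 e2
  push_cast at e1 e2 ⊢
  refine ⟨fun h => h0 ?_, ?_, ?_⟩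
  · simp only [Prod.mk.injEq, div_eq_zero_iff, mul_eq_zero, hs', hd', false_or, or_false] at h
    ext i; fin_cases i
    · exact h.1
    · exact h.2.1
    · exact h.2.2.1
    · exact h.2.2.2
  · apply mul_left_cancel₀ hd'; linear_combination e1
  · apply mul_left_cancel₀ hd'; field_simp; linear_combination e2

theorem IsRep'.curve {s : Fin 3 → ℚ} (hs : IsRep' d D s) (hn : n = d * d') (hd : d ≠ 0)
    {x : Fin 4 → F} (hx : IsCurvePoint n D x) :
    (x 0, s 0 * x 1, s 1 * x 2, s 2 * x 3 / d) ≠ (0, 0, 0, 0) ∧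
    (s 1 * x 2) ^ 2 = d * (s 2 * x 3 / d) ^ 2 + d' * x 0 ^ 2 ∧
    (s 0 * x 1) ^ 2 = d * (s 2 * x 3 / d) ^ 2 - d' * x 0 ^ 2 := by
  obtain ⟨h0, e1, e2, -⟩ := isCurvePoint_iff.1 hx
  obtain ⟨hs0, a, b, c⟩ := hs
  have hd' : (d : F) ≠ 0 := by exact_mod_cast hd
  have hs' : ∀ i, ((s i : ℚ) : F) ≠ 0 := fun i => by exact_mod_cast hs0 i
  simp only [a, b, c, hn] at e1 e2
  push_cast at e1 e2 ⊢
  refine ⟨fun h => h0 ?_, ?_, ?_⟩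
  · simp only [Prod.mk.injEq, div_eq_zero_iff, mul_eq_zero, hs', hd', false_or, or_false] at h
    ext i; fin_cases i
    · exact h.1
    · exact h.2.1
    · exact h.2.2.1
    · exact h.2.2.2
  · apply mul_left_cancel₀ hd'; field_simp; linear_combination e1
  · apply mul_left_cancel₀ hd'; field_simp; linear_combination -e2

/-- The constant in front of the polar form is rational and independent of the place, so the product
formula makes it harmless. The same applies to the other tangent forms. -/
theorem IsRep.tangent_zero {s : Fin 3 → ℚ} (hs : IsRep d D s) (hn : n = d * d')
    (q : Fin 3 → ℚ) (x : Fin 4 → F) : tangentForm n D 0 q x = ((d : ℚ) : F) *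
      polar ((1 : ℤ) : F) ((d' : ℤ) : F) ((s 2 * q 2 : ℚ) : F) ((q 0 : ℚ) : F)
        ((s 1 * q 1 : ℚ) : F) (s 2 * x 3) (x 0) (s 1 * x 2) := by
  obtain ⟨-, a, b, c⟩ := hs
  rw [tangentForm_zero, b, c, hn]; unfold polar; push_cast; ring

theorem IsRep.tangent_one {s : Fin 3 → ℚ} (hs : IsRep d D s) (hn : n = d * d') (hd : d ≠ 0)
    (q : Fin 3 → ℚ) (x : Fin 4 → F) : tangentForm n D 1 q x = ((d : ℚ) : F) *
      polar ((d : ℤ) : F) ((d' : ℤ) : F) ((s 0 * q 2 / d : ℚ) : F) ((q 0 : ℚ) : F)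
        ((s 2 * q 1 : ℚ) : F) (s 0 * x 1 / d) (x 0) (s 2 * x 3) := by
  obtain ⟨-, a, b, c⟩ := hs
  have hd' : (d : F) ≠ 0 := by exact_mod_cast hd
  rw [tangentForm_one, a, c, hn]; unfold polar; push_cast; field_simp; ring

theorem IsRep.tangent_two {s : Fin 3 → ℚ} (hs : IsRep d D s) (hn : n = d * d') (hd : d ≠ 0)
    (q : Fin 3 → ℚ) (x : Fin 4 → F) : tangentForm n D 2 q x = ((-d : ℚ) : F) *
      polar ((d : ℤ) : F) ((2 * d' : ℤ) : F) ((s 0 * q 1 / d : ℚ) : F) ((q 0 : ℚ) : F)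
        ((s 1 * q 2 : ℚ) : F) (s 0 * x 1 / d) (x 0) (s 1 * x 2) := by
  obtain ⟨-, a, b, c⟩ := hs
  have hd' : (d : F) ≠ 0 := by exact_mod_cast hd
  rw [tangentForm_two, a, b, hn]; unfold polar; push_cast; field_simp; ring

theorem IsRep'.tangent_zero {s : Fin 3 → ℚ} (hs : IsRep' d D s) (hn : n = d * d') (hd : d ≠ 0)
    (q : Fin 3 → ℚ) (x : Fin 4 → F) : tangentForm n D 0 q x = ((d : ℚ) : F) *
      polar ((d : ℤ) : F) ((d' : ℤ) : F) ((s 2 * q 2 / d : ℚ) : F) ((q 0 : ℚ) : F)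
        ((s 1 * q 1 : ℚ) : F) (s 2 * x 3 / d) (x 0) (s 1 * x 2) := by
  obtain ⟨-, a, b, c⟩ := hs
  have hd' : (d : F) ≠ 0 := by exact_mod_cast hd
  rw [tangentForm_zero, b, c, hn]; unfold polar; push_cast; field_simp; ring

theorem IsRep'.tangent_one {s : Fin 3 → ℚ} (hs : IsRep' d D s) (hn : n = d * d') (hd : d ≠ 0)
    (q : Fin 3 → ℚ) (x : Fin 4 → F) : tangentForm n D 1 q x = ((-d : ℚ) : F) *
      polar ((d : ℤ) : F) ((-(d' : ℤ) : ℤ) : F) ((s 2 * q 1 / d : ℚ) : F) ((q 0 : ℚ) : F)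
        ((s 0 * q 2 : ℚ) : F) (s 2 * x 3 / d) (x 0) (s 0 * x 1) := by
  obtain ⟨-, a, b, c⟩ := hs
  have hd' : (d : F) ≠ 0 := by exact_mod_cast hd
  rw [tangentForm_one, a, c, hn]; unfold polar; push_cast; field_simp; ring

theorem IsRep'.tangent_two {s : Fin 3 → ℚ} (hs : IsRep' d D s) (hn : n = d * d')
    (q : Fin 3 → ℚ) (x : Fin 4 → F) : tangentForm n D 2 q x = ((-d : ℚ) : F) *
      polar ((1 : ℤ) : F) ((2 * d' : ℤ) : F) ((s 0 * q 1 : ℚ) : F) ((q 0 : ℚ) : F)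
        ((s 1 * q 2 : ℚ) : F) (s 0 * x 1) (x 0) (s 1 * x 2) := by
  obtain ⟨-, a, b, c⟩ := hs
  rw [tangentForm_two, a, b, hn]; unfold polar; push_cast; ring

theorem fin_three_ne_zero {q : Fin 3 → ℚ} (h : q ≠ 0) : (q 0, q 1, q 2) ≠ (0, 0, 0) := by
  intro h0
  simp only [Prod.mk.injEq] at h0
  apply h; ext i; fin_cases i
  · exact h0.1
  · exact h0.2.1
  · exact h0.2.2

theorem IsRep.conic_zero {s : Fin 3 → ℚ} (hs : IsRep d D s) (hn : n = d * d') (hd : d ≠ 0)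
    {q : Fin 3 → ℚ} (hq : IsConicPoint n D 0 q) : (s 2 * q 2, q 0, s 1 * q 1) ≠ (0, 0, 0) ∧
      (s 1 * q 1) ^ 2 = (1 : ℤ) * (s 2 * q 2) ^ 2 + (d' : ℤ) * q 0 ^ 2 := by
  obtain ⟨h0, e⟩ := isConicPoint_iff_zero.1 hq
  obtain ⟨hs0, a, b, c⟩ := hs
  have hd' : (d : ℚ) ≠ 0 := by exact_mod_cast hd
  rw [b, c, hn] at e
  refine ⟨fun h => fin_three_ne_zero h0 ?_, ?_⟩
  · simp only [Prod.mk.injEq, mul_eq_zero, hs0, false_or] at h ⊢; tauto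
  · apply mul_left_cancel₀ hd'; push_cast at *; linear_combination e

theorem IsRep.conic_one {s : Fin 3 → ℚ} (hs : IsRep d D s) (hn : n = d * d') (hd : d ≠ 0)
    {q : Fin 3 → ℚ} (hq : IsConicPoint n D 1 q) : (s 0 * q 2 / d, q 0, s 2 * q 1) ≠ (0, 0, 0) ∧
      (s 2 * q 1) ^ 2 = (d : ℤ) * (s 0 * q 2 / d) ^ 2 + (d' : ℤ) * q 0 ^ 2 := by
  obtain ⟨h0, e⟩ := isConicPoint_iff_one.1 hq
  obtain ⟨hs0, a, b, c⟩ := hs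
  have hd' : (d : ℚ) ≠ 0 := by exact_mod_cast hd
  rw [a, c, hn] at e
  refine ⟨fun h => fin_three_ne_zero h0 ?_, ?_⟩
  · simp only [Prod.mk.injEq, mul_eq_zero, div_eq_zero_iff, hd', hs0, false_or, or_false] at h ⊢
    tauto
  · apply mul_left_cancel₀ hd'; push_cast at *; field_simp; linear_combination e

theorem IsRep.conic_two {s : Fin 3 → ℚ} (hs : IsRep d D s) (hn : n = d * d') (hd : d ≠ 0)
    {q : Fin 3 → ℚ} (hq : IsConicPoint n D 2 q) : (s 0 * q 1 / d, q 0, s 1 * q 2) ≠ (0, 0, 0) ∧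
      (s 1 * q 2) ^ 2 = (d : ℤ) * (s 0 * q 1 / d) ^ 2 + (2 * d' : ℤ) * q 0 ^ 2 := by
  obtain ⟨h0, e⟩ := isConicPoint_iff_two.1 hq
  obtain ⟨hs0, a, b, c⟩ := hs
  have hd' : (d : ℚ) ≠ 0 := by exact_mod_cast hd
  rw [a, b, hn] at e
  refine ⟨fun h => fin_three_ne_zero h0 ?_, ?_⟩
  · simp only [Prod.mk.injEq, mul_eq_zero, div_eq_zero_iff, hd', hs0, false_or, or_false] at h ⊢
    tauto
  · apply mul_left_cancel₀ hd'; push_cast at *; field_simp; linear_combination -e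

theorem IsRep'.conic_zero {s : Fin 3 → ℚ} (hs : IsRep' d D s) (hn : n = d * d') (hd : d ≠ 0)
    {q : Fin 3 → ℚ} (hq : IsConicPoint n D 0 q) : (s 2 * q 2 / d, q 0, s 1 * q 1) ≠ (0, 0, 0) ∧
      (s 1 * q 1) ^ 2 = (d : ℤ) * (s 2 * q 2 / d) ^ 2 + (d' : ℤ) * q 0 ^ 2 := by
  obtain ⟨h0, e⟩ := isConicPoint_iff_zero.1 hq
  obtain ⟨hs0, a, b, c⟩ := hs
  have hd' : (d : ℚ) ≠ 0 := by exact_mod_cast hd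
  rw [b, c, hn] at e
  refine ⟨fun h => fin_three_ne_zero h0 ?_, ?_⟩
  · simp only [Prod.mk.injEq, mul_eq_zero, div_eq_zero_iff, hd', hs0, false_or, or_false] at h ⊢
    tauto
  · apply mul_left_cancel₀ hd'; push_cast at *; field_simp; linear_combination e

theorem IsRep'.conic_one {s : Fin 3 → ℚ} (hs : IsRep' d D s) (hn : n = d * d') (hd : d ≠ 0)
    {q : Fin 3 → ℚ} (hq : IsConicPoint n D 1 q) : (s 2 * q 1 / d, q 0, s 0 * q 2) ≠ (0, 0, 0) ∧
      (s 0 * q 2) ^ 2 = (d : ℤ) * (s 2 * q 1 / d) ^ 2 + (-(d' : ℤ) : ℤ) * q 0 ^ 2 := by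
  obtain ⟨h0, e⟩ := isConicPoint_iff_one.1 hq
  obtain ⟨hs0, a, b, c⟩ := hs
  have hd' : (d : ℚ) ≠ 0 := by exact_mod_cast hd
  rw [a, c, hn] at e
  refine ⟨fun h => fin_three_ne_zero h0 ?_, ?_⟩
  · simp only [Prod.mk.injEq, mul_eq_zero, div_eq_zero_iff, hd', hs0, false_or, or_false] at h ⊢
    tauto
  · apply mul_left_cancel₀ hd'; push_cast at *; field_simp; linear_combination -e

end Coordinates

/-! ### Common scales for the local points of several conics -/

theorem exists_place_family {C : ∀ (p : ℕ) [Fact p.Prime], ℚ_[p] → Prop}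
    (h : ∀ (p : ℕ) [Fact p.Prime], ∃ l : ℚ_[p], l ≠ 0 ∧ C p l) :
    ∃ l : (v : Place) → v.Completion, (∀ v, l v ≠ 0) ∧
      ∀ (p : ℕ) [Fact p.Prime], C p (l (primePlace p)) := by
  let l : (v : Place) → v.Completion := fun v => match v with
    | .infinite => (1 : ℝ)
    | .finite p hp => haveI : Fact p.Prime := ⟨hp⟩; (h p).choose
  refine ⟨l, fun v => ?_, fun p hp => (h p).choose_spec.2⟩
  cases v with
  | infinite => exact one_ne_zero (α := ℝ)
  | finite p hp => have : Fact p.Prime := ⟨hp⟩; exact (h p).choose_spec.1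

section Local

variable {p : ℕ} [hp : Fact p.Prime]

theorem exists_norm_max (x : Fin 4 → ℚ_[p]) (hx : x ≠ 0) :
    ∃ l : ℚ_[p], l ≠ 0 ∧ (∀ i, ‖x i‖ ≤ ‖l‖) ∧ ∃ i, ‖x i‖ = ‖l‖ := by
  obtain ⟨i, -, hi⟩ := Finset.exists_max_image Finset.univ (fun i => ‖x i‖) ⟨0, Finset.mem_univ _⟩
  refine ⟨x i, fun h => hx ?_, fun j => hi j (Finset.mem_univ _), i, rfl⟩
  ext j
  have := hi j (Finset.mem_univ _)
  rw [h, norm_zero] at this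
  exact norm_le_zero_iff.1 this

theorem norm_lt_of_sq_eq {o A B x y : ℚ_[p]} {r : ℝ} (hA : ‖A‖ ≤ 1) (hB : ‖B‖ ≤ 1)
    (h : o ^ 2 = A * x ^ 2 + B * y ^ 2) (hx : ‖x‖ < r) (hy : ‖y‖ < r) : ‖o‖ < r := by
  have hr : 0 < r := (norm_nonneg _).trans_lt hx
  have aux : ∀ {A x : ℚ_[p]}, ‖A‖ ≤ 1 → ‖x‖ < r → ‖A * x ^ 2‖ < r ^ 2 := by
    intro A x hA hx
    rw [norm_mul, norm_pow]
    calc ‖A‖ * ‖x‖ ^ 2 ≤ 1 * ‖x‖ ^ 2 := by gcongr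
      _ < r ^ 2 := by rw [one_mul]; gcongr
  have := Padic.norm_add_lt_of_lt (aux hA hx) (aux hB hy)
  rw [← h, norm_pow] at this
  exact lt_of_pow_lt_pow_left₀ 2 hr.le this

/-- Passes from the maximum over four coordinates to three of them, when an equation bounds the
omitted one. -/
theorem maxNorm_of_omit {x y z o : ℚ_[p]} {r : ℝ} (hx : ‖x‖ ≤ r) (hy : ‖y‖ ≤ r) (hz : ‖z‖ ≤ r)
    (h : ‖x‖ = r ∨ ‖y‖ = r ∨ ‖z‖ = r ∨ ‖o‖ = r)
    (ho : ‖x‖ < r → ‖y‖ < r → ‖z‖ < r → ‖o‖ < r) : MaxNorm x y z r := by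
  refine ⟨hx, hy, hz, ?_⟩
  by_contra hcon
  push Not at hcon
  have := ho (lt_of_le_of_ne hx hcon.1) (lt_of_le_of_ne hy hcon.2.1) (lt_of_le_of_ne hz hcon.2.2)
  rcases h with h | h | h | h
  · exact hcon.1 h
  · exact hcon.2.1 h
  · exact hcon.2.2 h
  · exact this.ne h

theorem norm_natCast_eq_one {k : ℕ} (h : ¬ p ∣ k) : ‖(k : ℚ_[p])‖ = 1 := by
  have := norm_intCast_eq_one (p := p) (k := k) (by exact_mod_cast h)
  exact_mod_cast this

theorem norm_natCast_le_one (k : ℕ) : ‖(k : ℚ_[p])‖ ≤ 1 := by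
  exact_mod_cast Padic.norm_int_le_one (p := p) k

/-- A single scale for all three conics is needed so that its symbols cancel in pairs. That p does
not divide d is what lets w be bounded by r and t. -/
theorem exists_scale {d d' : ℕ} (hd : ¬ p ∣ d) {t w u r : ℚ_[p]}
    (h0 : (t, w, u, r) ≠ (0, 0, 0, 0)) (h1 : u ^ 2 = r ^ 2 + d' * t ^ 2)
    (h2 : r ^ 2 = d * w ^ 2 + d' * t ^ 2) : ∃ l : ℚ_[p], l ≠ 0 ∧ MaxNorm w t r ‖l‖ ∧
      MaxNorm w t u ‖l‖ ∧ MaxNorm r t u ‖l‖ := by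
  obtain ⟨l, hl, hle, i, hi⟩ := exists_norm_max ![t, w, u, r] (fun h => h0 (by
    have := fun i => congrFun h i
    simp only [Fin.forall_fin_succ] at this
    simpa using this))
  simp only [Fin.forall_fin_succ] at hle
  obtain ⟨lt, lw, lu, lr, -⟩ := hle
  have hd1 := norm_natCast_eq_one (p := p) hd
  have hd0 : (d : ℚ_[p]) ≠ 0 := norm_ne_zero_iff.1 (by rw [hd1]; exact one_ne_zero)
  have hor : ‖t‖ = ‖l‖ ∨ ‖w‖ = ‖l‖ ∨ ‖u‖ = ‖l‖ ∨ ‖r‖ = ‖l‖ := by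
    fin_cases i
    · exact Or.inl hi
    · exact Or.inr (Or.inl hi)
    · exact Or.inr (Or.inr (Or.inl hi))
    · exact Or.inr (Or.inr (Or.inr hi))
  have hd'1 := norm_natCast_le_one (p := p) d'
  refine ⟨l, hl, maxNorm_of_omit (o := u) lw lt lr (by tauto) fun a b c => ?_,
    maxNorm_of_omit (o := r) lw lt lu (by tauto) fun a b c => ?_,
    maxNorm_of_omit (o := w) lr lt lu (by tauto) fun a b c => ?_⟩
  · exact norm_lt_of_sq_eq (A := 1) (B := d') (by simp) hd'1 (by rw [h1]; ring) c b
  · exact norm_lt_of_sq_eq (A := 1) (B := -d') (by simp) (by rwa [norm_neg]) (by rw [h1]; ring) c b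
  · exact norm_lt_of_sq_eq (A := (d : ℚ_[p])⁻¹) (B := -(d' : ℚ_[p]) * (d : ℚ_[p])⁻¹)
      (by rw [norm_inv, hd1, inv_one]) (by rw [norm_mul, norm_inv, hd1, norm_neg, inv_one, mul_one]; exact hd'1)
      (by rw [h2]; field_simp; ring) a b

/-- Here w occurs in both triples and never has to be recovered, so p may divide d. -/
theorem exists_scale' {d d' : ℕ} {t w u r : ℚ_[p]}
    (h0 : (t, r, u, w) ≠ (0, 0, 0, 0)) (h1 : u ^ 2 = d * w ^ 2 + d' * t ^ 2)
    (h2 : r ^ 2 = d * w ^ 2 - d' * t ^ 2) : ∃ l : ℚ_[p], l ≠ 0 ∧ MaxNorm w t u ‖l‖ ∧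
      MaxNorm w t r ‖l‖ := by
  obtain ⟨l, hl, hle, i, hi⟩ := exists_norm_max ![t, r, u, w] (fun h => h0 (by
    have := fun i => congrFun h i
    simp only [Fin.forall_fin_succ] at this
    simpa using this))
  simp only [Fin.forall_fin_succ] at hle
  obtain ⟨lt, lr, lu, lw, -⟩ := hle
  have hor : ‖t‖ = ‖l‖ ∨ ‖r‖ = ‖l‖ ∨ ‖u‖ = ‖l‖ ∨ ‖w‖ = ‖l‖ := by
    fin_cases i
    · exact Or.inl hi
    · exact Or.inr (Or.inl hi)
    · exact Or.inr (Or.inr (Or.inl hi))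
    · exact Or.inr (Or.inr (Or.inr hi))
  have hd1 := norm_natCast_le_one (p := p) d
  have hd'1 := norm_natCast_le_one (p := p) d'
  refine ⟨l, hl, maxNorm_of_omit (o := r) lw lt lu (by tauto) fun a b c => ?_,
    maxNorm_of_omit (o := u) lw lt lr (by tauto) fun a b c => ?_⟩
  · exact norm_lt_of_sq_eq hd1 (by rwa [norm_neg]) (h2.trans (by ring)) a b
  · exact norm_lt_of_sq_eq hd1 hd'1 h1 a b

/-- Coordinates with nearby squares agree up to sign, hence up to squares. -/
theorem hilbertSymbol_mul_of_sq_near {m : ℕ} (h8 : p % 8 = 1) {a b : ℚ_[p]}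
    (h : ‖a ^ 2 - b ^ 2‖ < ‖b‖ ^ 2) : hilbertSymbol (a * b) (m : ℚ_[p]) = 1 := by
  have h2 : p ≠ 2 := by rintro rfl; norm_num at h8
  rw [← norm_pow] at h
  obtain ⟨c, hc, e⟩ := exists_eq_mul_sq_of_norm_sub_lt h2 h
  apply hilbertSymbol_of_isSquare_left
  have : a = b * c ∨ a = -(b * c) := sq_eq_sq_iff_eq_or_eq_neg.1 (by rw [e]; ring)
  have hab : a ^ 2 - b ^ 2 = (a - b) * (a + b) := by ring
  -- The product (a − b)(a + b) is smaller than b², so a is close to b or to −b; then ab is ± a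
  -- square, and −1 is a square.
  have hcase : ‖a - b‖ < ‖b‖ ∨ ‖a - -b‖ < ‖-b‖ := by
    by_contra hcon
    push Not at hcon
    rw [norm_neg, sub_neg_eq_add] at hcon
    have := mul_le_mul hcon.1 hcon.2 (norm_nonneg _) (norm_nonneg _)
    rw [← norm_mul, ← norm_mul, ← hab, ← sq] at this
    exact absurd h this.not_gt
  rcases hcase with hcase | hcase
  · obtain ⟨c, -, e⟩ := exists_eq_mul_sq_of_norm_sub_lt h2 hcase
    exact ⟨b * c, by rw [e]; ring⟩
  · obtain ⟨c, -, e⟩ := exists_eq_mul_sq_of_norm_sub_lt h2 hcase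
    obtain ⟨i, hi⟩ := isSquare_neg_one_padic h8
    exact ⟨i * (b * c), by rw [e]; linear_combination (b * c) ^ 2 * hi⟩

end Local

theorem HasPlaceProd.const_mul {m : ℕ} (hm : OneModEight m) {k : ℚ} (hk : k ≠ 0)
    {T : (v : Place) → v.Completion} (hT : ∀ v, T v ≠ 0) {g : Place → ℤ} {s : ℤ}
    (h : HasPlaceProd (fun v => hilbertAt m v (T v) * g v) s) :
    HasPlaceProd (fun v => hilbertAt m v ((k : v.Completion) * T v) * g v) s := by
  have := (hasPlaceProd_oddHilbert hm.1 hm.2 hk).mul h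
  rw [one_mul] at this
  exact this.congr fun v => by
    rw [hilbertAt_mul hm v (by exact_mod_cast hk) (hT v), hilbertAt_ratCast hm, mul_assoc]

section TwoConics

variable {n m : ℕ} {A B A' B' : ℤ} {X Y Z X' Y' Z' : (v : Place) → v.Completion}

/-- The contributions of two conics of which the local points have a common scale. -/
theorem hasPlaceProd_polar_mul_polar (hm : LocallyGood n m) (hAB : GoodConic n m A B)
    (hAB' : GoodConic n m A' B')
    (hP : ∀ v, Z v ^ 2 = (A : v.Completion) * X v ^ 2 + (B : v.Completion) * Y v ^ 2)
    (hP0 : ∀ v, (X v, Y v, Z v) ≠ (0, 0, 0))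
    (hP' : ∀ v, Z' v ^ 2 = (A' : v.Completion) * X' v ^ 2 + (B' : v.Completion) * Y' v ^ 2)
    (hP0' : ∀ v, (X' v, Y' v, Z' v) ≠ (0, 0, 0))
    (hl : ∀ (p : ℕ) [Fact p.Prime], ¬ p ∣ 2 * n → ∃ l : ℚ_[p], l ≠ 0 ∧
      MaxNorm (p := p) (X (primePlace p)) (Y (primePlace p)) (Z (primePlace p)) ‖l‖ ∧
      MaxNorm (p := p) (X' (primePlace p)) (Y' (primePlace p)) (Z' (primePlace p)) ‖l‖)
    (hlm : ∀ (p : ℕ) [Fact p.Prime], p ∣ m →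
      hilbertAt m (primePlace p) (Z (primePlace p) * Z' (primePlace p)) = 1)
    {x y z : ℚ} (h0 : (x, y, z) ≠ (0, 0, 0)) (hQ : z ^ 2 = A * x ^ 2 + B * y ^ 2)
    {x' y' z' : ℚ} (h0' : (x', y', z') ≠ (0, 0, 0)) (hQ' : z' ^ 2 = A' * x' ^ 2 + B' * y' ^ 2)
    {x₀ y₀ z₀ : ℤ} (hg₀ : Int.gcd (Int.gcd x₀ y₀) z₀ = 1)
    (hQ₀ : z₀ ^ 2 = A * x₀ ^ 2 + B * y₀ ^ 2)
    {x₁ y₁ z₁ : ℤ} (hg₁ : Int.gcd (Int.gcd x₁ y₁) z₁ = 1)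
    (hQ₁ : z₁ ^ 2 = A' * x₁ ^ 2 + B' * y₁ ^ 2)
    {k k' : ℚ} (hk : k ≠ 0) (hk' : k' ≠ 0)
    (hT : ∀ v, (k : v.Completion) * polar (A : v.Completion) B x y z (X v) (Y v) (Z v) ≠ 0)
    (hT' : ∀ v, (k' : v.Completion) *
      polar (A' : v.Completion) B' x' y' z' (X' v) (Y' v) (Z' v) ≠ 0) :
    HasPlaceProd (fun v =>
      hilbertAt m v ((k : v.Completion) * polar (A : v.Completion) B x y z (X v) (Y v) (Z v)) *
      hilbertAt m v ((k' : v.Completion) *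
        polar (A' : v.Completion) B' x' y' z' (X' v) (Y' v) (Z' v)))
      (jacobiSym (z₀ * z₁) m) := by
  have hm1 := hm.oneModEight
  -- At p ∣ m the scale is Z': then Z'l is a square and Zl = ZZ' has trivial symbol. At good primes
  -- it is the common scale, and at other bad primes any nonzero value will do.
  obtain ⟨l, hl0, hl1⟩ := exists_place_family
    (C := fun p _ l => (¬ p ∣ 2 * n →
      MaxNorm (p := p) (X (primePlace p)) (Y (primePlace p)) (Z (primePlace p)) ‖l‖ ∧
      MaxNorm (p := p) (X' (primePlace p)) (Y' (primePlace p)) (Z' (primePlace p)) ‖l‖) ∧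
      (p ∣ m → l = Z' (primePlace p))) (fun p hp => by
    by_cases hpm : p ∣ m
    · exact ⟨Z' (primePlace p), ((hAB'.tame p hpm).1.maxNorm (hP' (primePlace p))
        (hP0' (primePlace p))).1, fun h => absurd ((hpm.trans hm.dvd).mul_left 2) h, fun _ => rfl⟩
    · by_cases hpn : p ∣ 2 * n
      · exact ⟨1, one_ne_zero, fun h => absurd hpn h, fun h => absurd h hpm⟩
      · obtain ⟨l, h1, h2⟩ := hl p hpn
        exact ⟨l, h1, fun _ => h2, fun h => absurd h hpm⟩)
  have e1 := hasPlaceProd_polar hm hAB hP hP0 (l := l) ⟨hl0, fun p _ h => ((hl1 p).1 h).1⟩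
    (fun p _ hpm => (congrArg (fun a => hilbertAt m (primePlace p) (Z (primePlace p) * a))
      ((hl1 p).2 hpm)).trans (hlm p hpm)) h0 hQ hg₀ hQ₀
    fun v => right_ne_zero_of_mul (hT v)
  have e2 := hasPlaceProd_polar hm hAB' hP' hP0' (l := l) ⟨hl0, fun p _ h => ((hl1 p).1 h).2⟩
    (fun p _ hpm => (congrArg (fun a => hilbertAt m (primePlace p) (Z' (primePlace p) * a))
      ((hl1 p).2 hpm)).trans (hilbertSymbol_of_isSquare_left _ ⟨_, rfl⟩)) h0' hQ' hg₁ hQ₁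
    fun v => right_ne_zero_of_mul (hT' v)
  have e3 := (e1.const_mul hm1 hk fun v => right_ne_zero_of_mul (hT v)).mul
    (e2.const_mul hm1 hk' fun v => right_ne_zero_of_mul (hT' v))
  rw [jacobiSym.mul_left]
  refine e3.congr fun v => ?_
  -- The symbol of the common scale occurs once for each conic, hence cancels.
  have := hilbertAt_mul_self m v (l v)
  linear_combination (-hilbertAt m v ((k : v.Completion) *
    polar (A : v.Completion) B x y z (X v) (Y v) (Z v)) * hilbertAt m v ((k' : v.Completion) *
        polar (A' : v.Completion) B' x' y' z' (X' v) (Y' v) (Z' v))) * this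

end TwoConics

/-! ### The square root of 2 and the invariant δ -/

section Local

variable {p : ℕ} [hp : Fact p.Prime]

/-- The product (1 + j)(1 − j) = −1 is a square, and the only other root is −j. -/
theorem isSquare_one_add_iff (h8 : p % 8 = 1) {j j' : ℚ_[p]} (hj : j ^ 2 = 2) (hj' : j' ^ 2 = 2) :
    IsSquare (1 + j) ↔ IsSquare (1 + j') := by
  have key : ∀ {j : ℚ_[p]}, j ^ 2 = 2 → IsSquare (1 + j) → IsSquare (1 + -j) := by
    intro j hj h
    obtain ⟨i, hi⟩ := isSquare_neg_one_padic h8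
    obtain ⟨s, hs⟩ := h
    have hne : s ≠ 0 := by
      rintro rfl
      have : j = -1 := by linear_combination hs
      rw [this] at hj; norm_num at hj
    refine ⟨i / s, ?_⟩
    field_simp
    linear_combination hi - (1 - j) * hs - hj
  rcases sq_eq_sq_iff_eq_or_eq_neg.1 (hj.trans hj'.symm) with rfl | rfl
  · rfl
  · exact ⟨fun h => by simpa using key hj h, key hj'⟩

theorem deltaPrime_eq (h8 : p % 8 = 1) {j : ℚ_[p]} (hj : j ^ 2 = 2) [Decidable (IsSquare (1 + j))] :
    deltaPrime p = if IsSquare (1 + j) then 0 else 1 := by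
  unfold deltaPrime
  by_cases h : IsSquare (1 + j)
  · rw [if_pos h, if_neg]
    rintro ⟨j', hj', h'⟩
    exact h' ((isSquare_one_add_iff h8 hj hj').1 h)
  · rw [if_neg h, if_pos ⟨j, hj, h⟩]

theorem norm_sq_two (h2 : p ≠ 2) {j : ℚ_[p]} (hj : j ^ 2 = 2) : ‖j‖ = 1 := by
  have := norm_two_eq_one h2
  rw [← hj, norm_pow] at this
  exact (pow_eq_one_iff_of_nonneg (norm_nonneg _) two_ne_zero).1 this

theorem norm_one_add_sqrt_two (h2 : p ≠ 2) {j : ℚ_[p]} (hj : j ^ 2 = 2) : ‖1 + j‖ = 1 := by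
  have h1 : ‖1 + j‖ ≤ 1 := (Padic.nonarchimedean _ _).trans (by simp [norm_sq_two h2 hj])
  have h3 : ‖1 - j‖ ≤ 1 := by
    rw [sub_eq_add_neg]
    exact (Padic.nonarchimedean _ _).trans (by simp [norm_sq_two h2 hj])
  have h4 : ‖1 + j‖ * ‖1 - j‖ = 1 := by
    rw [← norm_mul, show (1 + j) * (1 - j) = -1 by linear_combination -hj]; simp
  nlinarith [norm_nonneg (1 + j), norm_nonneg (1 - j)]

/-- The contribution of a prime divisor `p` of `d` to `δ_d`. -/
theorem hilbertSymbol_mul_sub {d d' : ℕ} (h8 : p % 8 = 1) (hsq : Squarefree d) (hpd : p ∣ d)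
    {t w u r : ℚ_[p]} (hr : r ≠ 0) (hw : ‖w‖ ≤ ‖r‖) (h1 : u ^ 2 = r ^ 2 + d' * t ^ 2)
    (h2 : r ^ 2 = d * w ^ 2 + d' * t ^ 2) :
    u - r ≠ 0 ∧ hilbertSymbol ((u - r) * r) (d : ℚ_[p]) = (-1) ^ deltaPrime p := by
  classical
  have hp2 : p ≠ 2 := by rintro rfl; norm_num at h8
  obtain ⟨j, hj⟩ := isSquare_two_padic h8
  rw [← sq, eq_comm] at hj
  obtain ⟨x, hx, hd⟩ := exists_eq_p_mul_unit hsq hpd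
  have hr' : 0 < ‖r‖ := norm_pos_iff.2 hr
  -- The two equations give u² − 2r² = −d w², which is small because p ∣ d; so u is close to a root
  -- of 2 times r.
  have hsmall : ‖(u - j * r) * (u + j * r)‖ < ‖r‖ ^ 2 := by
    rw [show (u - j * r) * (u + j * r) = -(d * w ^ 2) by
      linear_combination h1 - h2 - r ^ 2 * hj, norm_neg, norm_mul, norm_pow, hd, norm_mul, hx,
      mul_one]
    have : ‖(p : ℚ_[p])‖ < 1 := Padic.norm_p_lt_one
    calc ‖(p : ℚ_[p])‖ * ‖w‖ ^ 2 ≤ ‖(p : ℚ_[p])‖ * ‖r‖ ^ 2 := by gcongr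
      _ < 1 * ‖r‖ ^ 2 := by gcongr
      _ = ‖r‖ ^ 2 := one_mul _
  obtain ⟨j, hj, hju⟩ : ∃ j : ℚ_[p], j ^ 2 = 2 ∧ ‖u - j * r‖ < ‖r‖ := by
    by_contra hcon
    push Not at hcon
    have a := hcon j hj
    have b := hcon (-j) (by rw [neg_sq, hj])
    rw [neg_mul, sub_neg_eq_add] at b
    have := mul_le_mul a b (norm_nonneg _) (norm_nonneg _)
    rw [← sq] at this
    rw [norm_mul] at hsmall
    exact absurd hsmall this.not_gt
  have hj1 := norm_one_add_sqrt_two hp2 hj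
  have hj1' : ‖j - 1‖ = 1 := by
    have := norm_one_add_sqrt_two hp2 (j := -j) (by rw [neg_sq, hj])
    rwa [← norm_neg, show -(j - 1) = 1 + -j by ring]
  have hj0 : 1 + j ≠ 0 := norm_ne_zero_iff.1 (by rw [hj1]; exact one_ne_zero)
  have hnear : ‖(u - r) * r - (j - 1) * r ^ 2‖ < ‖(j - 1) * r ^ 2‖ := by
    rw [show (u - r) * r - (j - 1) * r ^ 2 = (u - j * r) * r by ring, norm_mul, norm_mul, hj1',
      norm_pow, one_mul, sq]
    gcongr
  obtain ⟨c, hc, e⟩ := exists_eq_mul_sq_of_norm_sub_lt hp2 hnear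
  -- Since (j − 1)(j + 1) = 1, the factors j − 1 and 1 + j agree up to a square.
  have e' : (u - r) * r = (1 + j) * (r * c * (1 + j)⁻¹) ^ 2 := by
    rw [e]; field_simp; linear_combination hj
  have hne : r * c * (1 + j)⁻¹ ≠ 0 := mul_ne_zero (mul_ne_zero hr hc) (inv_ne_zero hj0)
  refine ⟨fun h => ?_, ?_⟩
  · rw [h, zero_mul] at e'
    exact mul_ne_zero hj0 (pow_ne_zero 2 hne) e'.symm
  · rw [e', hilbertSymbol_mul_sq_left _ _ hne, deltaPrime_eq h8 hj]
    by_cases h : IsSquare (1 + j)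
    · rw [if_pos h, pow_zero, hilbertSymbol_of_isSquare_left _ h]
    · rw [if_neg h, pow_one, hd, hilbertSymbol_p_mul_unit hp2 hj1 hx h]

end Local

/-- A total function G on ℕ replaces `deltaPrime`, which needs a primality instance, so that the
product over prime factors has the shape required by `hasPlaceProd_of_primes`. -/
theorem neg_one_pow_delta (m : ℕ) : ∃ G : ℕ → ℤ, (∀ p [Fact p.Prime], G p = (-1) ^ deltaPrime p) ∧
    (-1) ^ delta m = ∏ p ∈ m.primeFactors, G p := by
  classical
  refine ⟨fun p => if hp : p.Prime then (-1) ^ (haveI : Fact p.Prime := ⟨hp⟩; deltaPrime p) else 1,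
    fun p hp => dif_pos hp.out, ?_⟩
  rw [delta, ← Finset.prod_attach, ← Finset.prod_pow_eq_pow_sum]
  exact Finset.prod_congr rfl fun p _ => by simp only [dif_pos (Nat.prime_of_mem_primeFactors p.2)]

/-- The contributions of the two conics `u² = r² + d' t²` and `r² = d w² + d' t²` to the pairing
of `(1, d, d)` and `(d, d, 1)`. -/
theorem hasPlaceProd_polar_one_mul_polar {n d d' : ℕ} (hm : LocallyGood n d) (hn : n = d * d')
    (hn0 : n ≠ 0) (hAB : GoodConic n d d d')
    (hsq : ∀ (p : ℕ) [Fact p.Prime], p ∣ d → IsSquare (d' : ℚ_[p]))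
    {T W U R : (v : Place) → v.Completion}
    (hP : ∀ v, U v ^ 2 = ((1 : ℤ) : v.Completion) * R v ^ 2 + ((d' : ℤ) : v.Completion) * T v ^ 2)
    (hP' : ∀ v, R v ^ 2 = ((d : ℤ) : v.Completion) * W v ^ 2 + ((d' : ℤ) : v.Completion) * T v ^ 2)
    (hP0' : ∀ v, (W v, T v, R v) ≠ (0, 0, 0))
    (hl : ∀ (p : ℕ) [Fact p.Prime], ¬ p ∣ 2 * n → ∃ l : ℚ_[p], l ≠ 0 ∧
      MaxNorm (p := p) (R (primePlace p)) (T (primePlace p)) (U (primePlace p)) ‖l‖ ∧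
      MaxNorm (p := p) (W (primePlace p)) (T (primePlace p)) (R (primePlace p)) ‖l‖)
    {x y z : ℚ} (h0 : (x, y, z) ≠ (0, 0, 0)) (hQ : z ^ 2 = (1 : ℤ) * x ^ 2 + (d' : ℤ) * y ^ 2)
    {x' y' z' : ℚ} (h0' : (x', y', z') ≠ (0, 0, 0))
    (hQ' : z' ^ 2 = (d : ℤ) * x' ^ 2 + (d' : ℤ) * y' ^ 2)
    {x₁ y₁ z₁ : ℤ} (hg₁ : Int.gcd (Int.gcd x₁ y₁) z₁ = 1)
    (hQ₁ : z₁ ^ 2 = (d : ℤ) * x₁ ^ 2 + (d' : ℤ) * y₁ ^ 2)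
    {k k' : ℚ} (hk : k ≠ 0) (hk' : k' ≠ 0)
    (hT : ∀ v, (k : v.Completion) *
      polar ((1 : ℤ) : v.Completion) (d' : ℤ) x y z (R v) (T v) (U v) ≠ 0)
    (hT' : ∀ v, (k' : v.Completion) *
      polar ((d : ℤ) : v.Completion) (d' : ℤ) x' y' z' (W v) (T v) (R v) ≠ 0) :
    HasPlaceProd (fun v =>
      hilbertAt d v ((k : v.Completion) *
        polar ((1 : ℤ) : v.Completion) (d' : ℤ) x y z (R v) (T v) (U v)) *
      hilbertAt d v ((k' : v.Completion) *
        polar ((d : ℤ) : v.Completion) (d' : ℤ) x' y' z' (W v) (T v) (R v)))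
      ((-1) ^ delta d * jacobiSym z₁ d) := by
  have hm1 := hm.oneModEight
  have hfac : ∀ (p : ℕ) [Fact p.Prime], p ∣ d → R (primePlace p) ≠ 0 ∧
      U (primePlace p) - R (primePlace p) ≠ 0 ∧
      hilbertAt d (primePlace p) ((U (primePlace p) - R (primePlace p)) * R (primePlace p)) =
        (-1) ^ deltaPrime p := by
    intro p hp hpd
    obtain ⟨h1, h2, -⟩ := (hAB.tame p hpd).1.maxNorm (hP' (primePlace p)) (hP0' (primePlace p))
    have := hilbertSymbol_mul_sub (p := p) (d' := d') (t := T (primePlace p))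
      (w := W (primePlace p)) (u := U (primePlace p)) (hm1.2 p hp.out hpd) hm.squarefree hpd h1 h2
      (by have := hP (primePlace p); simp only [Int.cast_one, one_mul, Int.cast_natCast] at this
          exact this)
      (by have := hP' (primePlace p); simp only [Int.cast_natCast] at this; exact this)
    exact ⟨h1, this.1, (hilbertAt_prime d p _).trans this.2⟩
  obtain ⟨l, hl0, hl1⟩ := exists_place_family
    (C := fun p _ l => ¬ p ∣ 2 * n →
      MaxNorm (p := p) (R (primePlace p)) (T (primePlace p)) (U (primePlace p)) ‖l‖ ∧
      MaxNorm (p := p) (W (primePlace p)) (T (primePlace p)) (R (primePlace p)) ‖l‖) (fun p hp => by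
    by_cases hpn : p ∣ 2 * n
    · exact ⟨1, one_ne_zero, fun h => absurd hpn h⟩
    · obtain ⟨l, h1, h2⟩ := hl p hpn
      exact ⟨l, h1, fun _ => h2⟩)
  -- The common scale is changed at p ∣ d, to U − R for the first conic and to R for the second, so
  -- that each local hypothesis concerns a square.
  have modify : ∀ f : (v : Place) → v.Completion, (∀ (p : ℕ) [Fact p.Prime], p ∣ d →
      f (primePlace p) ≠ 0) → ∃ g : (v : Place) → v.Completion, (∀ v, g v ≠ 0) ∧
      ∀ (p : ℕ) [Fact p.Prime], (p ∣ d → g (primePlace p) = f (primePlace p)) ∧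
        (¬ p ∣ d → g (primePlace p) = l (primePlace p)) := by
    intro f hf
    exact exists_place_family (C := fun p _ g => (p ∣ d → g = f (primePlace p)) ∧
        (¬ p ∣ d → g = l (primePlace p))) fun p hp => by
      by_cases hpd : p ∣ d
      · exact ⟨f (primePlace p), hf p hpd, fun _ => rfl, fun h => absurd hpd h⟩
      · exact ⟨l (primePlace p), hl0 _, fun h => absurd h hpd, fun _ => rfl⟩
  obtain ⟨l₁, hl₁, hl₁'⟩ := modify (fun v => U v - R v) fun p _ h => (hfac p h).2.1
  obtain ⟨l₂, hl₂, hl₂'⟩ := modify R fun p _ h => (hfac p h).1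
  have hnd : ∀ {p : ℕ}, ¬ p ∣ 2 * n → ¬ p ∣ d := fun h h' => h ((h'.trans hm.dvd).mul_left 2)
  have e1 := hasPlaceProd_polar_one hm hn hn0 hsq hP (l := l₁) ⟨hl₁, fun p _ h => by
      rw [(hl₁' p).2 (hnd h)]; exact (hl1 p h).1⟩
    (fun p _ hpm => ⟨(hfac p hpm).2.1, by
      rw [(hl₁' p).1 hpm]; exact hilbertSymbol_of_isSquare_left _ ⟨_, rfl⟩⟩) h0 hQ
    fun v => right_ne_zero_of_mul (hT v)
  have e2 := hasPlaceProd_polar hm hAB hP' hP0' (l := l₂) ⟨hl₂, fun p _ h => by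
      rw [(hl₂' p).2 (hnd h)]; exact (hl1 p h).2⟩
    (fun p _ hpm => by rw [(hl₂' p).1 hpm]; exact hilbertSymbol_of_isSquare_left _ ⟨_, rfl⟩)
    h0' hQ' hg₁ hQ₁ fun v => right_ne_zero_of_mul (hT' v)
  obtain ⟨G, hG, hGd⟩ := neg_one_pow_delta d
  -- The two modified scales differ only at p ∣ d, where their product (U − R)R contributes
  -- (−1)^δ_p; elsewhere they cancel.
  have e3 : HasPlaceProd (fun v => hilbertAt d v (l₁ v) * hilbertAt d v (l₂ v))
      ((-1) ^ delta d) := by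
    rw [hGd]
    refine hasPlaceProd_of_primes _ G (fun p hp => Nat.prime_of_mem_primeFactors hp) (by
      simp only [hilbertAt_infinite, mul_one]) (fun p hp hpd => ?_) (fun p hp hpd => ?_)
    · have hpd : ¬ p ∣ d := fun h => hpd (Nat.mem_primeFactors.2 ⟨hp, h, hm1.1⟩)
      have : Fact p.Prime := ⟨hp⟩
      have a := (hl₁' p).2 hpd
      have b := (hl₂' p).2 hpd
      rw [a, b]; exact hilbertAt_mul_self _ _ _
    · have hpd := Nat.dvd_of_mem_primeFactors hpd
      have : Fact p.Prime := ⟨hp⟩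
      rw [hG p, ← (hfac p hpd).2.2, hilbertAt_mul hm1 _ (hfac p hpd).2.1 (hfac p hpd).1,
        (hl₁' p).1 hpd, (hl₂' p).1 hpd]
  have e4 := (e3.mul (e1.const_mul hm1 hk fun v => right_ne_zero_of_mul (hT v))).mul
    (e2.const_mul hm1 hk' fun v => right_ne_zero_of_mul (hT' v))
  rw [mul_one] at e4
  refine e4.congr fun v => ?_
  have h1 := hilbertAt_mul_self d v (l₁ v)
  have h2 := hilbertAt_mul_self d v (l₂ v)
  generalize hilbertAt d v (l₁ v) = a at *
  generalize hilbertAt d v (l₂ v) = b at *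
  generalize hilbertAt d v ((k : v.Completion) * _) = α
  generalize hilbertAt d v ((k' : v.Completion) * _) = β
  linear_combination (-α * β) * h1 + (-α * β * a * a) * h2

/-- With B = mc and Ac a unit square at p ∣ m, the conic is tame there. Moreover AB is m up to a
square, hence also −m, and (−m, m) = 1. -/
theorem goodConic_of_eq {n m : ℕ} {A B c : ℤ} (hm : LocallyGood n m) (hB : B = m * c)
    (hA0 : A ≠ 0) (hc0 : c ≠ 0) (hdvd : ∀ p : ℕ, p.Prime → (p : ℤ) ∣ A * c → p ∣ 2 * n)
    (hloc : ∀ (p : ℕ) [Fact p.Prime], p ∣ m → ¬ (p : ℤ) ∣ A * c ∧ IsSquare ((A * c : ℤ) : ℚ_[p])) :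
    GoodConic n m A B := by
  have hm0 := hm.oneModEight.1
  subst hB
  refine ⟨fun p hp h => hdvd p hp (h.mul_right _), fun p hp h => ?_, hA0,
    mul_ne_zero (by exact_mod_cast hm0) hc0, fun p hp hpm => ?_⟩
  · rcases (Nat.prime_iff_prime_int.1 hp).dvd_or_dvd h with h | h
    · exact ((Int.natCast_dvd_natCast.1 h).trans hm.dvd).mul_left 2
    · exact hdvd p hp (h.mul_left _)
  · obtain ⟨h1, h2⟩ := hloc p hpm
    obtain ⟨u, hu, e⟩ := exists_eq_p_mul_unit hm.squarefree hpm
    have h8 := hm.oneModEight.2 p hp.out hpm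
    refine ⟨Or.inl ⟨norm_intCast_eq_one fun h => h1 (h.mul_right _), ?_⟩, ?_⟩
    · push_cast
      rw [norm_mul, norm_intCast_eq_one fun h => h1 (h.mul_left _), e, norm_mul, hu, mul_one,
        mul_one]
    · obtain ⟨r, hr⟩ := h2
      obtain ⟨i, hi⟩ := isSquare_neg_one_padic h8
      have hm0' : (m : ℚ_[p]) ≠ 0 := by exact_mod_cast hm0
      have hr0 : r ≠ 0 := by
        rintro rfl
        have : ((A * c : ℤ) : ℚ_[p]) = 0 := by rw [hr]; ring
        exact mul_ne_zero hA0 hc0 (by exact_mod_cast this)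
      have hi0 : i ≠ 0 := by rintro rfl; norm_num at hi
      have : (A : ℚ_[p]) * ((m * c : ℤ) : ℚ_[p]) = -(m : ℚ_[p]) * (i * r) ^ 2 := by
        push_cast at hr ⊢
        linear_combination (m : ℚ_[p]) * hr - m * r ^ 2 * hi
      rw [this, hilbertSymbol_mul_sq_left _ _ (mul_ne_zero hi0 hr0), hilbertSymbol_neg_self]

theorem GoodConic.symm {n m : ℕ} {A B : ℤ} (h : GoodConic n m A B) : GoodConic n m B A :=
  ⟨h.right, h.left, h.right_ne, h.left_ne, fun p _ hp =>
    ⟨(h.tame p hp).1.symm, by rw [mul_comm]; exact (h.tame p hp).2⟩⟩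

/-- A factorization of `n` for which the local conditions hold. -/
structure LocallyGoodFactors (n d e f : ℕ) : Prop where
  eq : n = d * (e * f)
  squarefree : Squarefree n
  left : LocallyGood n d
  mid : LocallyGood n e
  right : LocallyGood n f

namespace LocallyGoodFactors

variable {n d e f : ℕ}

theorem ne_zero (h : LocallyGoodFactors n d e f) : n ≠ 0 := h.squarefree.ne_zero

theorem not_dvd_of_dvd (h : LocallyGoodFactors n d e f) {p : ℕ} (hp : p.Prime) (hpe : p ∣ e) :
    ¬ p ∣ d ∧ ¬ p ∣ f := by
  have := h.squarefree
  rw [h.eq] at this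
  refine ⟨fun hd => hp.not_isUnit (this p (mul_dvd_mul hd (hpe.mul_right _))),
    fun hf => hp.not_isUnit (this p ((mul_dvd_mul hpe hf).mul_left _))⟩

theorem isSquare_left (h : LocallyGoodFactors n d e f) {p : ℕ} [hp : Fact p.Prime] (hpe : p ∣ e) :
    IsSquare (d : ℚ_[p]) :=
  h.left.isSquare p ((hpe.trans h.mid.dvd).mul_left 2) (h.not_dvd_of_dvd hp.out hpe).1

theorem isSquare_right (h : LocallyGoodFactors n d e f) {p : ℕ} [hp : Fact p.Prime] (hpe : p ∣ e) :
    IsSquare (f : ℚ_[p]) :=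
  h.right.isSquare p ((hpe.trans h.mid.dvd).mul_left 2) (h.not_dvd_of_dvd hp.out hpe).2

/-- The values s = 1, −1, 2 belong to the equations for c, c̄, γ; all three are squares at p ≡ 1
(mod 8). The divisor a is d, or 1 for the conic with a trivial leading coefficient. -/
theorem goodConic (h : LocallyGoodFactors n d e f) {a : ℕ} {B s : ℤ} (ha : a ∣ d)
    (hasq : ∀ (p : ℕ) [Fact p.Prime], p ∣ e → IsSquare (a : ℚ_[p]))
    (hB : B = s * (e * f : ℕ)) (hs : s = 1 ∨ s = -1 ∨ s = 2) : GoodConic n e a B := by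
  have h0 := h.ne_zero
  have hf0 := h.right.oneModEight.1
  have hd0 := h.left.oneModEight.1
  have hs0 : s ≠ 0 := by rcases hs with rfl | rfl | rfl <;> norm_num
  have ha0 : a ≠ 0 := fun h => hd0 (by rw [h, zero_dvd_iff] at ha; exact ha)
  have key : ∀ p : ℕ, p.Prime → (p : ℤ) ∣ a * (s * f) → p ∣ a ∨ p = 2 ∨ p ∣ f := by
    intro p hp hdvd
    have hp' := Nat.prime_iff_prime_int.1 hp
    rcases hp'.dvd_or_dvd hdvd with h1 | h1
    · exact Or.inl (by exact_mod_cast h1)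
    rcases hp'.dvd_or_dvd h1 with h2 | h2
    · right; left
      rcases hs with rfl | rfl | rfl
      · exact absurd h2 hp'.not_dvd_one
      · exact absurd ((dvd_neg).1 h2) hp'.not_dvd_one
      · exact (Nat.prime_dvd_prime_iff_eq hp Nat.prime_two).1 (by exact_mod_cast h2)
    · exact Or.inr (Or.inr (by exact_mod_cast h2))
  refine goodConic_of_eq (c := s * f) h.mid (by rw [hB]; push_cast; ring) (by exact_mod_cast ha0)
    (mul_ne_zero hs0 (by exact_mod_cast hf0)) (fun p hp hdvd => ?_) (fun p hp hpe => ⟨?_, ?_⟩)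
  · rcases key p hp hdvd with h1 | h1 | h1
    · exact ((h1.trans ha).trans h.left.dvd).mul_left 2
    · exact h1 ▸ dvd_mul_right _ _
    · exact (h1.trans h.right.dvd).mul_left 2
  · intro hdvd
    rcases key p hp.out hdvd with h1 | h1 | h1
    · exact (h.not_dvd_of_dvd hp.out hpe).1 (h1.trans ha)
    · exact h.mid.oneModEight.ne_two hp.out hpe h1
    · exact (h.not_dvd_of_dvd hp.out hpe).2 h1
  · have h8 := h.mid.oneModEight.2 p hp.out hpe
    push_cast
    refine (hasq p hpe).mul (IsSquare.mul ?_ (h.isSquare_right hpe))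
    rcases hs with rfl | rfl | rfl
    · simp
    · simpa using isSquare_neg_one_padic h8
    · simpa using isSquare_two_padic h8

end LocallyGoodFactors

/-- The trivial component removes one tangent form; the two others face the same e, which is why
their scales cancel. -/
theorem IsRep.localPairing {n e : ℕ} {Λ Λ' : Fin 3 → SqClass} {C : CasselsDatum n Λ Λ'}
    {s : Fin 3 → ℚ} (hs : IsRep e C.D' s) (v : Place) :
    C.localPairing v = hilbertAt e v (tangentForm n C.D 1 (C.Q 1) (C.P v)) *
      hilbertAt e v (tangentForm n C.D 2 (C.Q 2) (C.P v)) := by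
  obtain ⟨h0, a, b, c⟩ := hs
  have h1 : ((s 1 : ℚ) : v.Completion) ≠ 0 := by exact_mod_cast h0 1
  have h2 : ((s 2 : ℚ) : v.Completion) ≠ 0 := by exact_mod_cast h0 2
  rw [CasselsDatum.localPairing, Fin.prod_univ_three, a, b, c]
  push_cast
  rw [hilbertSymbol_of_isSquare_right _ ⟨((s 0 : ℚ) : v.Completion), sq _⟩, one_mul,
    hilbertSymbol_mul_sq_right _ _ h1, hilbertSymbol_mul_sq_right _ _ h2]
  simp [hilbertAt]

theorem IsRep'.localPairing {n e : ℕ} {Λ Λ' : Fin 3 → SqClass} {C : CasselsDatum n Λ Λ'}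
    {s : Fin 3 → ℚ} (hs : IsRep' e C.D' s) (v : Place) :
    C.localPairing v = hilbertAt e v (tangentForm n C.D 0 (C.Q 0) (C.P v)) *
      hilbertAt e v (tangentForm n C.D 1 (C.Q 1) (C.P v)) := by
  obtain ⟨h0, a, b, c⟩ := hs
  have h1 : ((s 0 : ℚ) : v.Completion) ≠ 0 := by exact_mod_cast h0 0
  have h2 : ((s 1 : ℚ) : v.Completion) ≠ 0 := by exact_mod_cast h0 1
  rw [CasselsDatum.localPairing, Fin.prod_univ_three, a, b, c]
  push_cast
  rw [hilbertSymbol_of_isSquare_right _ ⟨((s 2 : ℚ) : v.Completion), sq _⟩, mul_one,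
    hilbertSymbol_mul_sq_right _ _ h1, hilbertSymbol_mul_sq_right _ _ h2]
  simp [hilbertAt]

theorem hilbertSymbol_near_of_tame {p m : ℕ} [hp : Fact p.Prime] (h8 : p % 8 = 1) {e f : ℕ}
    (hsq : Squarefree e) (hpe : p ∣ e) {k : ℤ} {a b t : ℚ_[p]} (hb : b ≠ 0) (ht : ‖t‖ ≤ ‖b‖)
    (h : a ^ 2 = b ^ 2 + k * ((e * f : ℕ) * t ^ 2)) : hilbertSymbol (a * b) (m : ℚ_[p]) = 1 := by
  apply hilbertSymbol_mul_of_sq_near h8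
  obtain ⟨u, hu, e'⟩ := exists_eq_p_mul_unit hsq hpe
  have hb' : 0 < ‖b‖ := norm_pos_iff.2 hb
  have : ‖(p : ℚ_[p])‖ < 1 := Padic.norm_p_lt_one
  rw [h, add_sub_cancel_left, Nat.cast_mul, e', norm_mul, norm_mul, norm_mul, norm_mul, hu,
    norm_pow, mul_one]
  calc ‖(k : ℚ_[p])‖ * (‖(p : ℚ_[p])‖ * ‖(f : ℚ_[p])‖ * ‖t‖ ^ 2)
      ≤ 1 * (‖(p : ℚ_[p])‖ * 1 * ‖b‖ ^ 2) := by
        gcongr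
        · exact Padic.norm_int_le_one k
        · exact norm_natCast_le_one f
    _ < 1 * (1 * 1 * ‖b‖ ^ 2) := by gcongr
    _ = ‖b‖ ^ 2 := by ring

section Conics

variable {n d d' : ℕ} {D : Fin 3 → ℚˣ} {F : Type*} [Field F] [CharZero F] {s : Fin 3 → ℚ}

theorem IsRep.conics (hs : IsRep d D s) (hn : n = d * d') (hd : d ≠ 0) {x : Fin 4 → F}
    (hx : IsCurvePoint n D x) :
    (s 1 * x 2) ^ 2 = ((1 : ℤ) : F) * (s 2 * x 3) ^ 2 + ((d' : ℤ) : F) * x 0 ^ 2 ∧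
    (s 2 * x 3) ^ 2 = ((d : ℤ) : F) * (s 0 * x 1 / d) ^ 2 + ((d' : ℤ) : F) * x 0 ^ 2 ∧
    (s 1 * x 2) ^ 2 =
      ((d : ℤ) : F) * (s 0 * x 1 / d) ^ 2 + ((2 * (d' : ℤ) : ℤ) : F) * x 0 ^ 2 ∧
    (s 0 * x 1 / d, x 0, s 2 * x 3) ≠ (0, 0, 0) ∧
    (s 0 * x 1 / d, x 0, s 1 * x 2) ≠ (0, 0, 0) := by
  obtain ⟨h0, h1, h2⟩ := hs.curve hn hd hx
  generalize s 0 * x 1 / d = w at *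
  generalize s 1 * x 2 = u at *
  generalize s 2 * x 3 = r at *
  refine ⟨by rw [h1]; push_cast; ring, by rw [h2]; push_cast; ring,
    by rw [h1, h2]; push_cast; ring, fun h => h0 ?_, fun h => h0 ?_⟩ <;>
  simp only [Prod.mk.injEq] at h ⊢ <;> obtain ⟨rfl, b, rfl⟩ := h
  · exact ⟨b, rfl, pow_eq_zero_iff two_ne_zero |>.1 (by rw [h1, b]; ring), rfl⟩
  · exact ⟨b, rfl, rfl, pow_eq_zero_iff two_ne_zero |>.1 (by rw [h2, b]; ring)⟩

theorem IsRep'.conics (hs : IsRep' d D s) (hn : n = d * d') (hd : d ≠ 0) {x : Fin 4 → F}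
    (hx : IsCurvePoint n D x) :
    (s 1 * x 2) ^ 2 = ((d : ℤ) : F) * (s 2 * x 3 / d) ^ 2 + ((d' : ℤ) : F) * x 0 ^ 2 ∧
    (s 0 * x 1) ^ 2 = ((d : ℤ) : F) * (s 2 * x 3 / d) ^ 2 + ((-(d' : ℤ) : ℤ) : F) * x 0 ^ 2 ∧
    (s 2 * x 3 / d, x 0, s 1 * x 2) ≠ (0, 0, 0) ∧
    (s 2 * x 3 / d, x 0, s 0 * x 1) ≠ (0, 0, 0) := by
  obtain ⟨h0, h1, h2⟩ := hs.curve hn hd hx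
  generalize s 2 * x 3 / d = w at *
  generalize s 1 * x 2 = u at *
  generalize s 0 * x 1 = r at *
  refine ⟨by rw [h1]; push_cast; ring, by rw [h2]; push_cast; ring,
    fun h => h0 ?_, fun h => h0 ?_⟩ <;>
  simp only [Prod.mk.injEq] at h ⊢ <;> obtain ⟨rfl, b, rfl⟩ := h
  · exact ⟨b, pow_eq_zero_iff two_ne_zero |>.1 (by rw [h2, b]; ring), rfl, rfl⟩
  · exact ⟨b, rfl, pow_eq_zero_iff two_ne_zero |>.1 (by rw [h1, b]; ring), rfl⟩

end Conics

/-! ### Values of the pairing on the four kinds of pairs -/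

section Pairing

variable {n d e f : ℕ}

theorem LocallyGoodFactors.not_dvd_left (h : LocallyGoodFactors n d e f) {p : ℕ}
    (hp : ¬ p ∣ 2 * n) : ¬ p ∣ d := fun hd => hp ((hd.trans h.left.dvd).mul_left 2)

theorem LocallyGoodFactors.hilbertAt_mul_eq_one (h : LocallyGoodFactors n d e f) {p : ℕ}
    [hp : Fact p.Prime] (hpe : p ∣ e) {k : ℤ} {a b t : ℚ_[p]} (hb : b ≠ 0) (ht : ‖t‖ ≤ ‖b‖)
    (hab : a ^ 2 = b ^ 2 + k * ((e * f : ℕ) * t ^ 2)) :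
    hilbertAt e (primePlace p) (a * b : ℚ_[p]) = 1 :=
  (hilbertAt_prime e p _).trans (hilbertSymbol_near_of_tame (h.mid.oneModEight.2 p hp.out hpe)
    h.mid.squarefree hpe hb ht hab)

/-- The pairing of `(1, d, d)` and `(1, e, e)`. -/
theorem hasPlaceProd_localPairing_Lam_Lam (h : LocallyGoodFactors n d e f)
    (C : CasselsDatum n (Lam d) (Lam e)) {a b c α β γ : ℤ}
    (hg : Int.gcd (Int.gcd a b) c = 1) (hc : c ^ 2 = (d : ℤ) * a ^ 2 + ((e * f : ℕ) : ℤ) * b ^ 2)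
    (hg' : Int.gcd (Int.gcd α β) γ = 1)
    (hγ : γ ^ 2 = (d : ℤ) * α ^ 2 + (2 * ((e * f : ℕ) : ℤ)) * β ^ 2) :
    HasPlaceProd C.localPairing (jacobiSym (c * γ) e) := by
  have hd0 := h.left.oneModEight.1
  have hd0' : (d : ℚ) ≠ 0 := by exact_mod_cast hd0
  obtain ⟨s, hs⟩ := exists_isRep hd0 C.hD
  obtain ⟨s', hs'⟩ := exists_isRep h.mid.oneModEight.1 C.hD'
  have hcur := fun v => hs.curve h.eq hd0 (C.hP v)
  have hcon := fun v => hs.conics h.eq hd0 (C.hP v)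
  have hdd : ∀ (p : ℕ) [Fact p.Prime], p ∣ e → IsSquare (d : ℚ_[p]) := fun p _ => h.isSquare_left
  have hG1 := h.goodConic dvd_rfl hdd (one_mul _).symm (Or.inl rfl)
  have hG2 := h.goodConic dvd_rfl hdd (s := 2) rfl (Or.inr (Or.inr rfl))
  refine (hasPlaceProd_polar_mul_polar h.mid hG1 hG2 (fun v => (hcon v).2.1)
    (fun v => (hcon v).2.2.2.1) (fun v => (hcon v).2.2.1) (fun v => (hcon v).2.2.2.2)
    (fun p hp hpn => ?_) (fun p hp hpe => ?_) (hs.conic_one h.eq hd0 (C.hQ 1)).1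
    (hs.conic_one h.eq hd0 (C.hQ 1)).2 (hs.conic_two h.eq hd0 (C.hQ 2)).1
    ((hs.conic_two h.eq hd0 (C.hQ 2)).2.trans (by push_cast; rfl)) hg hc hg' hγ
    (k := d) (k' := -d) hd0' (neg_ne_zero.2 hd0') (fun v => ?_) (fun v => ?_)).congr fun v => ?_
  · obtain ⟨l, h1, h2, h3, -⟩ := exists_scale (p := p) (h.not_dvd_left hpn)
      (hcur (primePlace p)).1 (hcur (primePlace p)).2.1 (hcur (primePlace p)).2.2
    exact ⟨l, h1, h2, h3⟩
  · obtain ⟨h1, h2, h3⟩ := (hG2.tame p hpe).1.maxNorm (hcon (primePlace p)).2.2.1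
      (hcon (primePlace p)).2.2.2.2
    -- As r² = u² − d't² with p ∣ d', the leading coordinates r and u of the two conics agree up to
    -- sign modulo p.
    refine h.hilbertAt_mul_eq_one (k := -1) hpe h1 h3 ?_
    have := (hcur (primePlace p)).2.1
    refine (eq_sub_of_add_eq this.symm).trans ?_
    rw [sub_eq_add_neg, Int.cast_neg, Int.cast_one, neg_one_mul]; rfl
  · rw [← hs.tangent_one h.eq hd0]; exact C.hL v 1
  · have := hs.tangent_two h.eq hd0 (C.Q 2) (C.P v)
    rw [← this]; exact C.hL v 2
  · rw [hs'.localPairing, hs.tangent_one h.eq hd0, hs.tangent_two h.eq hd0]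

/-- The pairing of `(1, d, d)` and `(e, e, 1)`. -/
theorem hasPlaceProd_localPairing_Lam_Lam' (h : LocallyGoodFactors n d e f)
    (C : CasselsDatum n (Lam d) (Lam' e)) {a b c : ℤ}
    (hg : Int.gcd (Int.gcd a b) c = 1) (hc : c ^ 2 = (d : ℤ) * a ^ 2 + ((e * f : ℕ) : ℤ) * b ^ 2) :
    HasPlaceProd C.localPairing (jacobiSym c e) := by
  have hd0 := h.left.oneModEight.1
  have hd0' : (d : ℚ) ≠ 0 := by exact_mod_cast hd0
  obtain ⟨s, hs⟩ := exists_isRep hd0 C.hD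
  obtain ⟨s', hs'⟩ := exists_isRep' h.mid.oneModEight.1 C.hD'
  have hcur := fun v => hs.curve h.eq hd0 (C.hP v)
  have hcon := fun v => hs.conics h.eq hd0 (C.hP v)
  have hG1 := h.goodConic (one_dvd d) (fun p _ _ => by simp) (one_mul _).symm (Or.inl rfl)
  have hG2 := h.goodConic dvd_rfl (fun p _ => h.isSquare_left) (one_mul _).symm (Or.inl rfl)
  have hP0 : ∀ v, (s 2 * C.P v 3, C.P v 0, s 1 * C.P v 2) ≠ (0, 0, 0) := fun v h0 => by
    obtain ⟨h1, h2, h3⟩ := hcur v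
    simp only [Prod.mk.injEq] at h0
    obtain ⟨a, b, c⟩ := h0
    rw [a, b] at h3
    refine h1 ?_
    have : (s 0 * C.P v 1 / d : v.Completion) ^ 2 = 0 := by
      have hd1 : (d : v.Completion) ≠ 0 := by exact_mod_cast hd0
      apply mul_left_cancel₀ hd1
      linear_combination -h3
    rw [a, b, c, pow_eq_zero_iff two_ne_zero |>.1 this]
  -- The first conic has the rational point (1, 0, 1) and contributes the symbol of 1, so only c
  -- remains.
  have e := hasPlaceProd_polar_mul_polar h.mid hG1 hG2 (fun v => (hcon v).1)
    hP0 (fun v => (hcon v).2.1) (fun v => (hcon v).2.2.2.1)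
    (fun p hp hpn => ?_) (fun p hp hpe => ?_) (hs.conic_zero h.eq hd0 (C.hQ 0)).1
    (hs.conic_zero h.eq hd0 (C.hQ 0)).2 (hs.conic_one h.eq hd0 (C.hQ 1)).1
    (hs.conic_one h.eq hd0 (C.hQ 1)).2 (x₀ := 1) (y₀ := 0) (z₀ := 1) (by simp) (by simp) hg hc
    (k := d) (k' := d) hd0' hd0' (fun v => ?_) (fun v => ?_)
  · rw [one_mul] at e
    exact e.congr fun v => by
      rw [hs'.localPairing, hs.tangent_zero h.eq, hs.tangent_one h.eq hd0]; rfl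
  · obtain ⟨l, h1, h2, -, h3⟩ := exists_scale (p := p) (h.not_dvd_left hpn)
      (hcur (primePlace p)).1 (hcur (primePlace p)).2.1 (hcur (primePlace p)).2.2
    exact ⟨l, h1, h3, h2⟩
  · obtain ⟨h1, h2, h3⟩ := (hG2.tame p hpe).1.maxNorm (hcon (primePlace p)).2.1
      (hcon (primePlace p)).2.2.2.1
    refine h.hilbertAt_mul_eq_one (k := 1) hpe h1 h3 ?_
    refine (hcur (primePlace p)).2.1.trans ?_
    rw [Int.cast_one, one_mul]; rfl
  · have := hs.tangent_zero h.eq (C.Q 0) (C.P v)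
    exact fun h0 => C.hL v 0 (this.trans h0)
  · rw [← hs.tangent_one h.eq hd0]; exact C.hL v 1

/-- The pairing of `(d, d, 1)` and `(e, e, 1)`. -/
theorem hasPlaceProd_localPairing_Lam'_Lam' (h : LocallyGoodFactors n d e f)
    (C : CasselsDatum n (Lam' d) (Lam' e)) {a b c a' b' c' : ℤ}
    (hg : Int.gcd (Int.gcd a b) c = 1) (hc : c ^ 2 = (d : ℤ) * a ^ 2 + ((e * f : ℕ) : ℤ) * b ^ 2)
    (hg' : Int.gcd (Int.gcd a' b') c' = 1)
    (hc' : c' ^ 2 = (d : ℤ) * a' ^ 2 + (-((e * f : ℕ) : ℤ)) * b' ^ 2) :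
    HasPlaceProd C.localPairing (jacobiSym (c * c') e) := by
  have hd0 := h.left.oneModEight.1
  have hd0' : (d : ℚ) ≠ 0 := by exact_mod_cast hd0
  obtain ⟨s, hs⟩ := exists_isRep' hd0 C.hD
  obtain ⟨s', hs'⟩ := exists_isRep' h.mid.oneModEight.1 C.hD'
  have hcur := fun v => hs.curve h.eq hd0 (C.hP v)
  have hcon := fun v => hs.conics h.eq hd0 (C.hP v)
  have hdd : ∀ (p : ℕ) [Fact p.Prime], p ∣ e → IsSquare (d : ℚ_[p]) := fun p _ => h.isSquare_left
  have hG1 := h.goodConic dvd_rfl hdd (one_mul _).symm (Or.inl rfl)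
  have hG2 := h.goodConic dvd_rfl hdd (neg_one_mul _).symm (Or.inr (Or.inl rfl))
  refine (hasPlaceProd_polar_mul_polar h.mid hG1 hG2 (fun v => (hcon v).1)
    (fun v => (hcon v).2.2.1) (fun v => (hcon v).2.1) (fun v => (hcon v).2.2.2)
    (fun p hp hpn => ?_) (fun p hp hpe => ?_) (hs.conic_zero h.eq hd0 (C.hQ 0)).1
    (hs.conic_zero h.eq hd0 (C.hQ 0)).2 (hs.conic_one h.eq hd0 (C.hQ 1)).1
    (hs.conic_one h.eq hd0 (C.hQ 1)).2 hg hc hg' hc'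
    (k := d) (k' := -d) hd0' (neg_ne_zero.2 hd0') (fun v => ?_) (fun v => ?_)).congr fun v => ?_
  · obtain ⟨l, h1, h2, h3⟩ := exists_scale' (p := p)
      (hcur (primePlace p)).1 (hcur (primePlace p)).2.1 (hcur (primePlace p)).2.2
    exact ⟨l, h1, h2, h3⟩
  · obtain ⟨h1, h2, h3⟩ := (hG2.tame p hpe).1.maxNorm (hcon (primePlace p)).2.1
      (hcon (primePlace p)).2.2.2
    refine h.hilbertAt_mul_eq_one (k := 2) hpe h1 h3 ?_
    have e1 := (hcur (primePlace p)).2.1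
    have e2 := (hcur (primePlace p)).2.2
    have : ((s 1 : ℚ) * C.P (primePlace p) 2 : (primePlace p).Completion) ^ 2 =
        ((s 0 : ℚ) * C.P (primePlace p) 1 : (primePlace p).Completion) ^ 2 +
        (2 : ℤ) * ((e * f : ℕ) * (C.P (primePlace p) 0) ^ 2) := by
      rw [e1, e2]; push_cast; ring
    exact this
  · rw [← hs.tangent_zero h.eq hd0]; exact C.hL v 0
  · rw [← hs.tangent_one h.eq hd0]; exact C.hL v 1
  · rw [hs'.localPairing, hs.tangent_zero h.eq hd0, hs.tangent_one h.eq hd0]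

/-- The pairing of `(1, d, d)` and `(d, d, 1)`. -/
theorem hasPlaceProd_localPairing_self (h : LocallyGoodFactors n e d 1)
    (C : CasselsDatum n (Lam d) (Lam' d)) {a b c : ℤ}
    (hg : Int.gcd (Int.gcd a b) c = 1) (hc : c ^ 2 = (d : ℤ) * a ^ 2 + (e : ℤ) * b ^ 2) :
    HasPlaceProd C.localPairing ((-1) ^ delta d * jacobiSym c d) := by
  have hd0 := h.mid.oneModEight.1
  have hn : n = d * e := by rw [h.eq]; ring
  have hd0' : (d : ℚ) ≠ 0 := by exact_mod_cast hd0
  obtain ⟨s, hs⟩ := exists_isRep hd0 C.hD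
  obtain ⟨s', hs'⟩ := exists_isRep' hd0 C.hD'
  have hcur := fun v => hs.curve hn hd0 (C.hP v)
  have hcon := fun v => hs.conics hn hd0 (C.hP v)
  -- Here the primes in question divide the first coefficient, so tameness comes from the conic with
  -- its coefficients exchanged.
  have hG : GoodConic n d d e := (h.goodConic (B := d) dvd_rfl (fun p _ => h.isSquare_left)
    (by simp) (Or.inl rfl)).symm
  refine (hasPlaceProd_polar_one_mul_polar h.mid hn h.ne_zero hG (fun p _ => h.isSquare_left)
    (fun v => (hcon v).1) (fun v => (hcon v).2.1) (fun v => (hcon v).2.2.2.1)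
    (fun p hp hpn => ?_) (hs.conic_zero hn hd0 (C.hQ 0)).1
    (hs.conic_zero hn hd0 (C.hQ 0)).2 (hs.conic_one hn hd0 (C.hQ 1)).1
    (hs.conic_one hn hd0 (C.hQ 1)).2 hg hc
    (k := d) (k' := d) hd0' hd0' (fun v => ?_) (fun v => ?_)).congr fun v => ?_
  · have hpd : ¬ p ∣ d := fun hd => hpn ((hd.trans h.mid.dvd).mul_left 2)
    obtain ⟨l, h1, h2, -, h3⟩ := exists_scale (p := p) hpd
      (hcur (primePlace p)).1 (hcur (primePlace p)).2.1 (hcur (primePlace p)).2.2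
    exact ⟨l, h1, h3, h2⟩
  · rw [← hs.tangent_zero hn]; exact C.hL v 0
  · rw [← hs.tangent_one hn hd0]; exact C.hL v 1
  · rw [hs'.localPairing, hs.tangent_zero hn, hs.tangent_one hn hd0]

end Pairing

/-! ### Character sums over finite fields and local solubility -/

section CharacterSum

variable {F : Type*} [Field F] [Fintype F] [DecidableEq F]

theorem sum_quadraticChar_sub (hF : ringChar F ≠ 2) (a : F) :
    ∑ x : F, quadraticChar F (x - a) = 0 := by
  rw [← quadraticChar_sum_zero (F := F) hF]
  exact (Equiv.subRight a).sum_comp (quadraticChar F)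

/-- An affine substitution moving a, b to 0, 1 turns the sum into χ(−1) times the Jacobi sum J(χ,
χ⁻¹) = −χ(−1). -/
theorem sum_quadraticChar_sub_mul_sub (hF : ringChar F ≠ 2) {a b : F} (hab : a ≠ b) :
    ∑ x : F, quadraticChar F (x - a) * quadraticChar F (x - b) = -1 := by
  have hb : b - a ≠ 0 := sub_ne_zero.2 hab.symm
  have h := jacobiSum_nontrivial_inv (quadraticChar_ne_one (F := F) hF)
  rw [(quadraticChar_isQuadratic F).inv, jacobiSum] at h
  have e : ∀ y : F, quadraticChar F ((b - a) * y + a - a) * quadraticChar F ((b - a) * y + a - b) =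
      quadraticChar F (-1) * (quadraticChar F y * quadraticChar F (1 - y)) := by
    intro y
    rw [← map_mul, ← map_mul, ← map_mul, show ((b - a) * y + a - a) * ((b - a) * y + a - b) =
      (b - a) ^ 2 * (-1 * (y * (1 - y))) by ring, map_mul _ ((b - a) ^ 2),
      quadraticChar_sq_one' hb, one_mul]
  have hbij : Function.Bijective fun y : F => (b - a) * y + a :=
    ((Equiv.mulLeft₀ (b - a) hb).trans (Equiv.addRight a)).bijective
  rw [← hbij.sum_comp fun x => quadraticChar F (x - a) * quadraticChar F (x - b)]
  simp only [e, ← Finset.mul_sum, h]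
  have := quadraticChar_sq_one (F := F) (a := -1) (neg_ne_zero.2 one_ne_zero)
  linear_combination -this

/-- The sum of (1 + χ(x−a))(1 − χ(x−b))(1 − χ(x−c)) exceeds the one with all signs positive by
exactly 4: the terms with a product of all three characters, and those with only b and c, cancel in
the difference. The second sum is nonnegative, so the first is nonzero and no bound on cubic
character sums is needed. -/
theorem exists_quadraticChar_pattern (hF : ringChar F ≠ 2) {a b c : F} (hab : a ≠ b) (hac : a ≠ c) :
    ∃ x : F, quadraticChar F (x - a) ≠ -1 ∧ quadraticChar F (x - b) ≠ 1 ∧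
      quadraticChar F (x - c) ≠ 1 := by
  set χ := quadraticChar F with hχ
  have hle : ∀ x, χ x = 0 ∨ χ x = 1 ∨ χ x = -1 := fun x => quadraticChar_isQuadratic F x
  have h1 : ∑ x : F, (1 + χ (x - a)) * (1 - χ (x - b)) * (1 - χ (x - c)) =
      ∑ x : F, (1 + χ (x - a)) * (1 + χ (x - b)) * (1 + χ (x - c)) -
      2 * (∑ x : F, χ (x - b) + ∑ x : F, χ (x - c) + ∑ x : F, χ (x - a) * χ (x - b) +
        ∑ x : F, χ (x - a) * χ (x - c)) := by
    simp only [Finset.mul_sum, ← Finset.sum_add_distrib, ← Finset.sum_sub_distrib]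
    exact Finset.sum_congr rfl fun x _ => by ring
  rw [sum_quadraticChar_sub hF, sum_quadraticChar_sub hF, sum_quadraticChar_sub_mul_sub hF hab,
    sum_quadraticChar_sub_mul_sub hF hac] at h1
  have h2 : 0 ≤ ∑ x : F, (1 + χ (x - a)) * (1 + χ (x - b)) * (1 + χ (x - c)) := by
    have h0 : ∀ x, 0 ≤ 1 + χ x := fun x => by rcases hle x with h | h | h <;> rw [h] <;> norm_num
    exact Finset.sum_nonneg fun x _ => mul_nonneg (mul_nonneg (h0 _) (h0 _)) (h0 _)
  obtain ⟨x, -, hx⟩ := Finset.exists_ne_zero_of_sum_ne_zero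
    (show ∑ x : F, (1 + χ (x - a)) * (1 - χ (x - b)) * (1 - χ (x - c)) ≠ 0 by omega)
  refine ⟨x, fun h => hx ?_, fun h => hx ?_, fun h => hx ?_⟩ <;> rw [h] <;> ring

end CharacterSum

section LocalPoints

variable {p : ℕ} [hp : Fact p.Prime]

theorem exists_legendreSym_pattern (h2 : p ≠ 2) {a b c : ℤ} (hab : ¬ (p : ℤ) ∣ a - b)
    (hac : ¬ (p : ℤ) ∣ a - c) (hbc : ¬ (p : ℤ) ∣ b - c) : ∃ x : ℤ,
    (x = a ∨ legendreSym p (x - a) = 1) ∧ (x = b ∨ legendreSym p (x - b) = -1) ∧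
      (x = c ∨ legendreSym p (x - c) = -1) := by
  have hcast : ∀ {a b : ℤ}, ¬ (p : ℤ) ∣ a - b → ((a : ℤ) : ZMod p) ≠ b := by
    intro a b h h'
    exact h ((ZMod.intCast_zmod_eq_zero_iff_dvd _ p).1 (by push_cast; rw [h', sub_self]) )
  have hF : ringChar (ZMod p) ≠ 2 := by rwa [ZMod.ringChar_zmod_n]
  obtain ⟨x, hx⟩ := exists_quadraticChar_pattern hF (hcast hab) (hcast hac)
  have hle : ∀ x, quadraticChar (ZMod p) x = 0 ∨ quadraticChar (ZMod p) x = 1 ∨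
    quadraticChar (ZMod p) x = -1 := fun x => quadraticChar_isQuadratic (ZMod p) x
  -- If x is the class of a, b or c, the lift is taken equal to that integer, so that the
  -- corresponding coordinate is exactly 0 and not merely divisible by p.
  obtain ⟨k, hk, hk'⟩ : ∃ k : ℤ, (k : ZMod p) = x ∧
      ∀ e ∈ ({a, b, c} : Set ℤ), (e : ZMod p) = x → k = e := by
    by_cases ha : (a : ZMod p) = x
    · refine ⟨a, ha, ?_⟩
      rintro e (rfl | rfl | rfl) he
      · rfl
      · exact absurd (ha.trans he.symm) (hcast hab)
      · exact absurd (ha.trans he.symm) (hcast hac)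
    by_cases hb : (b : ZMod p) = x
    · refine ⟨b, hb, ?_⟩
      rintro e (rfl | rfl | rfl) he
      · exact absurd he ha
      · rfl
      · exact absurd (hb.trans he.symm) (hcast hbc)
    by_cases hc : (c : ZMod p) = x
    · refine ⟨c, hc, ?_⟩
      rintro e (rfl | rfl | rfl) he
      · exact absurd he ha
      · exact absurd he hb
      · rfl
    obtain ⟨k, hk⟩ := ZMod.intCast_surjective x
    refine ⟨k, hk, ?_⟩
    rintro e (rfl | rfl | rfl) he
    · exact absurd he ha
    · exact absurd he hb
    · exact absurd he hc
  subst hk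
  refine ⟨k, ?_⟩
  simp only [legendreSym, Int.cast_sub]
  have hz : ∀ e : ℤ, e ∈ ({a, b, c} : Set ℤ) →
      quadraticChar (ZMod p) ((k : ZMod p) - e) = 0 → k = e := by
    intro e he h
    rw [quadraticChar_eq_zero_iff, sub_eq_zero] at h
    exact hk' e he h.symm
  refine ⟨?_, ?_, ?_⟩
  · rcases hle ((k : ZMod p) - a) with h | h | h
    · exact Or.inl (hz a (by simp) h)
    · exact Or.inr h
    · exact absurd h hx.1
  · rcases hle ((k : ZMod p) - b) with h | h | h
    · exact Or.inl (hz b (by simp) h)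
    · exact absurd h hx.2.1
    · exact Or.inr h
  · rcases hle ((k : ZMod p) - c) with h | h | h
    · exact Or.inl (hz c (by simp) h)
    · exact absurd h hx.2.2
    · exact Or.inr h

theorem exists_mul_sq_eq {k δ : ℤ} (h2 : p ≠ 2) (h : k = 0 ∨ legendreSym p (δ * k) = 1)
    (hδ : ¬ (p : ℤ) ∣ δ) : ∃ u : ℚ_[p], δ * u ^ 2 = k := by
  rcases h with rfl | h
  · exact ⟨0, by simp⟩
  · have hk : ¬ (p : ℤ) ∣ δ * k := fun hdvd => by
      rw [(legendreSym.eq_zero_iff p _).2 ((ZMod.intCast_zmod_eq_zero_iff_dvd _ p).2 hdvd)] at h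
      norm_num at h
    obtain ⟨u, hu⟩ := (isSquare_intCast_iff h2 hk).2 h
    have hδ0 : (δ : ℚ_[p]) ≠ 0 := by
      intro h0; exact hδ (by rw [Int.cast_eq_zero.1 h0]; exact dvd_zero _)
    refine ⟨u / δ, ?_⟩
    push_cast at hu
    field_simp
    linear_combination -hu

/-- Points at a prime of good reduction, for a non-square unit `d`. -/
theorem exists_points_of_good {n d : ℕ} (h : ¬ p ∣ 2 * n) (hd : ¬ p ∣ d)
    (hsq : ¬ IsSquare (d : ℚ_[p])) :
    (∃ u₁ u₂ u₃ : ℚ_[p], d * u₂ ^ 2 - d * u₃ ^ 2 = n ∧ d * u₃ ^ 2 - u₁ ^ 2 = n) ∧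
    ∃ u₁ u₂ u₃ : ℚ_[p], d * u₂ ^ 2 - u₃ ^ 2 = n ∧ u₃ ^ 2 - d * u₁ ^ 2 = n := by
  obtain ⟨h2, hn⟩ := not_dvd_two_mul h
  have hn' : ¬ (p : ℤ) ∣ n := by exact_mod_cast hn
  have h2n' : ¬ (p : ℤ) ∣ 2 * n := by exact_mod_cast h
  have hd' : ¬ (p : ℤ) ∣ d := by exact_mod_cast hd
  have hld : legendreSym p d = -1 := by
    rcases legendreSym.eq_one_or_neg_one p (a := (d : ℤ)) (fun h0 =>
      hd' ((ZMod.intCast_zmod_eq_zero_iff_dvd _ p).1 h0)) with h1 | h1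
    · exact absurd (by exact_mod_cast (isSquare_intCast_iff h2 hd').2 h1) hsq
    · exact h1
  have key : ∀ {x e : ℤ}, x = e ∨ legendreSym p (x - e) = 1 →
      ∃ u : ℚ_[p], u ^ 2 = x - e := by
    intro x e h
    obtain ⟨u, hu⟩ := exists_mul_sq_eq (k := x - e) (δ := 1) h2
      (h.imp sub_eq_zero.2 (by rw [one_mul]; exact id)) (fun h => hp.out.one_lt.ne' (by
        exact_mod_cast Int.eq_one_of_dvd_one (by positivity) h))
    exact ⟨u, by push_cast at hu; linear_combination hu⟩
  have key' : ∀ {x e : ℤ}, x = e ∨ legendreSym p (x - e) = -1 →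
      ∃ u : ℚ_[p], d * u ^ 2 = x - e := by
    intro x e h
    obtain ⟨u, hu⟩ := exists_mul_sq_eq (k := x - e) (δ := d) h2
      (h.imp sub_eq_zero.2 (fun h => by rw [legendreSym.mul, hld, h]; rfl)) hd'
    exact ⟨u, by push_cast at hu; exact hu⟩
  constructor
  -- Here x is the abscissa on the elliptic curve: x − n, x + n and x are to equal u₁², d u₂² and d
  -- u₃². The second case asks for d u₁², d u₂² and u₃² instead.
  · obtain ⟨x, h1, h3, h2'⟩ := exists_legendreSym_pattern h2 (a := n) (b := 0) (c := -n)
      (by rwa [sub_zero]) (by rwa [sub_neg_eq_add, ← two_mul]) (by rwa [zero_sub, neg_neg])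
    obtain ⟨u₁, e₁⟩ := key h1
    obtain ⟨u₂, e₂⟩ := key' h2'
    obtain ⟨u₃, e₃⟩ := key' h3
    push_cast at e₁ e₂ e₃
    exact ⟨u₁, u₂, u₃, by linear_combination e₂ - e₃, by linear_combination e₃ - e₁⟩
  · obtain ⟨x, h3, h1, h2'⟩ := exists_legendreSym_pattern h2 (a := 0) (b := n) (c := -n)
      (by rwa [zero_sub, Int.dvd_neg]) (by rwa [zero_sub, neg_neg]) (by rwa [sub_neg_eq_add, ← two_mul])
    obtain ⟨u₁, e₁⟩ := key' h1
    obtain ⟨u₂, e₂⟩ := key' h2'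
    obtain ⟨u₃, e₃⟩ := key h3
    push_cast at e₁ e₂ e₃
    exact ⟨u₁, u₂, u₃, by linear_combination e₂ - e₃, by linear_combination e₃ - e₁⟩

end LocalPoints

/-- Local solubility in both cases. -/
theorem exists_local_points {n d e : ℕ} (hd : LocallyGood n d) (hn : n = d * e)
    (he : ∀ (p : ℕ) [Fact p.Prime], p ∣ d → IsSquare (e : ℚ_[p])) (v : Place) :
    (∃ t u₁ u₂ u₃ : v.Completion, (t, u₁, u₂, u₃) ≠ (0, 0, 0, 0) ∧
      d * u₂ ^ 2 - d * u₃ ^ 2 = n * t ^ 2 ∧ d * u₃ ^ 2 - u₁ ^ 2 = n * t ^ 2) ∧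
    ∃ t u₁ u₂ u₃ : v.Completion, (t, u₁, u₂, u₃) ≠ (0, 0, 0, 0) ∧
      d * u₂ ^ 2 - u₃ ^ 2 = n * t ^ 2 ∧ u₃ ^ 2 - d * u₁ ^ 2 = n * t ^ 2 := by
  -- Where d is a square, both curves have an obvious point with t = 0.
  have hsq : IsSquare (d : v.Completion) → _ := fun h => show
    (∃ t u₁ u₂ u₃ : v.Completion, (t, u₁, u₂, u₃) ≠ (0, 0, 0, 0) ∧
      d * u₂ ^ 2 - d * u₃ ^ 2 = n * t ^ 2 ∧ d * u₃ ^ 2 - u₁ ^ 2 = n * t ^ 2) ∧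
    ∃ t u₁ u₂ u₃ : v.Completion, (t, u₁, u₂, u₃) ≠ (0, 0, 0, 0) ∧
      d * u₂ ^ 2 - u₃ ^ 2 = n * t ^ 2 ∧ u₃ ^ 2 - d * u₁ ^ 2 = n * t ^ 2 by
    obtain ⟨s, hs⟩ := h
    exact ⟨⟨0, s, 1, 1, by simp, by ring, by linear_combination hs⟩,
      ⟨0, 1, 1, s, by simp, by linear_combination hs, by linear_combination -hs⟩⟩
  cases v with
  | infinite =>
    exact hsq ((Real.isSquare_iff).2 (Nat.cast_nonneg d) : IsSquare (d : ℝ))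
  | finite p hp =>
    have hp' : Fact p.Prime := ⟨hp⟩
    by_cases hpd : p ∣ d
    · have h8 := hd.oneModEight.2 p hp hpd
      obtain ⟨r, hr⟩ := he p hpd
      obtain ⟨j, hj⟩ := isSquare_two_padic h8
      obtain ⟨i, hi⟩ := isSquare_neg_one_padic h8
      have h1 : (∃ t u₁ u₂ u₃ : ℚ_[p], (t, u₁, u₂, u₃) ≠ (0, 0, 0, 0) ∧
          d * u₂ ^ 2 - d * u₃ ^ 2 = n * t ^ 2 ∧ d * u₃ ^ 2 - u₁ ^ 2 = n * t ^ 2) ∧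
        ∃ t u₁ u₂ u₃ : ℚ_[p], (t, u₁, u₂, u₃) ≠ (0, 0, 0, 0) ∧
          d * u₂ ^ 2 - u₃ ^ 2 = n * t ^ 2 ∧ u₃ ^ 2 - d * u₁ ^ 2 = n * t ^ 2 := by
        rw [hn]; push_cast
        -- At p ∣ d the points come from e = r², j² = 2, i² = −1 and n = de.
        refine ⟨⟨1, 0, j * r, r, by simp, ?_, ?_⟩, ⟨1, i * r, r, 0, by simp, ?_, ?_⟩⟩ <;> rw [hr]
        · linear_combination (-d * r ^ 2) * hj
        · ring
        · ring
        · linear_combination (d * r ^ 2) * hi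
      exact h1
    by_cases hpn : p ∣ 2 * n
    · exact hsq (hd.isSquare p hpn hpd)
    by_cases hds : IsSquare (d : ℚ_[p])
    · exact hsq hds
    obtain ⟨⟨u₁, u₂, u₃, h1, h2⟩, ⟨v₁, v₂, v₃, h3, h4⟩⟩ := exists_points_of_good hpn hpd hds
    have h5 : (∃ t u₁ u₂ u₃ : ℚ_[p], (t, u₁, u₂, u₃) ≠ (0, 0, 0, 0) ∧
          d * u₂ ^ 2 - d * u₃ ^ 2 = n * t ^ 2 ∧ d * u₃ ^ 2 - u₁ ^ 2 = n * t ^ 2) ∧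
        ∃ t u₁ u₂ u₃ : ℚ_[p], (t, u₁, u₂, u₃) ≠ (0, 0, 0, 0) ∧
          d * u₂ ^ 2 - u₃ ^ 2 = n * t ^ 2 ∧ u₃ ^ 2 - d * u₁ ^ 2 = n * t ^ 2 :=
      ⟨⟨1, u₁, u₂, u₃, by simp, by rw [h1]; ring, by rw [h2]; ring⟩,
        ⟨1, v₁, v₂, v₃, by simp, by rw [h3]; ring, by rw [h4]; ring⟩⟩
    exact h5

/-! ### Nonvanishing of the tangent forms at a local point -/

section Signs

variable {F : Type*} [Field F] [CharZero F]

/-- If both signs gave 0, subtraction would force z = 0; the polar form is then a degenerate binary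
one, whose vanishing contradicts B y²c² ≠ 0. -/
theorem polar_ne_zero_or {A B a b c x y z : F} (hB : B ≠ 0) (hc : c ≠ 0)
    (hQ : c ^ 2 = A * a ^ 2 + B * b ^ 2) (hP : z ^ 2 = A * x ^ 2 + B * y ^ 2) (hy : y ≠ 0) :
    polar A B a b c x y z ≠ 0 ∨ polar A B a b c x y (-z) ≠ 0 := by
  by_contra hcon
  push Not at hcon
  obtain ⟨h1, h2⟩ := hcon
  unfold polar at h1 h2
  have hz : c * z = 0 := by linear_combination (h1 - h2) / 2
  have hz : z = 0 := (mul_eq_zero.1 hz).resolve_left hc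
  subst hz
  have : B * y ^ 2 * c ^ 2 = 0 := by
    linear_combination (B * y ^ 2) * hQ - (A * a ^ 2) * hP - (B * b * y - A * a * x) * h1
  exact mul_ne_zero (mul_ne_zero hB (pow_ne_zero 2 hy)) (pow_ne_zero 2 hc) this

/-- The signs of the coordinates of a point can be chosen so that three tangent forms do not
vanish. -/
theorem exists_signs {A B B' a b c α β γ t w r u : F} (hA : A ≠ 0) (hB : B ≠ 0) (hB' : B' ≠ 0)
    (hBB : B ≠ B') (hb : b ≠ 0) (hc : c ≠ 0) (hβ : β ≠ 0) (hγ : γ ≠ 0)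
    (hQ : c ^ 2 = A * a ^ 2 + B * b ^ 2) (hQ' : γ ^ 2 = A * α ^ 2 + B' * β ^ 2)
    (h0 : (t, w, r, u) ≠ (0, 0, 0, 0)) (hP : r ^ 2 = A * w ^ 2 + B * t ^ 2)
    (hP' : u ^ 2 = A * w ^ 2 + B' * t ^ 2) :
    ∃ r' u' : F, (r' = r ∨ r' = -r) ∧ (u' = u ∨ u' = -u) ∧ polar A B a b c w t r' ≠ 0 ∧
      polar A B' α β γ w t u' ≠ 0 ∧ u' - r' ≠ 0 := by
  by_cases ht : t = 0
  · subst ht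
    have hr : r ≠ 0 := by
      rintro rfl
      have hw : w = 0 := by
        have : A * w ^ 2 = 0 := by linear_combination -hP
        exact pow_eq_zero_iff two_ne_zero |>.1 ((mul_eq_zero.1 this).resolve_left hA)
      subst hw
      exact h0 (by rw [pow_eq_zero_iff two_ne_zero |>.1 (hP'.trans (by ring))])
    have hu : u = r ∨ u = -r := sq_eq_sq_iff_eq_or_eq_neg.1 (by rw [hP, hP']; ring)
    have aux : ∀ {B a b c r : F}, B ≠ 0 → b ≠ 0 → r ≠ 0 → c ^ 2 = A * a ^ 2 + B * b ^ 2 →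
        r ^ 2 = A * w ^ 2 → polar A B a b c w 0 r ≠ 0 := by
      intro B a b c r hB hb hr hQ hP h
      unfold polar at h
      have : B * b ^ 2 * r ^ 2 = 0 := by
        linear_combination (c * r + A * a * w) * h - r ^ 2 * hQ - A * a ^ 2 * hP
      exact mul_ne_zero (mul_ne_zero hB (pow_ne_zero 2 hb)) (pow_ne_zero 2 hr) this
    -- With t = 0 one has u² = r², so opposite signs are needed to keep u' − r' nonzero.
    refine ⟨r, -r, Or.inl rfl, ?_, aux hB hb hr hQ (by rw [hP]; ring),
      aux hB' hβ (neg_ne_zero.2 hr) hQ' (by rw [neg_sq, hP]; ring), fun h => hr ?_⟩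
    · rcases hu with rfl | rfl
      · exact Or.inr rfl
      · exact Or.inl rfl
    · linear_combination -h / 2
  · have h1 : ∃ r', (r' = r ∨ r' = -r) ∧ polar A B a b c w t r' ≠ 0 := by
      rcases polar_ne_zero_or hB hc hQ hP ht with h | h
      · exact ⟨r, Or.inl rfl, h⟩
      · exact ⟨-r, Or.inr rfl, h⟩
    have h2 : ∃ u', (u' = u ∨ u' = -u) ∧ polar A B' α β γ w t u' ≠ 0 := by
      rcases polar_ne_zero_or hB' hγ hQ' hP' ht with h | h
      · exact ⟨u, Or.inl rfl, h⟩
      · exact ⟨-u, Or.inr rfl, h⟩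
    obtain ⟨r', hr, h1⟩ := h1
    obtain ⟨u', hu, h2⟩ := h2
    refine ⟨r', u', hr, hu, h1, h2, fun h => ?_⟩
    have e1 : r' ^ 2 = r ^ 2 := sq_eq_sq_iff_eq_or_eq_neg.2 hr
    have e2 : u' ^ 2 = u ^ 2 := sq_eq_sq_iff_eq_or_eq_neg.2 hu
    have : (B' - B) * t ^ 2 = 0 := by
      linear_combination hP - hP' + e1 - e2 + (u' + r') * h
    exact mul_ne_zero (sub_ne_zero.2 hBB.symm) (pow_ne_zero 2 ht) this

end Signs

theorem sqClass_mul_self (q : ℚ) : sqClass q * sqClass q = 1 := by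
  unfold sqClass
  split_ifs with h
  · exact one_mul 1
  · rw [← QuotientGroup.mk_mul, QuotientGroup.eq_one_iff]
    exact ⟨Units.mk0 q h, sq _⟩

/-- The standard representative of `(1, d, d)`. -/
def lamUnits (d : ℕ) (hd : d ≠ 0) : Fin 3 → ℚˣ :=
  ![1, Units.mk0 (d : ℚ) (by exact_mod_cast hd), Units.mk0 (d : ℚ) (by exact_mod_cast hd)]

/-- The standard representative of `(d, d, 1)`. -/
def lamUnits' (d : ℕ) (hd : d ≠ 0) : Fin 3 → ℚˣ :=
  ![Units.mk0 (d : ℚ) (by exact_mod_cast hd), Units.mk0 (d : ℚ) (by exact_mod_cast hd), 1]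

theorem mk_lamUnits {d : ℕ} (hd : d ≠ 0) (i : Fin 3) : (lamUnits d hd i : SqClass) = Lam d i := by
  have hd' : (d : ℚ) ≠ 0 := by exact_mod_cast hd
  have h : sqClass d = (Units.mk0 (d : ℚ) hd' : ℚˣ) := dif_neg hd'
  fin_cases i
  · rfl
  · exact h.symm
  · exact h.symm

theorem mk_lamUnits' {d : ℕ} (hd : d ≠ 0) (i : Fin 3) :
    (lamUnits' d hd i : SqClass) = Lam' d i := by
  have hd' : (d : ℚ) ≠ 0 := by exact_mod_cast hd
  have h : sqClass d = (Units.mk0 (d : ℚ) hd' : ℚˣ) := dif_neg hd'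
  fin_cases i
  · exact h.symm
  · exact h.symm
  · rfl

theorem isCurvePoint_lamUnits {n d : ℕ} (hd : d ≠ 0) {F : Type*} [Field F] [CharZero F]
    {t u₁ u₂ u₃ : F} (h0 : (t, u₁, u₂, u₃) ≠ (0, 0, 0, 0)) (h1 : d * u₂ ^ 2 - d * u₃ ^ 2 = n * t ^ 2)
    (h2 : d * u₃ ^ 2 - u₁ ^ 2 = n * t ^ 2) :
    IsCurvePoint n (lamUnits d hd) ![t, u₁, u₂, u₃] := by
  rw [isCurvePoint_iff]
  refine ⟨fun h => h0 ?_, ?_⟩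
  · have := fun i => congrFun h i
    simp only [Fin.forall_fin_succ] at this
    simpa using this
  · simp [lamUnits]
    exact ⟨by linear_combination h1, by linear_combination h2, by linear_combination -h1 - h2⟩

theorem isCurvePoint_lamUnits' {n d : ℕ} (hd : d ≠ 0) {F : Type*} [Field F] [CharZero F]
    {t u₁ u₂ u₃ : F} (h0 : (t, u₁, u₂, u₃) ≠ (0, 0, 0, 0)) (h1 : d * u₂ ^ 2 - u₃ ^ 2 = n * t ^ 2)
    (h2 : u₃ ^ 2 - d * u₁ ^ 2 = n * t ^ 2) :
    IsCurvePoint n (lamUnits' d hd) ![t, u₁, u₂, u₃] := by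
  rw [isCurvePoint_iff]
  refine ⟨fun h => h0 ?_, ?_⟩
  · have := fun i => congrFun h i
    simp only [Fin.forall_fin_succ] at this
    simpa using this
  · simp [lamUnits']
    exact ⟨by linear_combination h1, by linear_combination h2, by linear_combination -h1 - h2⟩

/-! ### Selmer membership and existence of the choices in the pairing -/

section Selmer

variable {n d e : ℕ}

theorem Lam_mem_Sel2 (hd : LocallyGood n d) (hn : n = d * e)
    (he : ∀ (p : ℕ) [Fact p.Prime], p ∣ d → IsSquare (e : ℚ_[p])) : Lam d ∈ Sel2 n := by
  refine ⟨by simp [Lam, sqClass_mul_self], lamUnits d hd.oneModEight.1, mk_lamUnits _, fun v => ?_⟩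
  obtain ⟨⟨t, u₁, u₂, u₃, h0, h1, h2⟩, -⟩ := exists_local_points hd hn he v
  exact ⟨_, isCurvePoint_lamUnits _ h0 h1 h2⟩

theorem Lam'_mem_Sel2 (hd : LocallyGood n d) (hn : n = d * e)
    (he : ∀ (p : ℕ) [Fact p.Prime], p ∣ d → IsSquare (e : ℚ_[p])) : Lam' d ∈ Sel2 n := by
  refine ⟨by simp [Lam', sqClass_mul_self], lamUnits' d hd.oneModEight.1, mk_lamUnits' _,
    fun v => ?_⟩
  obtain ⟨-, ⟨t, u₁, u₂, u₃, h0, h1, h2⟩⟩ := exists_local_points hd hn he v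
  exact ⟨_, isCurvePoint_lamUnits' _ h0 h1 h2⟩

theorem nonempty_casselsDatum_Lam (hd : LocallyGood n d) (hn : n = d * e) (he0 : e ≠ 0)
    (he : ∀ (p : ℕ) [Fact p.Prime], p ∣ d → IsSquare (e : ℚ_[p])) {a b c α β γ : ℤ}
    (hb : b ≠ 0) (hc : c ≠ 0) (hβ : β ≠ 0) (hγ : γ ≠ 0)
    (hQ : c ^ 2 = (d : ℤ) * a ^ 2 + (e : ℤ) * b ^ 2)
    (hQ' : γ ^ 2 = (d : ℤ) * α ^ 2 + (2 * (e : ℤ)) * β ^ 2)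
    {D' : Fin 3 → ℚˣ} {Λ' : Fin 3 → SqClass} (hD' : ∀ i, (D' i : SqClass) = Λ' i) :
    Nonempty (CasselsDatum n (Lam d) Λ') := by
  have hd0 := hd.oneModEight.1
  have hd0' : (d : ℚ) ≠ 0 := by exact_mod_cast hd0
  have hrep : IsRep d (lamUnits d hd0) ![1, 1, 1] := by
    refine ⟨fun i => ?_, ?_, ?_, ?_⟩
    · fin_cases i <;> simp
    all_goals simp [lamUnits]
  have hQq : (c : ℚ) ^ 2 = d * a ^ 2 + e * b ^ 2 := by exact_mod_cast hQ
  have hQq' : (γ : ℚ) ^ 2 = d * α ^ 2 + 2 * e * β ^ 2 := by exact_mod_cast hQ'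
  -- The last two points are the given solutions with the substitution w = u₁/d undone, whence the
  -- coordinates d·a and d·α; the first conic has the evident point (0, 1, 1).
  let Q : Fin 3 → Fin 3 → ℚ := ![![0, 1, 1], ![b, c, d * a], ![β, d * α, γ]]
  have hpt : ∀ v : Place, ∃ x : Fin 4 → v.Completion, IsCurvePoint n (lamUnits d hd0) x ∧
      ∀ i, tangentForm n (lamUnits d hd0) i (Q i) x ≠ 0 := by
    intro v
    obtain ⟨⟨t, u₁, u₂, u₃, h0, h1, h2⟩, -⟩ := exists_local_points hd hn he v
    have hd1 : (d : v.Completion) ≠ 0 := by exact_mod_cast hd0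
    have he1 : (e : v.Completion) ≠ 0 := by exact_mod_cast he0
    subst hn
    push_cast at h1 h2
    obtain ⟨r, u, hr, hu, k1, k2, k3⟩ := exists_signs (F := v.Completion) (A := (d : ℤ))
      (B := (e : ℤ)) (B' := ((2 * (e : ℤ) : ℤ) : v.Completion)) (a := a) (b := b) (c := c)
      (α := α) (β := β) (γ := γ)
      (t := t) (w := u₁ / d) (r := u₃) (u := u₂) (by exact_mod_cast hd0) (by exact_mod_cast he0)
      (by exact_mod_cast mul_ne_zero two_ne_zero he0)
      (fun h => he1 (by push_cast at h; linear_combination -h)) (by exact_mod_cast hb)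
      (by exact_mod_cast hc) (by exact_mod_cast hβ) (by exact_mod_cast hγ) (by exact_mod_cast hQ)
      (by exact_mod_cast hQ') (fun h => h0 (by
        simp only [Prod.mk.injEq, div_eq_zero_iff, hd1, or_false] at h ⊢; tauto))
      (by push_cast; field_simp; linear_combination h2)
      (by push_cast; field_simp; linear_combination h1 + h2)
    have hr2 : r ^ 2 = u₃ ^ 2 := sq_eq_sq_iff_eq_or_eq_neg.2 hr
    have hu2 : u ^ 2 = u₂ ^ 2 := sq_eq_sq_iff_eq_or_eq_neg.2 hu
    refine ⟨![t, u₁, u, r], isCurvePoint_lamUnits _ (fun h => h0 ?_) ?_ ?_, ?_⟩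
    · simp only [Prod.mk.injEq] at h ⊢
      obtain ⟨h1, h3, h4, h5⟩ := h
      subst h4 h5
      exact ⟨h1, h3, pow_eq_zero_iff two_ne_zero |>.1 (by rw [← hu2]; ring),
        pow_eq_zero_iff two_ne_zero |>.1 (by rw [← hr2]; ring)⟩
    · rw [hr2, hu2]; push_cast; exact h1
    · rw [hr2]; push_cast; exact h2
    · have hdq : ((d : ℚ) : v.Completion) ≠ 0 := by exact_mod_cast hd0
      have hdq' : ((-d : ℚ) : v.Completion) ≠ 0 := by exact_mod_cast neg_ne_zero.2 hd0'
      simp only [Fin.forall_fin_succ]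
      refine ⟨?_, ?_, ?_, fun i => i.elim0⟩
      · refine fun h => mul_ne_zero hdq k3 (Eq.trans ?_ ((hrep.tangent_zero rfl _ _).symm.trans h))
        simp [polar, Q]
      · refine fun h => mul_ne_zero hdq k1 (Eq.trans ?_
          ((hrep.tangent_one rfl hd0 _ _).symm.trans h))
        simp [polar, Q, hd1]
      · refine fun h => mul_ne_zero hdq' k2 (Eq.trans ?_
          ((hrep.tangent_two rfl hd0 _ _).symm.trans h))
        simp [polar, Q, hd1]
  choose P hP hL using hpt
  refine ⟨⟨lamUnits d hd0, D', mk_lamUnits _, hD', Q, fun i => ?_, P, hP, hL⟩⟩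
  subst hn
  fin_cases i
  · refine isConicPoint_iff_zero.2 ⟨fun h => ?_, ?_⟩
    · simpa [Q] using congrFun h 1
    · simp [Q, lamUnits]
  · refine isConicPoint_iff_one.2 ⟨fun h => hb ?_, ?_⟩
    · simpa [Q] using congrFun h 0
    · simp [Q, lamUnits]; linear_combination (d : ℚ) * hQq
  · refine isConicPoint_iff_two.2 ⟨fun h => hβ ?_, ?_⟩
    · simpa [Q] using congrFun h 0
    · simp [Q, lamUnits]; linear_combination -(d : ℚ) * hQq'

theorem nonempty_casselsDatum_Lam' (hd : LocallyGood n d) (hn : n = d * e) (he0 : e ≠ 0)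
    (he : ∀ (p : ℕ) [Fact p.Prime], p ∣ d → IsSquare (e : ℚ_[p])) {a b c α β γ : ℤ}
    (hb : b ≠ 0) (hc : c ≠ 0) (hβ : β ≠ 0) (hγ : γ ≠ 0)
    (hQ : c ^ 2 = (d : ℤ) * a ^ 2 + (e : ℤ) * b ^ 2)
    (hQ' : γ ^ 2 = (d : ℤ) * α ^ 2 + (-(e : ℤ)) * β ^ 2)
    {D' : Fin 3 → ℚˣ} {Λ' : Fin 3 → SqClass} (hD' : ∀ i, (D' i : SqClass) = Λ' i) :
    Nonempty (CasselsDatum n (Lam' d) Λ') := by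
  have hd0 := hd.oneModEight.1
  have hd0' : (d : ℚ) ≠ 0 := by exact_mod_cast hd0
  have hrep : IsRep' d (lamUnits' d hd0) ![1, 1, 1] := by
    refine ⟨fun i => ?_, ?_, ?_, ?_⟩
    · fin_cases i <;> simp
    all_goals simp [lamUnits']
  have hQq : (c : ℚ) ^ 2 = d * a ^ 2 + e * b ^ 2 := by exact_mod_cast hQ
  have hQq' : (γ : ℚ) ^ 2 = d * α ^ 2 + (-e) * β ^ 2 := by exact_mod_cast hQ'
  let Q : Fin 3 → Fin 3 → ℚ := ![![b, c, d * a], ![β, d * α, γ], ![0, 1, 1]]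
  have hpt : ∀ v : Place, ∃ x : Fin 4 → v.Completion, IsCurvePoint n (lamUnits' d hd0) x ∧
      ∀ i, tangentForm n (lamUnits' d hd0) i (Q i) x ≠ 0 := by
    intro v
    obtain ⟨-, ⟨t, u₁, u₂, u₃, h0, h1, h2⟩⟩ := exists_local_points hd hn he v
    have hd1 : (d : v.Completion) ≠ 0 := by exact_mod_cast hd0
    have he1 : (e : v.Completion) ≠ 0 := by exact_mod_cast he0
    subst hn
    push_cast at h1 h2
    obtain ⟨u, r, hu, hr, k1, k2, k3⟩ := exists_signs (F := v.Completion) (A := (d : ℤ))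
      (B := (e : ℤ)) (B' := ((-(e : ℤ) : ℤ) : v.Completion)) (a := a) (b := b) (c := c)
      (α := α) (β := β) (γ := γ)
      (t := t) (w := u₃ / d) (r := u₂) (u := u₁) (by exact_mod_cast hd0) (by exact_mod_cast he0)
      (by push_cast; exact neg_ne_zero.2 he1)
      (fun h => he1 (by push_cast at h; linear_combination h / 2)) (by exact_mod_cast hb)
      (by exact_mod_cast hc) (by exact_mod_cast hβ) (by exact_mod_cast hγ) (by exact_mod_cast hQ)
      (by exact_mod_cast hQ') (fun h => h0 (by
        simp only [Prod.mk.injEq, div_eq_zero_iff, hd1, or_false] at h ⊢; tauto))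
      (by push_cast; field_simp; linear_combination h1)
      (by push_cast; field_simp; linear_combination -h2)
    have hr2 : r ^ 2 = u₁ ^ 2 := sq_eq_sq_iff_eq_or_eq_neg.2 hr
    have hu2 : u ^ 2 = u₂ ^ 2 := sq_eq_sq_iff_eq_or_eq_neg.2 hu
    refine ⟨![t, r, u, u₃], isCurvePoint_lamUnits' _ (fun h => h0 ?_) ?_ ?_, ?_⟩
    · simp only [Prod.mk.injEq] at h ⊢
      obtain ⟨h1, h3, h4, h5⟩ := h
      subst h3 h4
      exact ⟨h1, pow_eq_zero_iff two_ne_zero |>.1 (by rw [← hr2]; ring),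
        pow_eq_zero_iff two_ne_zero |>.1 (by rw [← hu2]; ring), h5⟩
    · rw [hu2]; push_cast; exact h1
    · rw [hr2]; push_cast; exact h2
    · have hdq : ((d : ℚ) : v.Completion) ≠ 0 := by exact_mod_cast hd0
      have hdq' : ((-d : ℚ) : v.Completion) ≠ 0 := by exact_mod_cast neg_ne_zero.2 hd0'
      simp only [Fin.forall_fin_succ]
      refine ⟨?_, ?_, ?_, fun i => i.elim0⟩
      · refine fun h => mul_ne_zero hdq k1 (Eq.trans ?_
          ((hrep.tangent_zero rfl hd0 _ _).symm.trans h))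
        simp [polar, Q, hd1]
      · refine fun h => mul_ne_zero hdq' k2 (Eq.trans ?_
          ((hrep.tangent_one rfl hd0 _ _).symm.trans h))
        simp [polar, Q, hd1]
      · refine fun h => mul_ne_zero hdq k3 (Eq.trans ?_ ((hrep.tangent_two rfl _ _).symm.trans h))
        simp [polar, Q]
        ring
  choose P hP hL using hpt
  refine ⟨⟨lamUnits' d hd0, D', mk_lamUnits' _, hD', Q, fun i => ?_, P, hP, hL⟩⟩
  subst hn
  fin_cases i
  · refine isConicPoint_iff_zero.2 ⟨fun h => hb ?_, ?_⟩
    · simpa [Q] using congrFun h 0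
    · simp [Q, lamUnits']; linear_combination (d : ℚ) * hQq
  · refine isConicPoint_iff_one.2 ⟨fun h => hβ ?_, ?_⟩
    · simpa [Q] using congrFun h 0
    · simp [Q, lamUnits']; linear_combination -(d : ℚ) * hQq'
  · refine isConicPoint_iff_two.2 ⟨fun h => ?_, ?_⟩
    · simpa [Q] using congrFun h 1
    · simp [Q, lamUnits']

end Selmer

/-! ### Residue symbols of the coordinates of points on conics -/

theorem jacobiSym_congr_primes {m : ℕ} (hm : Squarefree m) {a b : ℤ}
    (h : ∀ (p : ℕ) [Fact p.Prime], p ∣ m → jacobiSym a p = jacobiSym b p) :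
    jacobiSym a m = jacobiSym b m := by
  rw [jacobiSym_eq_prod_primeFactors hm, jacobiSym_eq_prod_primeFactors hm]
  refine Finset.prod_congr rfl fun p hp => ?_
  have : Fact p.Prime := ⟨Nat.prime_of_mem_primeFactors hp⟩
  exact h p (Nat.dvd_of_mem_primeFactors hp)

/-- A Jacobi symbol is `1` if the Hilbert symbols at the remaining odd primes are. -/
theorem jacobiSym_eq_one_of_hilbertSymbol {m : ℕ} (hm : OneModEight m) (hsq : Squarefree m) {e : ℤ}
    (he : e ≠ 0) (hcop : ∀ p : ℕ, p.Prime → p ∣ m → ¬ (p : ℤ) ∣ e)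
    (h : ∀ (p : ℕ) [Fact p.Prime], p ≠ 2 → ¬ p ∣ m → hilbertSymbol (e : ℚ_[p]) (m : ℚ_[p]) = 1) :
    jacobiSym e m = 1 := by
  rw [jacobiSym_eq_prod_primeFactors hsq]
  have h1 := hasPlaceProd_oddHilbert hm.1 hm.2 (a := (e : ℚ)) (by exact_mod_cast he)
  refine (hasPlaceProd_of_primes m.primeFactors (fun p => jacobiSym e p)
    (fun p hp => Nat.prime_of_mem_primeFactors hp) (oddHilbert_infinite _ _) (fun p hp hpm => ?_)
    (fun p hp hpm => ?_)).unique h1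
  · have hpm : ¬ p ∣ m := fun h => hpm (Nat.mem_primeFactors.2 ⟨hp, h, hm.1⟩)
    by_cases h2 : p = 2
    · subst h2; exact oddHilbert_two _ _ _
    · have : Fact p.Prime := ⟨hp⟩
      rw [oddHilbert_finite hp h2]
      have := h p h2 hpm
      simpa using this
  · have hpm := Nat.dvd_of_mem_primeFactors hpm
    have : Fact p.Prime := ⟨hp⟩
    rw [oddHilbert_finite hp (hm.ne_two hp hpm)]
    simpa using hilbertSymbol_intCast_of_dvd hm hsq hpm (hcop p hp hpm)

theorem dvd_of_sq_eq {p : ℕ} (hp : p.Prime) {c k : ℤ} (h : c ^ 2 = p * k) : (p : ℤ) ∣ c :=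
  (Nat.prime_iff_prime_int.1 hp).dvd_of_dvd_pow (h ▸ dvd_mul_right _ _)

theorem dvd_of_dvd_mul_sq {p m : ℕ} (hp : p.Prime) (hm : Squarefree m) (hpm : p ∣ m) {a k : ℤ}
    (h : (m : ℤ) * a ^ 2 = p ^ 2 * k) : (p : ℤ) ∣ a := by
  obtain ⟨r, rfl⟩ := hpm
  have hp' := Nat.prime_iff_prime_int.1 hp
  have hr : ¬ p ∣ r := fun hr => hp.not_isUnit (hm p (mul_dvd_mul_left p hr))
  have e : (r : ℤ) * a ^ 2 = p * k := by
    apply mul_left_cancel₀ hp'.ne_zero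
    push_cast at h; linear_combination h
  rcases hp'.dvd_or_dvd (Dvd.intro _ e.symm) with h | h
  · exact absurd (by exact_mod_cast h) hr
  · exact hp'.dvd_of_dvd_pow h

theorem not_dvd_of_primitive {a b c : ℤ} (hg : Int.gcd (Int.gcd a b) c = 1) {p : ℕ} (hp : p.Prime) :
    ¬ ((p : ℤ) ∣ a ∧ (p : ℤ) ∣ b ∧ (p : ℤ) ∣ c) := by
  rintro ⟨ha, hb, hc⟩
  have := Int.dvd_coe_gcd (Int.dvd_coe_gcd ha hb) hc
  rw [hg] at this
  exact hp.one_lt.ne' (by exact_mod_cast Int.eq_one_of_dvd_one (by positivity) this)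

theorem not_dvd_right_coord {p m : ℕ} (hp : p.Prime) (hm : Squarefree m) (hpm : p ∣ m)
    {a b c K : ℤ} (hg : Int.gcd (Int.gcd a b) c = 1) (hc : c ^ 2 = (m : ℤ) * a ^ 2 + K * b ^ 2) :
    ¬ (p : ℤ) ∣ b := by
  rintro ⟨b, rfl⟩
  have hpm' := hpm
  obtain ⟨r, hr⟩ := hpm'
  have hr' : (m : ℤ) = p * r := by exact_mod_cast hr
  obtain ⟨c, rfl⟩ : (p : ℤ) ∣ c :=
    dvd_of_sq_eq hp (k := r * a ^ 2 + K * p * b ^ 2) (by rw [hc, hr']; ring)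
  have := dvd_of_dvd_mul_sq hp hm hpm (a := a) (k := c ^ 2 - K * b ^ 2) (by linear_combination -hc)
  exact not_dvd_of_primitive hg hp ⟨this, dvd_mul_right _ _, dvd_mul_right _ _⟩

theorem not_dvd_left_coord {p m : ℕ} (hp : p.Prime) (hm : Squarefree m) (hpm : p ∣ m)
    {a b c K : ℤ} (hg : Int.gcd (Int.gcd a b) c = 1) (hc : c ^ 2 = K * a ^ 2 + (m : ℤ) * b ^ 2) :
    ¬ (p : ℤ) ∣ a :=
  not_dvd_right_coord hp hm hpm (by rwa [Int.gcd_comm b a]) (hc.trans (add_comm _ _))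

section Norms

variable {p : ℕ} [hp : Fact p.Prime]

theorem norm_intCast_lt_one {k : ℤ} (h : (p : ℤ) ∣ k) : ‖(k : ℚ_[p])‖ < 1 :=
  Padic.norm_intCast_lt_one_iff.2 h

theorem dvd_of_norm_lt_one {k : ℤ} (h : ‖(k : ℚ_[p])‖ < 1) : (p : ℤ) ∣ k :=
  Padic.norm_intCast_lt_one_iff.1 h

/-- If `p` divides `b` in a primitive solution of `c² = A a² + K b²`, then `A` is a square. -/
theorem isSquare_of_dvd_coord (h2 : p ≠ 2) {A a b c K : ℤ} (hA : ¬ (p : ℤ) ∣ A)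
    (hg : Int.gcd (Int.gcd a b) c = 1) (hc : c ^ 2 = A * a ^ 2 + K * b ^ 2) (hb : (p : ℤ) ∣ b) :
    IsSquare (A : ℚ_[p]) := by
  by_contra hns
  have h := norm_sq_sub_mul_sq h2 (norm_intCast_eq_one hA) hns c a
  have e : (c : ℚ_[p]) ^ 2 - A * a ^ 2 = ((K * b ^ 2 : ℤ) : ℚ_[p]) := by
    have : (c : ℚ_[p]) ^ 2 = A * a ^ 2 + K * b ^ 2 := by exact_mod_cast hc
    rw [this]; push_cast; ring
  rw [e] at h
  have h1 : ‖((K * b ^ 2 : ℤ) : ℚ_[p])‖ < 1 :=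
    norm_intCast_lt_one ((dvd_pow hb two_ne_zero).mul_left _)
  rw [h, pow_lt_one_iff_of_nonneg (le_max_of_le_left (norm_nonneg _)) two_ne_zero,
    max_lt_iff] at h1
  exact not_dvd_of_primitive hg hp.out
    ⟨dvd_of_norm_lt_one h1.2, hb, dvd_of_norm_lt_one h1.1⟩

end Norms

/-- The coordinate `b` of a primitive solution of `c² = m a² + K b²` is a residue modulo `m`. -/
theorem jacobiSym_right_coord {m : ℕ} (hm : OneModEight m) (hsq : Squarefree m) {a b c K : ℤ}
    (hg : Int.gcd (Int.gcd a b) c = 1)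
    (hc : c ^ 2 = (m : ℤ) * a ^ 2 + K * b ^ 2) : jacobiSym b m = 1 := by
  by_cases hb : b = 0
  · have : m = 1 := Nat.eq_one_iff_not_exists_prime_dvd.2 fun p hp hpm =>
      not_dvd_right_coord hp hsq hpm hg hc (hb ▸ dvd_zero _)
    rw [this, jacobiSym.one_right]
  refine jacobiSym_eq_one_of_hilbertSymbol hm hsq hb
    (fun p hp hpm => not_dvd_right_coord hp hsq hpm hg hc) fun p hp h2 hpm => ?_
  have hpm' : ¬ (p : ℤ) ∣ m := by exact_mod_cast hpm
  -- Outside 2m either b is a unit, or p ∣ b and m is then a square in ℚ_p.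
  by_cases hpb : (p : ℤ) ∣ b
  · exact hilbertSymbol_of_isSquare_right _
      (by exact_mod_cast isSquare_of_dvd_coord h2 hpm' hg hc hpb)
  · exact hilbertSymbol_units h2 (norm_intCast_eq_one hpb) (norm_natCast_eq_one hpm)

theorem jacobiSym_left_coord {m : ℕ} (hm : OneModEight m) (hsq : Squarefree m) {a b c K : ℤ}
    (hg : Int.gcd (Int.gcd a b) c = 1)
    (hc : c ^ 2 = K * a ^ 2 + (m : ℤ) * b ^ 2) : jacobiSym a m = 1 :=
  jacobiSym_right_coord hm hsq (by rwa [Int.gcd_comm b a]) (hc.trans (add_comm _ _))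

theorem jacobiSym_congr_of_dvd_sub {p : ℕ} {a b : ℤ} (h : (p : ℤ) ∣ a - b) :
    jacobiSym a p = jacobiSym b p := by
  rw [jacobiSym.mod_left, jacobiSym.mod_left b,
    Int.emod_eq_emod_iff_emod_sub_eq_zero.2 (Int.emod_eq_zero_of_dvd h)]

section Residues

variable {p : ℕ} [hp : Fact p.Prime]

theorem jacobiSym_prime_mul_self {a : ℤ} (ha : ¬ (p : ℤ) ∣ a) : jacobiSym a p * jacobiSym a p = 1 := by
  rw [← sq]
  refine jacobiSym.sq_one ?_
  rw [Int.isCoprime_iff_gcd_eq_one.symm, isCoprime_comm]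
  exact ((Nat.prime_iff_prime_int.1 hp.out).coprime_iff_not_dvd).2 ha

theorem jacobiSym_neg_one_prime (h8 : p % 8 = 1) : jacobiSym (-1) p = 1 :=
  OneModEight.jacobiSym_neg_one ⟨hp.out.ne_zero, fun q hq hqp => by
    rwa [(Nat.prime_dvd_prime_iff_eq hq hp.out).1 hqp]⟩

theorem jacobiSym_two_prime (h8 : p % 8 = 1) : jacobiSym 2 p = 1 :=
  OneModEight.jacobiSym_two ⟨hp.out.ne_zero, fun q hq hqp => by
    rwa [(Nat.prime_dvd_prime_iff_eq hq hp.out).1 hqp]⟩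

theorem jacobiSym_eq_of_dvd_sq_sub (h8 : p % 8 = 1) {u v : ℤ} (h : (p : ℤ) ∣ u ^ 2 - v ^ 2) :
    jacobiSym u p = jacobiSym v p := by
  rw [show u ^ 2 - v ^ 2 = (u - v) * (u - -v) by ring] at h
  rcases (Nat.prime_iff_prime_int.1 hp.out).dvd_or_dvd h with h | h
  · exact jacobiSym_congr_of_dvd_sub h
  · rw [jacobiSym_congr_of_dvd_sub h, ← neg_one_mul, jacobiSym.mul_left,
      jacobiSym_neg_one_prime h8, one_mul]

/-- With i² ≡ −1 one has u ≡ ±iv. Both −1 and i are residues, the latter because (1 + i)² ≡ 2i and 2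
is a residue. -/
theorem jacobiSym_eq_of_dvd_sq_add (h8 : p % 8 = 1) {u v : ℤ} (h : (p : ℤ) ∣ u ^ 2 + v ^ 2) :
    jacobiSym u p = jacobiSym v p := by
  have hp' := Nat.prime_iff_prime_int.1 hp.out
  obtain ⟨y, hy⟩ := (ZMod.exists_sq_eq_neg_one_iff (p := p)).2 (by omega)
  obtain ⟨i, rfl⟩ := ZMod.intCast_surjective y
  have hi : (p : ℤ) ∣ i ^ 2 + 1 := by
    rw [← ZMod.intCast_zmod_eq_zero_iff_dvd]; push_cast; rw [sq, ← hy]; ring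
  have hi1 : ¬ (p : ℤ) ∣ 1 + i := by
    intro h1
    have h2 : (p : ℤ) ∣ 2 := by
      have := dvd_add hi (h1.mul_left (1 - i))
      rwa [show i ^ 2 + 1 + (1 - i) * (1 + i) = 2 by ring] at this
    have := (Nat.prime_dvd_prime_iff_eq hp.out Nat.prime_two).1 (by exact_mod_cast h2)
    subst this; norm_num at h8
  have hJ : jacobiSym i p = 1 := by
    have h1 : jacobiSym ((1 + i) * (1 + i)) p = jacobiSym (2 * i) p :=
      jacobiSym_congr_of_dvd_sub (by
        rwa [show (1 + i) * (1 + i) - 2 * i = i ^ 2 + 1 by ring])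
    rw [jacobiSym.mul_left, jacobiSym_prime_mul_self hi1, jacobiSym.mul_left,
      jacobiSym_two_prime h8, one_mul] at h1
    exact h1.symm
  have := jacobiSym_eq_of_dvd_sq_sub h8 (u := u) (v := i * v) (by
    rw [show u ^ 2 - (i * v) ^ 2 = u ^ 2 + v ^ 2 - (i ^ 2 + 1) * v ^ 2 by ring]
    exact dvd_sub h (hi.mul_right _))
  rw [this, jacobiSym.mul_left, hJ, one_mul]

end Residues

/-- Modulo p ∣ A the equations become c² ≡ K b² and c'² ≡ −K b'², so (cb')² ≡ −(c'b)²; the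
coordinates b, b' have symbol 1 modulo A. -/
theorem jacobiSym_eq_jacobiSym_conj {A : ℕ} (hA : OneModEight A) (hsq : Squarefree A)
    {K a b c a' b' c' : ℤ} (hg : Int.gcd (Int.gcd a b) c = 1)
    (hc : c ^ 2 = A * a ^ 2 + K * b ^ 2) (hg' : Int.gcd (Int.gcd a' b') c' = 1)
    (hc' : c' ^ 2 = A * a' ^ 2 + -K * b' ^ 2) : jacobiSym c A = jacobiSym c' A := by
  have h : jacobiSym (c * b') A = jacobiSym (c' * b) A :=
    jacobiSym_congr_primes hsq fun p hp hpA => jacobiSym_eq_of_dvd_sq_add (hA.2 p hp.out hpA) (by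
      rw [mul_pow, mul_pow, hc, hc', show (A * a ^ 2 + K * b ^ 2) * b' ^ 2 +
        (A * a' ^ 2 + -K * b' ^ 2) * b ^ 2 = A * (a ^ 2 * b' ^ 2 + a' ^ 2 * b ^ 2) by ring]
      exact (Int.natCast_dvd_natCast.2 hpA).mul_right _)
  rwa [jacobiSym.mul_left, jacobiSym.mul_left, jacobiSym_right_coord hA hsq hg hc,
    jacobiSym_right_coord hA hsq hg' hc', mul_one, mul_one] at h

/-- Modulo p ∣ B both conics degenerate to c² ≡ A a² and x² ≡ A y², hence (cy)² ≡ (xa)²; and y has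
symbol 1 modulo B. -/
theorem jacobiSym_eq_mul_of_conics {B : ℕ} (hB : OneModEight B) (hsq : Squarefree B)
    {A K a b c x y z : ℤ} (hK : (B : ℤ) ∣ K) (hc : c ^ 2 = A * a ^ 2 + K * b ^ 2)
    (hg : Int.gcd (Int.gcd y z) x = 1) (hx : x ^ 2 = A * y ^ 2 + B * z ^ 2) :
    jacobiSym c B = jacobiSym x B * jacobiSym a B := by
  have h : jacobiSym (c * y) B = jacobiSym (x * a) B :=
    jacobiSym_congr_primes hsq fun p hp hpB => jacobiSym_eq_of_dvd_sq_sub (hB.2 p hp.out hpB) (by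
      rw [mul_pow, mul_pow, hc, hx, show (A * a ^ 2 + K * b ^ 2) * y ^ 2 -
        (A * y ^ 2 + B * z ^ 2) * a ^ 2 = K * (b ^ 2 * y ^ 2) - B * (z ^ 2 * a ^ 2) by ring]
      have hpB' : (p : ℤ) ∣ B := Int.natCast_dvd_natCast.2 hpB
      exact dvd_sub ((hpB'.trans hK).mul_right _) (hpB'.mul_right _))
  rwa [jacobiSym.mul_left, jacobiSym.mul_left, jacobiSym_left_coord hB hsq hg hx, mul_one] at h

theorem LocallyGoodFactors.swap {n A B f : ℕ} (h : LocallyGoodFactors n A B f) :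
    LocallyGoodFactors n B A f :=
  ⟨by rw [h.eq]; ring, h.squarefree, h.mid, h.left, h.right⟩

theorem jacobiSym_natCast_of_isSquare {A B : ℕ} (hB : OneModEight B) (hsq : Squarefree B)
    (h : ∀ (p : ℕ) [Fact p.Prime], p ∣ B → ¬ p ∣ A ∧ IsSquare (A : ℚ_[p])) :
    jacobiSym A B = 1 := by
  rw [← jacobiSym.one_left B]
  refine jacobiSym_congr_primes hsq fun p hp hpB => ?_
  obtain ⟨h1, h2⟩ := h p hpB
  rw [jacobiSym.one_left, ← jacobiSym.legendreSym.to_jacobiSym]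
  exact (isSquare_intCast_iff (hB.ne_two hp.out hpB) (by exact_mod_cast h1)).1 (by exact_mod_cast h2)

theorem OneModEight.mul {a b : ℕ} (ha : OneModEight a) (hb : OneModEight b) : OneModEight (a * b) :=
  ⟨mul_ne_zero ha.1 hb.1, fun p hp h => (hp.dvd_mul.1 h).elim (ha.2 p hp) (hb.2 p hp)⟩

namespace LocallyGoodFactors

variable {n A B f : ℕ}

theorem jacobiSym_left_mid (h : LocallyGoodFactors n A B f) : jacobiSym A B = 1 :=
  jacobiSym_natCast_of_isSquare h.mid.oneModEight h.mid.squarefree fun _ hp hpB =>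
    ⟨(h.not_dvd_of_dvd hp.out hpB).1, h.isSquare_left hpB⟩

theorem squarefree_left_mul_mid (h : LocallyGoodFactors n A B f) : Squarefree (A * B) :=
  h.squarefree.squarefree_of_dvd ⟨f, by rw [h.eq]; ring⟩

theorem squarefree_mid_mul_right (h : LocallyGoodFactors n A B f) : Squarefree (B * f) :=
  h.squarefree.squarefree_of_dvd ⟨A, by rw [h.eq]; ring⟩

theorem not_dvd (h : LocallyGoodFactors n A B f) {p : ℕ} (hp : ¬ p ∣ 2 * n) :
    p ≠ 2 ∧ ¬ p ∣ A ∧ ¬ p ∣ B ∧ ¬ p ∣ f := by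
  obtain ⟨h2, hn⟩ := not_dvd_two_mul hp
  exact ⟨h2, fun h' => hn (h'.trans h.left.dvd), fun h' => hn (h'.trans h.mid.dvd),
    fun h' => hn (h'.trans h.right.dvd)⟩

/-- Put e = A a₁b₂ + B a₂b₁ and let e' be the difference of the two terms. Then A e e' = (A c₁b₂)² −
AB (c₂b₁)² is a norm from ℚ(√AB), which makes e a local norm at all odd p ∤ AB; so (e/AB) = 1.
Modulo A only B a₂b₁ survives, modulo B only A a₁b₂, and their other factors have symbol 1. -/
theorem jacobiSym_eq_of_two_conics (h : LocallyGoodFactors n A B f) {a₁ b₁ c₁ a₂ b₂ c₂ : ℤ}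
    (ha₁ : 0 < a₁) (hb₁ : 0 < b₁) (hg₁ : Int.gcd (Int.gcd a₁ b₁) c₁ = 1)
    (hc₁ : c₁ ^ 2 = A * a₁ ^ 2 + (B * f : ℕ) * b₁ ^ 2)
    (ha₂ : 0 < a₂) (hb₂ : 0 < b₂) (hg₂ : Int.gcd (Int.gcd a₂ b₂) c₂ = 1)
    (hc₂ : c₂ ^ 2 = B * a₂ ^ 2 + (A * f : ℕ) * b₂ ^ 2) : jacobiSym a₁ B = jacobiSym a₂ A := by
  have hA := h.left.oneModEight
  have hB := h.mid.oneModEight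
  have hA0 : (0 : ℤ) < A := by exact_mod_cast Nat.pos_of_ne_zero hA.1
  have hB0 : (0 : ℤ) < B := by exact_mod_cast Nat.pos_of_ne_zero hB.1
  have ca : ∀ (p : ℕ), p.Prime → p ∣ A → ¬ (p : ℤ) ∣ B ∧ ¬ (p : ℤ) ∣ a₂ ∧ ¬ (p : ℤ) ∣ b₁ :=
    fun p hp hpA => ⟨by exact_mod_cast (h.swap.not_dvd_of_dvd hp hpA).1,
      not_dvd_left_coord hp h.swap.squarefree_mid_mul_right (hpA.mul_right f) hg₂ hc₂,
      not_dvd_right_coord hp h.left.squarefree hpA hg₁ hc₁⟩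
  have cb : ∀ (p : ℕ), p.Prime → p ∣ B → ¬ (p : ℤ) ∣ A ∧ ¬ (p : ℤ) ∣ a₁ ∧ ¬ (p : ℤ) ∣ b₂ :=
    fun p hp hpB => ⟨by exact_mod_cast (h.not_dvd_of_dvd hp hpB).1,
      not_dvd_left_coord hp h.squarefree_mid_mul_right (hpB.mul_right f) hg₁ hc₁,
      not_dvd_right_coord hp h.mid.squarefree hpB hg₂ hc₂⟩
  set e := A * a₁ * b₂ + B * a₂ * b₁ with he
  have hepos : 0 < e := by positivity
  have key : jacobiSym e (A * B : ℕ) = 1 := by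
    refine jacobiSym_eq_one_of_hilbertSymbol (hA.mul hB) h.squarefree_left_mul_mid hepos.ne'
      (fun p hp hpm hpe => ?_) fun p hp h2 hpm => ?_
    · have hp' := Nat.prime_iff_prime_int.1 hp
      rcases hp.dvd_mul.1 hpm with hpA | hpB
      · obtain ⟨h1, h2, h3⟩ := ca p hp hpA
        have hpA' : (p : ℤ) ∣ A := Int.natCast_dvd_natCast.2 hpA
        have := (dvd_add_right ((hpA'.mul_right a₁).mul_right b₂)).1 hpe
        rcases hp'.dvd_or_dvd this with h' | h'
        · exact (hp'.dvd_or_dvd h').elim h1 h2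
        · exact h3 h'
      · obtain ⟨h1, h2, h3⟩ := cb p hp hpB
        have hpB' : (p : ℤ) ∣ B := Int.natCast_dvd_natCast.2 hpB
        have := (dvd_add_left ((hpB'.mul_right a₂).mul_right b₁)).1 hpe
        rcases hp'.dvd_or_dvd this with h' | h'
        · exact (hp'.dvd_or_dvd h').elim h1 h2
        · exact h3 h'
    · by_cases hsq : IsSquare ((A * B : ℕ) : ℚ_[p])
      · exact hilbertSymbol_of_isSquare_right _ hsq
      have hp' := Nat.prime_iff_prime_int.1 hp.out
      have hpA0 : ¬ p ∣ A := fun h => hpm (h.mul_right _)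
      have hpB0 : ¬ p ∣ B := fun h => hpm (h.mul_left _)
      have hpn : ¬ p ∣ 2 * n := fun hn => hsq (by
        push_cast; exact (h.left.isSquare p hn hpA0).mul (h.mid.isSquare p hn hpB0))
      have hpf := (h.not_dvd hpn).2.2.2
      have hpA : ¬ (p : ℤ) ∣ A := by exact_mod_cast hpA0
      have hpB : ¬ (p : ℤ) ∣ B := by exact_mod_cast hpB0
      have hm1 := norm_natCast_eq_one hpm
      have hp2 : ¬ (p : ℤ) ∣ 2 := fun h => h2
        ((Nat.prime_dvd_prime_iff_eq hp.out Nat.prime_two).1 (by exact_mod_cast h))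
      by_cases hpe : (p : ℤ) ∣ e
      swap
      · exact hilbertSymbol_units h2 (norm_intCast_eq_one hpe) hm1
      set e' := A * a₁ * b₂ - B * a₂ * b₁ with he'
      have hprod : (A : ℤ) * (e * e') = (A * (c₁ * b₂)) ^ 2 - (A * B : ℕ) * (c₂ * b₁) ^ 2 := by
        rw [he, he']; push_cast at hc₁ hc₂ ⊢
        linear_combination (-(A : ℤ) ^ 2 * b₂ ^ 2) * hc₁ + (A * B * b₁ ^ 2) * hc₂
      have hnorm : ‖((e * e' : ℤ) : ℚ_[p])‖ =
          max ‖((A * (c₁ * b₂) : ℤ) : ℚ_[p])‖ ‖((c₂ * b₁ : ℤ) : ℚ_[p])‖ ^ 2 := by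
        rw [← norm_sq_sub_mul_sq h2 hm1 hsq, ← one_mul ‖((e * e' : ℤ) : ℚ_[p])‖,
          ← norm_intCast_eq_one hpA, ← norm_mul]
        congr 1
        exact_mod_cast hprod
      -- A prime dividing both e and e' divides a₁b₂, a₂b₁ and c₂b₁. Either p ∣ b₁, which forces p ∣
      -- b₂ and makes A and B squares, or p divides all of a₂, b₂, c₂.
      have he'1 : ¬ (p : ℤ) ∣ e' := by
        intro hpe'
        have hA1 : (p : ℤ) ∣ a₁ * b₂ := by
          have := dvd_add hpe hpe'
          rw [show e + e' = 2 * (A * (a₁ * b₂)) by rw [he, he']; ring] at this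
          exact (hp'.dvd_or_dvd ((hp'.dvd_or_dvd this).resolve_left hp2)).resolve_left hpA
        have hB1 : (p : ℤ) ∣ a₂ * b₁ := by
          have := dvd_sub hpe hpe'
          rw [show e - e' = 2 * (B * (a₂ * b₁)) by rw [he, he']; ring] at this
          exact (hp'.dvd_or_dvd ((hp'.dvd_or_dvd this).resolve_left hp2)).resolve_left hpB
        have hlt := norm_intCast_lt_one (p := p) (hpe.mul_right e')
        rw [hnorm, pow_lt_one_iff_of_nonneg (le_max_of_le_left (norm_nonneg _)) two_ne_zero,
          max_lt_iff] at hlt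
        have hcb := dvd_of_norm_lt_one hlt.2
        by_cases hb : (p : ℤ) ∣ b₁
        · have hAsq := isSquare_of_dvd_coord h2 hpA hg₁ hc₁ hb
          have ha : ¬ (p : ℤ) ∣ a₁ := fun ha => not_dvd_of_primitive hg₁ hp.out ⟨ha, hb,
            hp'.dvd_of_dvd_pow (n := 2) (by
              rw [hc₁]
              exact dvd_add ((dvd_pow ha two_ne_zero).mul_left _)
                ((dvd_pow hb two_ne_zero).mul_left _))⟩
          have hBsq := isSquare_of_dvd_coord h2 hpB hg₂ hc₂ ((hp'.dvd_or_dvd hA1).resolve_left ha)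
          exact hsq (by push_cast at hAsq hBsq ⊢; exact hAsq.mul hBsq)
        · have ha := (hp'.dvd_or_dvd hB1).resolve_right hb
          have hc := (hp'.dvd_or_dvd hcb).resolve_right hb
          have hAf : ¬ (p : ℤ) ∣ (A * f : ℕ) := fun h => by
            rcases hp.out.dvd_mul.1 (Int.natCast_dvd_natCast.1 h) with h | h
            · exact hpA0 h
            · exact hpf h
          refine not_dvd_of_primitive hg₂ hp.out ⟨ha, ?_, hc⟩
          have : (p : ℤ) ∣ (A * f : ℕ) * b₂ ^ 2 := by
            rw [show ((A * f : ℕ) : ℤ) * b₂ ^ 2 = c₂ ^ 2 - B * a₂ ^ 2 by rw [hc₂]; ring]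
            exact dvd_sub (dvd_pow hc two_ne_zero) ((dvd_pow ha two_ne_zero).mul_left _)
          exact hp'.dvd_of_dvd_pow ((hp'.dvd_or_dvd this).resolve_left hAf)
      have hne : ‖((e : ℤ) : ℚ_[p])‖ =
          max ‖((A * (c₁ * b₂) : ℤ) : ℚ_[p])‖ ‖((c₂ * b₁ : ℤ) : ℚ_[p])‖ ^ 2 := by
        rw [← hnorm]; push_cast; rw [norm_mul, norm_intCast_eq_one he'1, mul_one]
      have he0 : ((e : ℤ) : ℚ_[p]) ≠ 0 := by exact_mod_cast hepos.ne'
      rcases max_choice ‖((A * (c₁ * b₂) : ℤ) : ℚ_[p])‖ ‖((c₂ * b₁ : ℤ) : ℚ_[p])‖ with hm | hm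
      all_goals
        rw [hm] at hne
        refine hilbertSymbol_eq_one_of_norm_eq h2 (fun h0 => he0 ?_) hne one_ne_zero
          (by rw [hm1]; simp)
        rw [h0, norm_zero] at hne
        exact norm_eq_zero.1 (by rw [hne]; norm_num)
  rw [jacobiSym.mul_right' _ hA.1 hB.1] at key
  have e1 : jacobiSym e A = jacobiSym a₂ A := by
    have : jacobiSym e A = jacobiSym (B * a₂ * b₁) A :=
      jacobiSym_congr_primes h.left.squarefree fun p hp hpA => jacobiSym_congr_of_dvd_sub (by
        rw [he, add_sub_cancel_right, mul_assoc]
        exact (Int.natCast_dvd_natCast.2 hpA).mul_right _)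
    rw [this, jacobiSym.mul_left, jacobiSym.mul_left, h.swap.jacobiSym_left_mid,
      jacobiSym_right_coord hA h.left.squarefree hg₁ hc₁, one_mul, mul_one]
  have e2 : jacobiSym e B = jacobiSym a₁ B := by
    have : jacobiSym e B = jacobiSym (A * a₁ * b₂) B :=
      jacobiSym_congr_primes h.mid.squarefree fun p hp hpB => jacobiSym_congr_of_dvd_sub (by
        rw [he, add_sub_cancel_left, mul_assoc]
        exact (Int.natCast_dvd_natCast.2 hpB).mul_right _)
    rw [this, jacobiSym.mul_left, jacobiSym.mul_left, h.jacobiSym_left_mid,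
      jacobiSym_right_coord hB h.mid.squarefree hg₂ hc₂, one_mul, mul_one]
  rw [e1, e2] at key
  rcases Int.mul_eq_one_iff_eq_one_or_neg_one.1 key with h | h <;> rw [h.1, h.2]

end LocallyGoodFactors

/-! ### Legendre's theorem for x² = A y² + B z² -/

/-- A residue modulo all primes dividing a square-free number is a residue modulo that number. -/
theorem exists_sq_sub_dvd {m : ℕ} (hm : Squarefree m) {b : ℤ}
    (h : ∀ p : ℕ, p.Prime → p ∣ m → ∃ x : ℤ, (p : ℤ) ∣ x ^ 2 - b) : ∃ x : ℤ, (m : ℤ) ∣ x ^ 2 - b := by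
  induction m using induction_on_primes with
  | zero => exact absurd rfl hm.ne_zero
  | one => exact ⟨0, by simp⟩
  | prime_mul p m hp ih =>
    obtain ⟨x, hx⟩ := ih (hm.squarefree_of_dvd (dvd_mul_left _ _)) fun q hq hqm =>
      h q hq (hqm.mul_left p)
    obtain ⟨y, hy⟩ := h p hp (dvd_mul_right _ _)
    have hcop : IsCoprime (p : ℤ) m := by
      rw [Nat.isCoprime_iff_coprime]
      exact Nat.coprime_of_squarefree_mul hm
    obtain ⟨u, w, huw⟩ := hcop
    refine ⟨x * (u * p) + y * (w * m), ?_⟩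
    push_cast
    refine IsCoprime.mul_dvd ⟨u, w, huw⟩ ?_ ?_
    · have : (x * (u * p) + y * (w * m)) ^ 2 - b = (y ^ 2 - b) + p * (u * (x - y) *
          (x * (u * p) + y * (w * m) + y)) := by
        linear_combination (y * (x * (u * p) + y * (w * m) + y)) * huw
      rw [this]; exact dvd_add hy (dvd_mul_right _ _)
    · have : (x * (u * p) + y * (w * m)) ^ 2 - b = (x ^ 2 - b) + m * (w * (y - x) *
          (x * (u * p) + y * (w * m) + x)) := by
        linear_combination (x * (x * (u * p) + y * (w * m) + x)) * huw
      rw [this]; exact dvd_add hx (dvd_mul_right _ _)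

theorem eq_one_of_squarefree_sq {m x : ℕ} (hm : Squarefree m) (h : x ^ 2 = m) : m = 1 := by
  have := Nat.isUnit_iff.1 (hm x ⟨1, by rw [← h]; ring⟩)
  rw [← h, this, one_pow]

/-- A small non-zero solution of `x² ≡ A y² + B z²` modulo `A B`. -/
theorem exists_small_solution {A B : ℕ} (hA : A ≠ 0) (hB : B ≠ 0) (hcop : Nat.Coprime A B)
    {r s : ℤ} (hr : (A : ℤ) ∣ r ^ 2 - B) (hs : (B : ℤ) ∣ s ^ 2 - A) :
    ∃ x y z : ℤ, (x, y, z) ≠ (0, 0, 0) ∧ x ^ 2 ≤ A * B ∧ y ^ 2 ≤ B ∧ z ^ 2 ≤ A ∧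
      (A * B : ℤ) ∣ x ^ 2 - A * y ^ 2 - B * z ^ 2 := by
  have : NeZero A := ⟨hA⟩
  have : NeZero B := ⟨hB⟩
  let S := Finset.range (Nat.sqrt (A * B) + 1) ×ˢ
    (Finset.range (Nat.sqrt B + 1) ×ˢ Finset.range (Nat.sqrt A + 1))
  let g : ℕ × ℕ × ℕ → ZMod A × ZMod B := fun v =>
    (((v.1 - r * v.2.2 : ℤ) : ZMod A), ((v.1 - s * v.2.1 : ℤ) : ZMod B))
  -- Thue's pigeonhole argument: the box has more than AB points, and AB is the number of pairs of
  -- residues of x − rz modulo A and x − sy modulo B.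
  have hcard : (Finset.univ : Finset (ZMod A × ZMod B)).card < S.card := by
    rw [Finset.card_univ, Fintype.card_prod, ZMod.card, ZMod.card]
    simp only [S, Finset.card_product, Finset.card_range]
    have h1 := Nat.lt_succ_sqrt (A * B)
    have h2 := Nat.lt_succ_sqrt B
    have h3 := Nat.lt_succ_sqrt A
    rw [Nat.succ_eq_add_one] at h1 h2 h3
    generalize Nat.sqrt (A * B) + 1 = a at *
    generalize Nat.sqrt B + 1 = b at *
    generalize Nat.sqrt A + 1 = c at *
    apply lt_of_pow_lt_pow_left₀ 2 (Nat.zero_le _)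
    calc (A * B) ^ 2 = (A * B) * (B * A) := by ring
      _ < (a * a) * ((b * b) * (c * c)) := by gcongr
      _ = (a * (b * c)) ^ 2 := by ring
  obtain ⟨u, hu, v, hv, huv, hg⟩ := Finset.exists_ne_map_eq_of_card_lt_of_maps_to hcard
    (f := g) (fun _ _ => Finset.mem_univ _)
  obtain ⟨x, y, z⟩ := u
  obtain ⟨x', y', z'⟩ := v
  simp only [S, Finset.mem_product, Finset.mem_range, Nat.lt_succ_iff, Nat.le_sqrt] at hu hv
  simp only [g, Prod.mk.injEq, ZMod.intCast_eq_intCast_iff_dvd_sub] at hg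
  have bound : ∀ {m a b : ℕ}, a * a ≤ m → b * b ≤ m → ((a : ℤ) - b) ^ 2 ≤ m := by
    intro m a b ha hb
    have ha' : (a : ℤ) * a ≤ m := by exact_mod_cast ha
    have hb' : (b : ℤ) * b ≤ m := by exact_mod_cast hb
    nlinarith [mul_nonneg (Int.natCast_nonneg a) (Int.natCast_nonneg b),
      mul_le_mul_of_nonneg_left ha' (le_refl (0 : ℤ)), Int.natCast_nonneg a, Int.natCast_nonneg b,
      abs_nonneg ((a : ℤ) - b), le_total (a : ℤ) b]
  refine ⟨(x : ℤ) - x', (y : ℤ) - y', (z : ℤ) - z', fun h => huv ?_, ?_, bound hu.2.1 hv.2.1,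
    bound hu.2.2 hv.2.2, IsCoprime.mul_dvd (Nat.isCoprime_iff_coprime.2 hcop) ?_ ?_⟩
  · simp only [Prod.mk.injEq] at h ⊢; omega
  · exact_mod_cast bound hu.1 hv.1
  · obtain ⟨k, hk⟩ := hg.1
    obtain ⟨l, hl⟩ := hr
    exact ⟨k * (-((x : ℤ) - x') - r * ((z : ℤ) - z')) + l * ((z : ℤ) - z') ^ 2 -
      ((y : ℤ) - y') ^ 2, by
      linear_combination (-((x : ℤ) - x') - r * ((z : ℤ) - z')) * hk + ((z : ℤ) - z') ^ 2 * hl⟩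
  · obtain ⟨k, hk⟩ := hg.2
    obtain ⟨l, hl⟩ := hs
    exact ⟨k * (-((x : ℤ) - x') - s * ((y : ℤ) - y')) + l * ((y : ℤ) - y') ^ 2 -
      ((z : ℤ) - z') ^ 2, by
      linear_combination (-((x : ℤ) - x') - s * ((y : ℤ) - y')) * hk + ((y : ℤ) - y') ^ 2 * hl⟩

/-- Legendre's theorem for `x² = A y² + B z²`. -/
theorem exists_conic_solution {A B : ℕ} (hAB : Squarefree (A * B))
    {r s : ℤ} (hr : (A : ℤ) ∣ r ^ 2 - B) (hs : (B : ℤ) ∣ s ^ 2 - A) :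
    ∃ x y z : ℤ, (x, y, z) ≠ (0, 0, 0) ∧ x ^ 2 = A * y ^ 2 + B * z ^ 2 := by
  have hcop := Nat.coprime_of_squarefree_mul hAB
  have hA0 : A ≠ 0 := left_ne_zero_of_mul hAB.ne_zero
  have hB0 : B ≠ 0 := right_ne_zero_of_mul hAB.ne_zero
  by_cases h1 : A * B = 1
  · obtain ⟨rfl, rfl⟩ := mul_eq_one.1 h1
    exact ⟨1, 1, 0, by simp, by simp⟩
  obtain ⟨x, y, z, h0, hx, hy, hz, k, hk⟩ := exists_small_solution hA0 hB0 hcop hr hs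
  have hA : (0 : ℤ) < A := by exact_mod_cast Nat.pos_of_ne_zero hA0
  have hB : (0 : ℤ) < B := by exact_mod_cast Nat.pos_of_ne_zero hB0
  have hABp : (0 : ℤ) < A * B := mul_pos hA hB
  have hx0 := sq_nonneg x
  have hy0 := sq_nonneg y
  have hz0 := sq_nonneg z
  have hyA : (A : ℤ) * y ^ 2 ≤ A * B := by gcongr
  have hzB : (B : ℤ) * z ^ 2 ≤ A * B := by rw [mul_comm]; gcongr
  -- The size bounds leave −2 ≤ k ≤ 1. The extreme values would force x² = AB, or y² = B and z² = A,
  -- which squarefreeness allows only when AB = 1.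
  have hk1 : k < 1 := by
    by_contra hcon
    push Not at hcon
    have : (A * B : ℤ) * 1 ≤ A * B * k := by gcongr
    have e : x ^ 2 = A * B := by nlinarith [mul_nonneg hA.le hy0, mul_nonneg hB.le hz0]
    refine h1 (eq_one_of_squarefree_sq hAB (x := x.natAbs) ?_)
    zify; rw [sq_abs]; exact_mod_cast e
  have hk2 : -2 < k := by
    by_contra hcon
    push Not at hcon
    have : (A * B : ℤ) * k ≤ A * B * (-2) := by gcongr
    have e1 : (A : ℤ) * y ^ 2 = A * B := by linarith
    have e2 : (B : ℤ) * z ^ 2 = A * B := by linarith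
    have e1 : y ^ 2 = B := mul_left_cancel₀ hA.ne' e1
    have e2 : z ^ 2 = A := mul_left_cancel₀ hB.ne' (e2.trans (mul_comm _ _))
    apply h1
    have hA1 := eq_one_of_squarefree_sq (x := z.natAbs)
      (hAB.squarefree_of_dvd (dvd_mul_right A B)) (by zify; rw [sq_abs]; exact e2)
    have hB1 := eq_one_of_squarefree_sq (x := y.natAbs)
      (hAB.squarefree_of_dvd (dvd_mul_left B A)) (by zify; rw [sq_abs]; exact e1)
    rw [hA1, hB1]
  have hk3 : k = 0 ∨ k = -1 := by omega
  rcases hk3 with rfl | rfl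
  · exact ⟨x, y, z, h0, by linear_combination hk⟩
  -- For k = −1, x² + AB = A y² + B z². Multiplying by x² + AB and composing the right side gives a
  -- solution of the original equation, with nonzero first coordinate.
  · refine ⟨x ^ 2 + A * B, x * y + B * z, x * z - A * y, fun h => ?_, ?_⟩
    · simp only [Prod.mk.injEq] at h
      linarith [h.1]
    · linear_combination (x ^ 2 + A * B : ℤ) * hk

/-- A Jacobi symbol computed by the Hilbert symbols `(E, -B)` at the odd primes. -/
theorem jacobiSym_eq_neg_one_of_hilbertSymbol {B : ℕ} (hB : OneModEight B) (hsq : Squarefree B)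
    {E w : ℤ} {s E₀ : ℕ} (hE : E = 2 ^ s * E₀) (hE₀ : Odd E₀)
    (h1 : ∀ (p : ℕ) [Fact p.Prime], p ≠ 2 → ¬ p ∣ B →
      hilbertSymbol (E : ℚ_[p]) (-(B : ℚ_[p])) = 1)
    (h2 : ∀ (p : ℕ) [Fact p.Prime], p ∣ B →
      hilbertSymbol (E : ℚ_[p]) (-(B : ℚ_[p])) = jacobiSym w p) :
    jacobiSym w B = jacobiSym (-1) E₀ := by
  have hE0 : (E : ℚ) ≠ 0 := by
    have : (E₀ : ℚ) ≠ 0 := by exact_mod_cast hE₀.pos.ne'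
    rw [hE]; push_cast; positivity
  have hEq : ((2 ^ s * E₀ : ℕ) : ℚ) = E := by rw [hE]; push_cast; ring
  have e1 := hasPlaceProd_oddHilbert hB.1 hB.2 hE0
  have e2 := hasPlaceProd_oddHilbert_neg_one s hE₀
  rw [hEq] at e2
  -- Over the odd primes the symbols (E, B) multiply to 1 and the symbols (E, −1) to (−1/E₀).
  have e3 := e1.mul e2
  rw [one_mul] at e3
  rw [jacobiSym_eq_prod_primeFactors hsq]
  have hBq : (B : ℚ) ≠ 0 := by exact_mod_cast hB.1
  have e4 : ∀ v, oddHilbert v E B * oddHilbert v E (-1) = oddHilbert v E (-B) := fun v => by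
    rw [← oddHilbert_mul_right v hE0 hBq (by norm_num), mul_neg_one]
  refine (hasPlaceProd_of_primes B.primeFactors (fun p => jacobiSym w p)
    (f := fun v => oddHilbert v E B * oddHilbert v E (-1))
    (fun p hp => Nat.prime_of_mem_primeFactors hp)
    (by simp only [oddHilbert_infinite, mul_one]) (fun p hp hpm => ?_) (fun p hp hpm => ?_)).unique e3
  · have hpm : ¬ p ∣ B := fun h => hpm (Nat.mem_primeFactors.2 ⟨hp, h, hB.1⟩)
    rw [e4]
    by_cases h2 : p = 2
    · subst h2; exact oddHilbert_two _ _ _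
    · have : Fact p.Prime := ⟨hp⟩
      rw [oddHilbert_finite hp h2]
      simpa using h1 p h2 hpm
  · have hpm := Nat.dvd_of_mem_primeFactors hpm
    have : Fact p.Prime := ⟨hp⟩
    rw [e4, oddHilbert_finite hp (hB.ne_two hp hpm)]
    simpa using h2 p hpm

theorem gcd_eq_one_of_primes {a b : ℤ} (h : ∀ p : ℕ, p.Prime → (p : ℤ) ∣ a → ¬ (p : ℤ) ∣ b) :
    Int.gcd a b = 1 :=
  Nat.coprime_of_dvd fun p hp ha hb =>
    h p hp (Int.natCast_dvd.2 ha) (Int.natCast_dvd.2 hb)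

theorem not_dvd_of_gcd_eq_one {a b : ℤ} (h : Int.gcd a b = 1) {p : ℕ} (hp : p.Prime)
    (ha : (p : ℤ) ∣ a) : ¬ (p : ℤ) ∣ b := fun hb => by
  have := Int.dvd_coe_gcd ha hb
  rw [h] at this
  exact hp.one_lt.ne' (by exact_mod_cast Int.eq_one_of_dvd_one (by positivity) this)

theorem sq_mod_eight_cases (u : ℤ) : (u % 2 = 1 ∧ u ^ 2 % 8 = 1) ∨ (u % 4 = 2 ∧ u ^ 2 % 8 = 4) ∨
    (u % 4 = 0 ∧ u ^ 2 % 8 = 0) := by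
  have h : u % 8 = 0 ∨ u % 8 = 1 ∨ u % 8 = 2 ∨ u % 8 = 3 ∨ u % 8 = 4 ∨ u % 8 = 5 ∨ u % 8 = 6 ∨
    u % 8 = 7 := by omega
  have e := Int.mul_emod u u 8
  rw [← sq] at e
  rcases h with h | h | h | h | h | h | h | h <;> rw [h] at e <;> omega

theorem parity_of_sq_eq {u v w : ℤ} (h : (u ^ 2 - v ^ 2 - w ^ 2) % 8 = 0)
    (hodd : ¬ (u % 2 = 0 ∧ v % 2 = 0 ∧ w % 2 = 0)) :
    u % 2 = 1 ∧ ((v % 2 = 1 ∧ w % 4 = 0) ∨ (w % 2 = 1 ∧ v % 4 = 0)) := by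
  rcases sq_mod_eight_cases u with hu | hu | hu <;> rcases sq_mod_eight_cases v with hv | hv | hv <;>
    rcases sq_mod_eight_cases w with hw | hw | hw <;> omega

/-- Solutions of `x² + z² = A y²` and `x₁² = A y₁² + B z₁²`. -/
structure ConicPair (A B : ℕ) (x y z x₁ y₁ z₁ : ℤ) : Prop where
  left : OneModEight A
  right : OneModEight B
  squarefree : Squarefree B
  not_dvd : ∀ p : ℕ, p.Prime → p ∣ B → ¬ p ∣ A
  isSquare : ∀ (p : ℕ) [Fact p.Prime], p ∣ A → IsSquare (-(B : ℚ_[p]))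
  gcd : Int.gcd x y = 1
  eq : x ^ 2 + z ^ 2 = A * y ^ 2
  dvd : (B : ℤ) ∣ z
  ne_zero : z ≠ 0
  primitive : Int.gcd (Int.gcd y₁ z₁) x₁ = 1
  eq_one : x₁ ^ 2 = A * y₁ ^ 2 + B * z₁ ^ 2
  pos : 0 < x₁
  pos_y : 0 < y

namespace ConicPair

variable {A B : ℕ} {x y z x₁ y₁ z₁ : ℤ}

theorem neg (h : ConicPair A B x y z x₁ y₁ z₁) : ConicPair A B (-x) y z x₁ y₁ z₁ :=
  { h with gcd := by rw [Int.neg_gcd]; exact h.gcd, eq := by rw [neg_sq]; exact h.eq }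

/-- The difference E = yx₁ − xy₁ times its conjugate E' = yx₁ + xy₁ is a norm from ℚ(√−B); this
controls the symbols (E, −B). -/
theorem mul_eq (h : ConicPair A B x y z x₁ y₁ z₁) :
    (y * x₁ - x * y₁) * (y * x₁ + x * y₁) = (z * y₁) ^ 2 + B * (y * z₁) ^ 2 := by
  linear_combination y ^ 2 * h.eq_one - y₁ ^ 2 * h.eq

/-- The product is a positive norm and the sum 2yx₁ is positive. Positivity of E removes any
contribution of the infinite place. -/
theorem sub_pos (h : ConicPair A B x y z x₁ y₁ z₁) :
    0 < y * x₁ - x * y₁ ∧ 0 < y * x₁ + x * y₁ := by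
  have hB : (0 : ℤ) < B := by exact_mod_cast Nat.pos_of_ne_zero h.right.1
  have h1 : 0 < (y * x₁ - x * y₁) * (y * x₁ + x * y₁) := by
    rw [h.mul_eq]
    by_cases hy : y₁ = 0
    · have hz : z₁ ≠ 0 := by
        rintro rfl
        have := h.eq_one
        rw [hy] at this
        have := h.pos
        nlinarith
      have := h.pos_y.ne'
      have : 0 < (y * z₁) ^ 2 := by positivity
      have := sq_nonneg (z * y₁)
      positivity
    · have := h.ne_zero
      have : 0 < (z * y₁) ^ 2 := by positivity
      positivity
  have h2 : 0 < y * x₁ := mul_pos h.pos_y h.pos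
  rcases mul_pos_iff.1 h1 with h3 | h3
  · exact h3
  · linarith [h3.1, h3.2]

/-- Since p divides z and B, it divides EE', but not E' − E = 2xy₁; so it divides exactly one
factor. The other is ±2xy₁ modulo p, and E, E' have the same symbol because EE' is a norm. -/
theorem hilbertSymbol_of_dvd (h : ConicPair A B x y z x₁ y₁ z₁) {p : ℕ} [hp : Fact p.Prime]
    (hpB : p ∣ B) : hilbertSymbol ((y * x₁ - x * y₁ : ℤ) : ℚ_[p]) (-(B : ℚ_[p])) =
      jacobiSym (x * y₁) p := by
  have hp' := Nat.prime_iff_prime_int.1 hp.out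
  have h8 := h.right.2 p hp.out hpB
  have h2 := h.right.ne_two hp.out hpB
  have hpB' : (p : ℤ) ∣ B := Int.natCast_dvd_natCast.2 hpB
  have hpA : ¬ (p : ℤ) ∣ A := by exact_mod_cast h.not_dvd p hp.out hpB
  have hpz : (p : ℤ) ∣ z := hpB'.trans h.dvd
  have hp2 : ¬ (p : ℤ) ∣ 2 := fun h => h2
    ((Nat.prime_dvd_prime_iff_eq hp.out Nat.prime_two).1 (by exact_mod_cast h))
  have hx : ¬ (p : ℤ) ∣ x := fun hx => by
    have : (p : ℤ) ∣ A * y ^ 2 := by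
      rw [← h.eq]; exact dvd_add (dvd_pow hx two_ne_zero) (dvd_pow hpz two_ne_zero)
    exact not_dvd_of_gcd_eq_one h.gcd hp.out hx
      (hp'.dvd_of_dvd_pow ((hp'.dvd_or_dvd this).resolve_left hpA))
  have hy₁ := not_dvd_left_coord hp.out h.squarefree hpB h.primitive h.eq_one
  have hprod : (p : ℤ) ∣ (y * x₁ - x * y₁) * (y * x₁ + x * y₁) := by
    rw [h.mul_eq]
    exact dvd_add (dvd_pow (hpz.mul_right _) two_ne_zero) (hpB'.mul_right _)
  have hxy : ¬ (p : ℤ) ∣ 2 * (x * y₁) := fun h => by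
    rcases hp'.dvd_or_dvd h with h | h
    · exact hp2 h
    · exact (hp'.dvd_or_dvd h).elim hx hy₁
  have hJ2 : jacobiSym (2 * (x * y₁)) p = jacobiSym (x * y₁) p := by
    rw [jacobiSym.mul_left, jacobiSym_two_prime h8, one_mul]
  have hH : ∀ {k : ℤ}, ¬ (p : ℤ) ∣ k → hilbertSymbol (k : ℚ_[p]) (-(B : ℚ_[p])) = jacobiSym k p := by
    intro k hk
    obtain ⟨i, hi⟩ := isSquare_neg_one_padic h8
    have hi0 : i ≠ 0 := by rintro rfl; norm_num at hi
    rw [← hilbertSymbol_intCast_of_dvd h.right h.squarefree hpB hk, ← hilbertSymbol_mul_sq_right _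
      (B : ℚ_[p]) hi0]
    congr 1
    linear_combination (B : ℚ_[p]) * hi
  obtain ⟨hE, hE'⟩ := h.sub_pos
  have hm := h.mul_eq
  set E := y * x₁ - x * y₁ with hEdef
  set E' := y * x₁ + x * y₁ with hEdef'
  by_cases hpE : (p : ℤ) ∣ E
  · have hpE' : ¬ (p : ℤ) ∣ E' := fun h' => hxy (by
      have := dvd_sub h' hpE
      rwa [show E' - E = 2 * (x * y₁) by rw [hEdef, hEdef']; ring] at this)
    have hE0 : (E : ℚ_[p]) ≠ 0 := by exact_mod_cast hE.ne'
    have hE0' : (E' : ℚ_[p]) ≠ 0 := by exact_mod_cast hE'.ne'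
    have hB0 : -(B : ℚ_[p]) ≠ 0 := neg_ne_zero.2 (by exact_mod_cast h.right.1)
    have h1 : hilbertSymbol ((E : ℚ_[p]) * E') (-(B : ℚ_[p])) = 1 := by
      refine hilbertSymbol_eq_one_of 1 (y * z₁ : ℤ) (z * y₁ : ℤ) (by simp) ?_
      have : (E : ℚ_[p]) * E' = (z * y₁ : ℤ) ^ 2 + B * (y * z₁ : ℤ) ^ 2 := by exact_mod_cast hm
      rw [this]; ring
    rw [hilbertSymbol_mul_left h2 hE0 hE0' hB0, hH hpE'] at h1
    have h3 : jacobiSym E' p = jacobiSym (x * y₁) p := by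
      rw [← hJ2]
      exact jacobiSym_congr_of_dvd_sub (by
        rwa [show E' - 2 * (x * y₁) = E by rw [hEdef, hEdef']; ring])
    rw [h3] at h1
    rcases Int.mul_eq_one_iff_eq_one_or_neg_one.1 h1 with h | h <;> rw [h.1, h.2]
  · have hpE' : (p : ℤ) ∣ E' := (hp'.dvd_or_dvd hprod).resolve_left hpE
    rw [hH hpE, jacobiSym_congr_of_dvd_sub (b := -1 * (2 * (x * y₁))) (by
      rwa [show E - -1 * (2 * (x * y₁)) = E' by rw [hEdef, hEdef']; ring]), jacobiSym.mul_left,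
      jacobiSym_neg_one_prime h8, one_mul, hJ2]

/-- If −B is a non-square unit, EE' has even valuation as a norm. As p cannot divide both factors, E
alone has even valuation. -/
theorem hilbertSymbol_of_not_dvd (h : ConicPair A B x y z x₁ y₁ z₁) {p : ℕ} [hp : Fact p.Prime]
    (h2 : p ≠ 2) (hpB0 : ¬ p ∣ B) :
    hilbertSymbol ((y * x₁ - x * y₁ : ℤ) : ℚ_[p]) (-(B : ℚ_[p])) = 1 := by
  by_cases hsq : IsSquare (-(B : ℚ_[p]))
  · exact hilbertSymbol_of_isSquare_right _ hsq
  have hp' := Nat.prime_iff_prime_int.1 hp.out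
  have hpA : ¬ (p : ℤ) ∣ A := fun hA => hsq (h.isSquare p (Int.natCast_dvd_natCast.1 hA))
  have hpB : ¬ (p : ℤ) ∣ B := by exact_mod_cast hpB0
  have hB1 : ‖-(B : ℚ_[p])‖ = 1 := by rw [norm_neg]; exact norm_natCast_eq_one hpB0
  have hp2 : ¬ (p : ℤ) ∣ 2 := fun h => h2
    ((Nat.prime_dvd_prime_iff_eq hp.out Nat.prime_two).1 (by exact_mod_cast h))
  have hm := h.mul_eq
  obtain ⟨hE, -⟩ := h.sub_pos
  set E := y * x₁ - x * y₁ with hEdef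
  set E' := y * x₁ + x * y₁ with hEdef'
  by_cases hpE : (p : ℤ) ∣ E
  swap
  · exact hilbertSymbol_units h2 (norm_intCast_eq_one hpE) hB1
  have hnorm : ‖((E * E' : ℤ) : ℚ_[p])‖ =
      max ‖((z * y₁ : ℤ) : ℚ_[p])‖ ‖((y * z₁ : ℤ) : ℚ_[p])‖ ^ 2 := by
    rw [← norm_sq_sub_mul_sq h2 hB1 hsq]
    congr 1
    rw [neg_mul, sub_neg_eq_add]
    exact_mod_cast hm
  have hpE' : ¬ (p : ℤ) ∣ E' := by
    intro hpE'
    have d1 : (p : ℤ) ∣ y * x₁ := by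
      have := dvd_add hpE hpE'
      rw [show E + E' = 2 * (y * x₁) by rw [hEdef, hEdef']; ring] at this
      exact (hp'.dvd_or_dvd this).resolve_left hp2
    have d2 : (p : ℤ) ∣ x * y₁ := by
      have := dvd_sub hpE' hpE
      rw [show E' - E = 2 * (x * y₁) by rw [hEdef, hEdef']; ring] at this
      exact (hp'.dvd_or_dvd this).resolve_left hp2
    have hlt := norm_intCast_lt_one (p := p) (hpE.mul_right E')
    rw [hnorm, pow_lt_one_iff_of_nonneg (le_max_of_le_left (norm_nonneg _)) two_ne_zero,
      max_lt_iff] at hlt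
    have d3 := dvd_of_norm_lt_one hlt.2
    by_cases hy : (p : ℤ) ∣ y
    -- If p ∣ y then also p ∣ y₁, and the two conics make −1 and B squares, contrary to −B being a
    -- non-square.
    · have hx : ¬ (p : ℤ) ∣ x := fun hx => not_dvd_of_gcd_eq_one h.gcd hp.out hx hy
      have hy₁ := (hp'.dvd_or_dvd d2).resolve_left hx
      have s1 := isSquare_of_dvd_coord h2 hpB (a := z₁) (b := y₁) (c := x₁) (K := A)
        (by rw [Int.gcd_comm z₁]; exact h.primitive) (by rw [h.eq_one]; ring) hy₁
      have s2 := isSquare_of_dvd_coord h2 (A := -1) (a := z) (b := y) (c := x) (K := A)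
        (fun h => hp'.not_dvd_one ((Int.dvd_neg).1 h))
        (by
          refine gcd_eq_one_of_primes fun q hq h1 h2 => ?_
          exact not_dvd_of_gcd_eq_one h.gcd hq h2 (h1.trans (Int.gcd_dvd_right _ _)))
        (by linear_combination h.eq) hy
      refine hsq ?_
      have := s2.mul s1
      push_cast at this
      rwa [neg_one_mul] at this
    · have hx₁ := (hp'.dvd_or_dvd d1).resolve_left hy
      have hz₁ := (hp'.dvd_or_dvd d3).resolve_left hy
      have : (p : ℤ) ∣ A * y₁ ^ 2 := by
        rw [show (A : ℤ) * y₁ ^ 2 = x₁ ^ 2 - B * z₁ ^ 2 by rw [h.eq_one]; ring]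
        exact dvd_sub (dvd_pow hx₁ two_ne_zero) ((dvd_pow hz₁ two_ne_zero).mul_left _)
      exact not_dvd_of_primitive h.primitive hp.out
        ⟨hp'.dvd_of_dvd_pow ((hp'.dvd_or_dvd this).resolve_left hpA), hz₁, hx₁⟩
  have hne : ‖(E : ℚ_[p])‖ = max ‖((z * y₁ : ℤ) : ℚ_[p])‖ ‖((y * z₁ : ℤ) : ℚ_[p])‖ ^ 2 := by
    rw [← hnorm]; push_cast; rw [norm_mul, norm_intCast_eq_one hpE', mul_one]
  have hE0 : (E : ℚ_[p]) ≠ 0 := by exact_mod_cast hE.ne'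
  rcases max_choice ‖((z * y₁ : ℤ) : ℚ_[p])‖ ‖((y * z₁ : ℤ) : ℚ_[p])‖ with hm | hm
  all_goals
    rw [hm] at hne
    refine hilbertSymbol_eq_one_of_norm_eq h2 (fun h0 => hE0 ?_) hne one_ne_zero
      (by rw [hB1]; simp)
    rw [h0, norm_zero] at hne
    exact norm_eq_zero.1 (by rw [hne]; norm_num)

/-- The product formula for (E, −B) leaves only the character modulo 4 of the odd part of E, to be
matched with that of x₁. -/
theorem jacobiSym_eq_of_parity (h : ConicPair A B x y z x₁ y₁ z₁) {s : ℕ} {E₀ : ℤ}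
    (hE : y * x₁ - x * y₁ = 2 ^ s * E₀) (hodd : E₀ % 2 = 1) (hmod : E₀ % 4 = x₁ % 4) :
    jacobiSym (x * y₁) B = jacobiSym (-1) x₁.natAbs := by
  have hpos : 0 < E₀ := by
    have := h.sub_pos.1
    rw [hE] at this
    exact pos_of_mul_pos_right this (by positivity)
  obtain ⟨k, rfl⟩ := Int.eq_ofNat_of_zero_le hpos.le
  obtain ⟨X, rfl⟩ := Int.eq_ofNat_of_zero_le h.pos.le
  have hk : Odd k := Nat.odd_iff.2 (by omega)
  have hX : Odd X := Nat.odd_iff.2 (by omega)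
  rw [jacobiSym_eq_neg_one_of_hilbertSymbol h.right h.squarefree hE hk
    (fun p _ h2 hpB => h.hilbertSymbol_of_not_dvd h2 hpB) (fun p _ hpB => h.hilbertSymbol_of_dvd hpB),
    Int.natAbs_natCast, jacobiSym.at_neg_one hk, jacobiSym.at_neg_one hX, ZMod.χ₄_nat_mod_four,
    ZMod.χ₄_nat_mod_four X]
  have : k % 4 = X % 4 := by omega
  rw [this]

/-- Modulo y, x² ≡ −z² with x and z prime to y, so (−1/y) = 1; here y > 0 is used. -/
theorem y_mod_four (h : ConicPair A B x y z x₁ y₁ z₁) (hy : y % 2 = 1) : y % 4 = 1 := by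
  obtain ⟨Y, rfl⟩ := Int.eq_ofNat_of_zero_le h.pos_y.le
  have hY : Odd Y := Nat.odd_iff.2 (by omega)
  have hx : Int.gcd x Y = 1 := h.gcd
  have hz : Int.gcd z Y = 1 := by
    refine gcd_eq_one_of_primes fun p hp hpz hpY => ?_
    refine not_dvd_of_gcd_eq_one h.gcd hp ?_ hpY
    refine (Nat.prime_iff_prime_int.1 hp).dvd_of_dvd_pow (n := 2) ?_
    rw [show x ^ 2 = A * (Y : ℤ) ^ 2 - z ^ 2 by linear_combination h.eq]
    exact dvd_sub ((dvd_pow hpY two_ne_zero).mul_left _) (dvd_pow hpz two_ne_zero)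
  have e : jacobiSym (x ^ 2) Y = jacobiSym (-1 * z ^ 2) Y := by
    rw [jacobiSym.mod_left, jacobiSym.mod_left (-1 * z ^ 2),
      Int.emod_eq_emod_iff_emod_sub_eq_zero.2 (Int.emod_eq_zero_of_dvd ?_)]
    exact ⟨A * Y, by linear_combination h.eq⟩
  rw [jacobiSym.mul_left, jacobiSym.sq_one' hx, jacobiSym.sq_one' hz, mul_one,
    jacobiSym.at_neg_one hY, ZMod.χ₄_nat_eq_if_mod_four] at e
  have : Y % 2 = 1 := by omega
  rw [if_neg (by omega)] at e
  by_contra hcon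
  rw [if_neg (by omega)] at e
  norm_num at e

/-- A 2-adic analysis of E = yx₁ − xy₁. Congruences modulo 8 make y and x₁ odd, and y ≡ 1 (mod 4).
If 4 ∣ xy₁, then E ≡ x₁ (mod 4). Otherwise x, y₁ are odd and 4 divides z, z₁, and the factor of two
in E must be removed. -/
theorem jacobiSym_eq (h : ConicPair A B x y z x₁ y₁ z₁) :
    jacobiSym (x * y₁) B = jacobiSym (-1) x₁.natAbs := by
  have hA8 := h.left.mod_eight
  have hB8 := h.right.mod_eight
  obtain ⟨k, hk⟩ : (8 : ℤ) ∣ A - 1 := by omega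
  obtain ⟨l, hl⟩ : (8 : ℤ) ∣ B - 1 := by omega
  have hnot : ∀ {a b : ℤ}, Int.gcd a b = 1 → ¬ (a % 2 = 0 ∧ b % 2 = 0) := fun hg h =>
    not_dvd_of_gcd_eq_one hg Nat.prime_two (Int.dvd_of_emod_eq_zero h.1)
      (Int.dvd_of_emod_eq_zero h.2)
  obtain ⟨hy, hxz⟩ := parity_of_sq_eq (u := y) (v := x) (w := z)
    (Int.emod_eq_zero_of_dvd ⟨-k * y ^ 2, by linear_combination -h.eq - y ^ 2 * hk⟩)
    (fun h' => hnot h.gcd ⟨h'.2.1, h'.1⟩)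
  obtain ⟨hx₁, hyz⟩ := parity_of_sq_eq (u := x₁) (v := y₁) (w := z₁)
    (Int.emod_eq_zero_of_dvd ⟨k * y₁ ^ 2 + l * z₁ ^ 2, by
      linear_combination h.eq_one + y₁ ^ 2 * hk + z₁ ^ 2 * hl⟩)
    (fun h' => not_dvd_of_primitive h.primitive Nat.prime_two
      ⟨Int.dvd_of_emod_eq_zero h'.2.1, Int.dvd_of_emod_eq_zero h'.2.2,
        Int.dvd_of_emod_eq_zero h'.1⟩)
  have hy4 := h.y_mod_four hy
  obtain ⟨q, hq⟩ : (4 : ℤ) ∣ y - 1 := by omega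
  have hyx : y * x₁ = x₁ + 4 * (q * x₁) := by linear_combination x₁ * hq
  by_cases hc : (4 : ℤ) ∣ x * y₁
  · obtain ⟨r, hr⟩ := hc
    exact h.jacobiSym_eq_of_parity (s := 0) (E₀ := y * x₁ - x * y₁) (by ring)
      (by rw [hyx, hr]; omega) (by rw [hyx, hr]; omega)
  have hx4 : ¬ x % 4 = 0 := fun h => hc ((Int.dvd_of_emod_eq_zero h).mul_right _)
  have hy14 : ¬ y₁ % 4 = 0 := fun h => hc ((Int.dvd_of_emod_eq_zero h).mul_left _)
  obtain ⟨hx, hz⟩ := hxz.resolve_right fun h => hx4 h.2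
  obtain ⟨hy₁, hz₁⟩ := hyz.resolve_right fun h => hy14 h.2
  -- If 4 ∣ E', then 16 ∣ EE' and E ≡ 2 (mod 4) force 8 ∣ E'. Hence E/2 = yx₁ − E'/2 ≡ x₁ (mod 4).
  have main : ∀ {x : ℤ}, ConicPair A B x y z x₁ y₁ z₁ → (4 : ℤ) ∣ y * x₁ + x * y₁ →
      jacobiSym (x * y₁) B = jacobiSym (-1) x₁.natAbs := by
    intro x h hdvd
    obtain ⟨r, hr⟩ := hdvd
    have hE : y * x₁ - x * y₁ = 2 ^ 1 * (x₁ + 4 * (q * x₁) - 2 * r) := by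
      linear_combination 2 * hyx - hr
    have hm := h.mul_eq
    obtain ⟨z', hz'⟩ := Int.dvd_of_emod_eq_zero hz
    obtain ⟨z₁', hz₁'⟩ := Int.dvd_of_emod_eq_zero hz₁
    have h8 : (2 : ℤ) ∣ (x₁ + 4 * (q * x₁) - 2 * r) * r := by
      refine ⟨(z' * y₁) ^ 2 + B * (y * z₁') ^ 2, ?_⟩
      rw [hE, hr, hz', hz₁'] at hm
      linarith
    have hr2 : (2 : ℤ) ∣ r := by
      rcases Int.prime_two.dvd_or_dvd h8 with h | h
      · omega
      · exact h
    exact h.jacobiSym_eq_of_parity hE (by omega) (by omega)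
  -- Exactly one of E, E' is divisible by 4; changing the sign of x exchanges them and costs only
  -- (−1/B) = 1.
  by_cases hdvd : (4 : ℤ) ∣ y * x₁ + x * y₁
  · exact main h hdvd
  · have hodd : (x * y₁) % 2 = 1 := by rw [Int.mul_emod, hx, hy₁]; rfl
    have := main h.neg (by rw [neg_mul]; omega)
    rw [neg_mul, ← neg_one_mul, jacobiSym.mul_left, h.right.jacobiSym_neg_one, one_mul] at this
    exact this

end ConicPair

/-! ### Composition of two solutions and its content -/

section Content

variable {p : ℕ} [hp : Fact p.Prime]

/-- The factors `c ± s a` in a primitive solution of `c² = s² a² + K b²`. -/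
theorem norm_factors (h2 : p ≠ 2) {A K a b c : ℤ} (hA : ¬ (p : ℤ) ∣ A) (hK : ¬ (p : ℤ) ∣ K)
    (hg : Int.gcd (Int.gcd a b) c = 1) (hc : c ^ 2 = A * a ^ 2 + K * b ^ 2) {s : ℚ_[p]}
    (hs : (A : ℚ_[p]) = s * s) : ‖(c : ℚ_[p]) - s * a‖ ≤ 1 ∧ ‖(c : ℚ_[p]) + s * a‖ ≤ 1 ∧
      ‖(c : ℚ_[p]) - s * a‖ * ‖(c : ℚ_[p]) + s * a‖ = ‖(b : ℚ_[p])‖ ^ 2 ∧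
      ¬ (‖(c : ℚ_[p]) - s * a‖ < 1 ∧ ‖(c : ℚ_[p]) + s * a‖ < 1) := by
  have hp' := Nat.prime_iff_prime_int.1 hp.out
  have hs1 : ‖s‖ = 1 := by
    have := norm_intCast_eq_one hA
    rw [hs, norm_mul, ← sq] at this
    exact (pow_eq_one_iff_of_nonneg (norm_nonneg _) two_ne_zero).1 this
  have hsa : ‖s * a‖ ≤ 1 := by rw [norm_mul, hs1, one_mul]; exact Padic.norm_int_le_one a
  have hcn := Padic.norm_int_le_one (p := p) c
  have hcq : (c : ℚ_[p]) ^ 2 = A * a ^ 2 + K * b ^ 2 := by exact_mod_cast hc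
  refine ⟨?_, (Padic.nonarchimedean _ _).trans (max_le hcn hsa), ?_, fun ⟨h1, h3⟩ => ?_⟩
  · rw [sub_eq_add_neg]
    exact (Padic.nonarchimedean _ _).trans (max_le hcn (by rwa [norm_neg]))
  · rw [← norm_mul, show ((c : ℚ_[p]) - s * a) * (c + s * a) = K * b ^ 2 by
      linear_combination hcq + a ^ 2 * hs, norm_mul, norm_intCast_eq_one hK, one_mul, norm_pow]
  · have hn2 := norm_two_eq_one h2
    have hpc : (p : ℤ) ∣ c := by
      have := Padic.norm_add_lt_of_lt h1 h3
      rw [show (c : ℚ_[p]) - s * a + (c + s * a) = 2 * c by ring, norm_mul, hn2, one_mul] at this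
      exact dvd_of_norm_lt_one this
    have hpa : (p : ℤ) ∣ a := by
      have := Padic.norm_add_lt_of_lt (x := -((c : ℚ_[p]) - s * (a : ℚ_[p])))
        (by rwa [norm_neg]) h3
      rw [show -((c : ℚ_[p]) - s * (a : ℚ_[p])) + ((c : ℚ_[p]) + s * (a : ℚ_[p])) =
          2 * (s * (a : ℚ_[p])) by ring, norm_mul, hn2, one_mul,
        norm_mul, hs1, one_mul] at this
      exact dvd_of_norm_lt_one this
    have : (p : ℤ) ∣ K * b ^ 2 := by
      rw [show K * b ^ 2 = c ^ 2 - A * a ^ 2 by rw [hc]; ring]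
      exact dvd_sub (dvd_pow hpc two_ne_zero) ((dvd_pow hpa two_ne_zero).mul_left _)
    exact not_dvd_of_primitive hg hp.out
      ⟨hpa, hp'.dvd_of_dvd_pow ((hp'.dvd_or_dvd this).resolve_left hK), hpc⟩

/-- The content of the composition of solutions of `c² = A a² + K b²` and `c'² = A a'² - K b'²`
has even valuation at the good primes. -/
theorem exists_norm_content_eq_sq (h2 : p ≠ 2) {A K a b c a' b' c' x y : ℤ} {g : ℕ}
    (hA : ¬ (p : ℤ) ∣ A) (hK : ¬ (p : ℤ) ∣ K) (hg : Int.gcd (Int.gcd a b) c = 1)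
    (hc : c ^ 2 = A * a ^ 2 + K * b ^ 2) (hg' : Int.gcd (Int.gcd a' b') c' = 1)
    (hc' : c' ^ 2 = A * a' ^ 2 + -K * b' ^ 2) (hb : b ≠ 0) (hb' : b' ≠ 0)
    (hx : c * c' - A * a * a' = g * x) (hy : c * a' - a * c' = g * y) (hxy : Int.gcd x y = 1) :
    ∃ r : ℚ_[p], r ≠ 0 ∧ ‖(g : ℚ_[p])‖ = ‖r‖ ^ 2 := by
  have hp' := Nat.prime_iff_prime_int.1 hp.out
  by_cases hpg : p ∣ g
  swap
  · exact ⟨1, one_ne_zero, by rw [norm_natCast_eq_one hpg]; simp⟩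
  have hpg' : (p : ℤ) ∣ g := Int.natCast_dvd_natCast.2 hpg
  have hg1 : ‖(g : ℚ_[p])‖ < 1 := by exact_mod_cast norm_intCast_lt_one hpg'
  have hid : (c * c' - A * a * a') ^ 2 - A * (c * a' - a * c') ^ 2 = -(K * (b * b')) ^ 2 := by
    linear_combination (c' ^ 2 - A * a' ^ 2) * hc + K * b ^ 2 * hc'
  have hsq : IsSquare (A : ℚ_[p]) := by
    have hdvd : (p : ℤ) ∣ K * (b * b') := by
      refine hp'.dvd_of_dvd_pow (n := 2) ?_
      rw [← Int.dvd_neg, ← hid, hx, hy]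
      exact dvd_sub (dvd_pow (hpg'.mul_right _) two_ne_zero)
        ((dvd_pow (hpg'.mul_right _) two_ne_zero).mul_left _)
    rcases hp'.dvd_or_dvd ((hp'.dvd_or_dvd hdvd).resolve_left hK) with h | h
    · exact isSquare_of_dvd_coord h2 hA hg hc h
    · exact isSquare_of_dvd_coord h2 hA hg' hc' h
  obtain ⟨s, hs⟩ := hsq
  obtain ⟨u1, v1, uv, nuv⟩ := norm_factors h2 hA hK hg hc hs
  obtain ⟨u1', v1', uv', nuv'⟩ := norm_factors h2 hA (by rwa [Int.dvd_neg]) hg' hc' hs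
  have hs1 : ‖s‖ = 1 := by
    have := norm_intCast_eq_one hA
    rw [hs, norm_mul, ← sq] at this
    exact (pow_eq_one_iff_of_nonneg (norm_nonneg _) two_ne_zero).1 this
  have hxq : (c * c' - A * a * a' : ℚ_[p]) = g * x := by exact_mod_cast hx
  have hyq : (c * a' - a * c' : ℚ_[p]) = g * y := by exact_mod_cast hy
  -- Over s = √A the composition splits into two products. As x, y are coprime, one of x ± sy is a
  -- unit, so ‖g‖ is the norm of one of the two products.
  have hP : (g : ℚ_[p]) * (x + s * y) = (c - s * a) * (c' + s * a') := by
    linear_combination -hxq - s * hyq - a * a' * hs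
  have hM : (g : ℚ_[p]) * (x - s * y) = (c + s * a) * (c' - s * a') := by
    linear_combination -hxq + s * hyq - a * a' * hs
  have hsy : ‖s * y‖ ≤ 1 := by rw [norm_mul, hs1, one_mul]; exact Padic.norm_int_le_one y
  have hx1 := Padic.norm_int_le_one (p := p) x
  have hP1 : ‖(x : ℚ_[p]) + s * y‖ ≤ 1 := (Padic.nonarchimedean _ _).trans (max_le hx1 hsy)
  have hM1 : ‖(x : ℚ_[p]) - s * y‖ ≤ 1 := by
    rw [sub_eq_add_neg]
    exact (Padic.nonarchimedean _ _).trans (max_le hx1 (by rwa [norm_neg]))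
  have hnot : ¬ (‖(x : ℚ_[p]) + s * y‖ < 1 ∧ ‖(x : ℚ_[p]) - s * y‖ < 1) := by
    rintro ⟨h1, h3⟩
    have hn2 := norm_two_eq_one h2
    have hpx : (p : ℤ) ∣ x := by
      have := Padic.norm_add_lt_of_lt h1 h3
      rw [show (x : ℚ_[p]) + s * y + (x - s * y) = 2 * x by ring, norm_mul, hn2, one_mul] at this
      exact dvd_of_norm_lt_one this
    have hpy : (p : ℤ) ∣ y := by
      have := Padic.norm_add_lt_of_lt (y := -((x : ℚ_[p]) - s * (y : ℚ_[p]))) h1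
        (by rwa [norm_neg])
      rw [show (x : ℚ_[p]) + s * (y : ℚ_[p]) + -((x : ℚ_[p]) - s * (y : ℚ_[p])) =
          2 * (s * (y : ℚ_[p])) by ring, norm_mul, hn2, one_mul,
        norm_mul, hs1, one_mul] at this
      exact dvd_of_norm_lt_one this
    exact not_dvd_of_gcd_eq_one hxy hp.out hpx hpy
  have hP' := congrArg norm hP
  have hM' := congrArg norm hM
  rw [norm_mul, norm_mul] at hP' hM'
  have hbq : (b : ℚ_[p]) ≠ 0 := by exact_mod_cast hb
  have hbq' : (b' : ℚ_[p]) ≠ 0 := by exact_mod_cast hb'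
  have hn0 := norm_nonneg (g : ℚ_[p])
  have lt1 : ∀ {u v : ℝ}, u ≤ 1 → 0 ≤ u → ‖(g : ℚ_[p])‖ * u = v → v < 1 := fun hu hu0 h => by
    rw [← h]; nlinarith
  have hPlt := lt1 hP1 (norm_nonneg _) hP'
  have hMlt := lt1 hM1 (norm_nonneg _) hM'
  have fin : ∀ {P M u v : ℝ}, P ≤ 1 → M ≤ 1 → ¬ (P < 1 ∧ M < 1) → ‖(g : ℚ_[p])‖ * P = u →
      ‖(g : ℚ_[p])‖ * M = v → ‖(g : ℚ_[p])‖ = u ∨ ‖(g : ℚ_[p])‖ = v := by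
    intro P M u v hP hM h hu hv
    rcases hP.lt_or_eq with h1 | h1
    · right; rw [← hv, le_antisymm hM (not_lt.1 fun h2 => h ⟨h1, h2⟩), mul_one]
    · left; rw [← hu, h1, mul_one]
  have key := fin hP1 hM1 hnot hP' hM'
  have eq1 : ∀ {u : ℝ}, u ≤ 1 → ¬ u < 1 → u = 1 := fun h h' => le_antisymm h (not_lt.1 h')
  -- Each conjugate pair contains a unit, while both products are non-units. So each product has a
  -- single non-unit factor, of norm ‖b‖² or ‖b'‖².
  by_cases hu : ‖(c : ℚ_[p]) - s * a‖ < 1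
  · have hv := eq1 v1 fun h => nuv ⟨hu, h⟩
    rw [hv, one_mul] at hM' hMlt
    have hv' := eq1 v1' fun h => nuv' ⟨hMlt, h⟩
    rw [hv, mul_one] at uv
    rw [hv', mul_one] at uv'
    rw [hv, hv', one_mul, mul_one, uv, uv'] at key
    exact key.elim (fun h => ⟨b, hbq, h⟩) fun h => ⟨b', hbq', h⟩
  · have hu' := eq1 u1 hu
    rw [hu', one_mul] at hP' hPlt
    have hw := eq1 u1' fun h => nuv' ⟨h, hPlt⟩
    rw [hu', one_mul] at uv
    rw [hw, one_mul] at uv'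
    rw [hu', hw, one_mul, mul_one, uv, uv'] at key
    exact key.elim (fun h => ⟨b', hbq', h⟩) fun h => ⟨b, hbq, h⟩

end Content

theorem dvd_coord_iff {p : ℕ} (hp : p.Prime) {A K a b c : ℤ} (hA : ¬ (p : ℤ) ∣ A)
    (hK : (p : ℤ) ∣ K) (hc : c ^ 2 = A * a ^ 2 + K * b ^ 2) : (p : ℤ) ∣ c ↔ (p : ℤ) ∣ a := by
  have hp' := Nat.prime_iff_prime_int.1 hp
  constructor
  · intro h
    have : (p : ℤ) ∣ A * a ^ 2 := by
      rw [show A * a ^ 2 = c ^ 2 - K * b ^ 2 by rw [hc]; ring]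
      exact dvd_sub (dvd_pow h two_ne_zero) (hK.mul_right _)
    exact hp'.dvd_of_dvd_pow ((hp'.dvd_or_dvd this).resolve_left hA)
  · intro h
    refine hp'.dvd_of_dvd_pow (n := 2) ?_
    rw [hc]
    exact dvd_add ((dvd_pow h two_ne_zero).mul_left _) (hK.mul_right _)

namespace LocallyGoodFactors

variable {n A B f : ℕ}

/-- Multiplying c + a√A by c' − a'√A up to sign, as norms with values K b² and −K b'², gives x² + z²
= A y² with z = K b b'. The divisibility hypothesis yields x ≡ 2cc' modulo the primes of B. Once its
content is removed, the point is compared with x₁² = A y₁² + B z₁² by `ConicPair.jacobiSym_eq`. -/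
theorem jacobiSym_mul_conj (h : LocallyGoodFactors n A B f) {a b c a' b' c' : ℤ}
    (hb : b ≠ 0) (hg : Int.gcd (Int.gcd a b) c = 1)
    (hc : c ^ 2 = A * a ^ 2 + (B * f : ℕ) * b ^ 2)
    (hb' : b' ≠ 0) (hg' : Int.gcd (Int.gcd a' b') c' = 1)
    (hc' : c' ^ 2 = A * a' ^ 2 + -(B * f : ℕ) * b' ^ 2)
    (hdiv : ((B * f : ℕ) : ℤ) ∣ a * c' + c * a')
    {x₁ y₁ z₁ : ℤ} (hg₁ : Int.gcd (Int.gcd y₁ z₁) x₁ = 1)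
    (hx₁ : x₁ ^ 2 = A * y₁ ^ 2 + B * z₁ ^ 2) (hpos : 0 < x₁) :
    jacobiSym (c * c') B = jacobiSym (-1) x₁.natAbs := by
  have hB := h.mid.oneModEight
  have hBsq := h.mid.squarefree
  have hK0 : ((B * f : ℕ) : ℤ) ≠ 0 := by
    exact_mod_cast mul_ne_zero hB.1 h.right.oneModEight.1
  set x := c * c' - A * a * a' with hx
  set y := c * a' - a * c' with hy
  set z := ((B * f : ℕ) : ℤ) * (b * b') with hz
  have hz0 : z ≠ 0 := mul_ne_zero hK0 (mul_ne_zero hb hb')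
  have hid : x ^ 2 + z ^ 2 = A * y ^ 2 := by
    rw [hx, hy, hz]
    linear_combination (c' ^ 2 - A * a' ^ 2) * hc + (B * f : ℕ) * b ^ 2 * hc'
  have hy0 : y ≠ 0 := by
    intro h0
    rw [h0] at hid
    have : 0 < z ^ 2 := by positivity
    nlinarith [sq_nonneg x]
  have loc : ∀ p : ℕ, p.Prime → p ∣ B → (p : ℤ) ∣ x - 2 * (c * c') ∧ ¬ (p : ℤ) ∣ x ∧
      (p : ℤ) ∣ z := by
    intro p hp hpB
    have hp' := Nat.prime_iff_prime_int.1 hp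
    have hpK : (p : ℤ) ∣ (B * f : ℕ) := Int.natCast_dvd_natCast.2 (hpB.mul_right f)
    have hpA : ¬ (p : ℤ) ∣ A := by exact_mod_cast (h.not_dvd_of_dvd hp hpB).1
    have h2 := hB.ne_two hp hpB
    have hp2 : ¬ (p : ℤ) ∣ 2 := fun h => h2
      ((Nat.prime_dvd_prime_iff_eq hp Nat.prime_two).1 (by exact_mod_cast h))
    have hac : ¬ (p : ℤ) ∣ a :=
      not_dvd_left_coord hp h.squarefree_mid_mul_right (hpB.mul_right f) hg hc
    have hcc : ¬ (p : ℤ) ∣ c := fun h => hac ((dvd_coord_iff hp hpA hpK hc).1 h)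
    have hac' : ¬ (p : ℤ) ∣ a' := by
      intro ha'
      have hcd := (dvd_coord_iff hp hpA ((Int.dvd_neg).2 hpK) hc').2 ha'
      obtain ⟨a₀, rfl⟩ := ha'
      obtain ⟨c₀, rfl⟩ := hcd
      have := dvd_of_dvd_mul_sq hp h.squarefree_mid_mul_right (hpB.mul_right f) (a := b')
        (k := A * a₀ ^ 2 - c₀ ^ 2) (by linear_combination hc')
      exact not_dvd_of_primitive hg' hp ⟨dvd_mul_right _ _, this, dvd_mul_right _ _⟩
    have hcc' : ¬ (p : ℤ) ∣ c' := fun h =>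
      hac' ((dvd_coord_iff hp hpA ((Int.dvd_neg).2 hpK) hc').1 h)
    -- The hypothesis on ac' + ca' fixes the relative sign: cc' ≡ −Aaa', so x does not vanish modulo
    -- p.
    have h3 : (p : ℤ) ∣ c * (c * c' + A * a * a') := by
      rw [show c * (c * c' + A * a * a') = A * a * (a * c' + c * a') + (B * f : ℕ) * (b ^ 2 * c') by
        linear_combination c' * hc]
      exact dvd_add ((hpK.trans hdiv).mul_left _) (hpK.mul_right _)
    have h4 := (hp'.dvd_or_dvd h3).resolve_left hcc
    have h5 : (p : ℤ) ∣ x - 2 * (c * c') := by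
      rw [hx, show c * c' - A * a * a' - 2 * (c * c') = -(c * c' + A * a * a') by ring, Int.dvd_neg]
      exact h4
    refine ⟨h5, fun hxp => ?_, hpK.mul_right _⟩
    have := (dvd_sub_right hxp).1 h5
    rcases hp'.dvd_or_dvd this with h | h
    · exact hp2 h
    · exact (hp'.dvd_or_dvd h).elim hcc hcc'
  set g := Int.gcd x y with hgdef
  have hg0 : g ≠ 0 := fun h0 => hy0 (Int.gcd_eq_zero_iff.1 h0).2
  have hgz : (g : ℤ) ≠ 0 := by exact_mod_cast hg0
  obtain ⟨x', hx'⟩ := Int.gcd_dvd_left x y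
  obtain ⟨y', hy'⟩ := Int.gcd_dvd_right x y
  rw [← hgdef] at hx' hy'
  have hxy' : Int.gcd x' y' = 1 := by
    have : g = g * Int.gcd x' y' := by
      conv_lhs => rw [hgdef, hx', hy', Int.gcd_mul_left, Int.natAbs_natCast]
    exact Nat.eq_of_mul_eq_mul_left (Nat.pos_of_ne_zero hg0) (by rw [← this, mul_one])
  obtain ⟨z', hz'⟩ : (g : ℤ) ∣ z := by
    rw [← Int.pow_dvd_pow_iff (n := 2) two_ne_zero]
    exact ⟨A * y' ^ 2 - x' ^ 2, by
      have e := hid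
      rw [hx', hy'] at e
      linear_combination e⟩
  have hgB : ∀ p : ℕ, p.Prime → p ∣ B → ¬ (p : ℤ) ∣ g := fun p hp hpB hpg =>
    (loc p hp hpB).2.1 (hx' ▸ hpg.mul_right _)
  have hBz : (B : ℤ) ∣ z' := by
    have hcop : IsCoprime (B : ℤ) g := by
      rw [Int.isCoprime_iff_gcd_eq_one]
      exact gcd_eq_one_of_primes fun p hp hpB => hgB p hp (Int.natCast_dvd_natCast.1 hpB)
    refine hcop.dvd_of_dvd_mul_left (?_ : (B : ℤ) ∣ g * z')
    rw [← hz', hz]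
    exact (Int.natCast_dvd_natCast.2 (dvd_mul_right B f)).mul_right _
  -- The content g is prime to B and has even valuation at every odd p ∤ B where B is not a square,
  -- so dividing by it does not change the symbol.
  have hJg : jacobiSym g B = 1 := by
    refine jacobiSym_eq_one_of_hilbertSymbol hB hBsq hgz hgB fun p hp h2 hpB => ?_
    by_cases hsq : IsSquare (B : ℚ_[p])
    · exact hilbertSymbol_of_isSquare_right _ hsq
    have hpn : ¬ p ∣ 2 * n := fun hn => hsq (h.mid.isSquare p hn hpB)
    obtain ⟨-, hpA, -, hpf⟩ := h.not_dvd hpn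
    have hpK : ¬ p ∣ B * f := fun h => (hp.out.dvd_mul.1 h).elim hpB hpf
    obtain ⟨r, hr, e⟩ := exists_norm_content_eq_sq h2 (by exact_mod_cast hpA)
      (by exact_mod_cast hpK) hg hc hg' hc' hb hb' hx' hy' hxy'
    exact hilbertSymbol_eq_one_of_norm_eq h2 hr (by exact_mod_cast e) one_ne_zero
      (by rw [norm_natCast_eq_one hpB]; simp)
  have hS : ∀ {Y : ℤ}, 0 < Y → Int.gcd x' Y = 1 → x' ^ 2 + z' ^ 2 = A * Y ^ 2 →
      ConicPair A B x' Y z' x₁ y₁ z₁ := fun hY hgY hE =>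
    { left := h.left.oneModEight
      right := hB
      squarefree := hBsq
      not_dvd := fun p hp hpB => (h.not_dvd_of_dvd hp hpB).1
      isSquare := fun p _ hpA => by
        rw [← neg_one_mul]
        exact (isSquare_neg_one_padic (h.left.oneModEight.2 p (Fact.out) hpA)).mul
          (h.swap.isSquare_left hpA)
      gcd := hgY
      eq := hE
      dvd := hBz
      ne_zero := fun h0 => hz0 (by rw [hz', h0, mul_zero])
      primitive := hg₁
      eq_one := hx₁
      pos := hpos
      pos_y := hY }
  have hid' : x' ^ 2 + z' ^ 2 = A * y' ^ 2 := by
    apply mul_left_cancel₀ (pow_ne_zero 2 hgz)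
    have e := hid
    rw [hx', hy', hz'] at e
    linear_combination e
  have hy0' : y' ≠ 0 := fun h0 => hy0 (by rw [hy', h0, mul_zero])
  have hJ := (hS (Y := |y'|) (abs_pos.2 hy0') (by rw [Int.gcd, Int.natAbs_abs]; exact hxy')
    (by rwa [sq_abs])).jacobiSym_eq
  have hJ2 : jacobiSym x B = jacobiSym (2 * (c * c')) B :=
    jacobiSym_congr_primes hBsq fun p hp hpB => jacobiSym_congr_of_dvd_sub (loc p hp.out hpB).1
  rw [jacobiSym.mul_left 2, hB.jacobiSym_two, one_mul, hx', jacobiSym.mul_left, hJg, one_mul] at hJ2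
  rw [← hJ2, ← hJ, jacobiSym.mul_left, jacobiSym_left_coord hB hBsq hg₁ hx₁, mul_one]

end LocallyGoodFactors

/-! ### The reciprocity relation between c and c̄ -/

theorem jacobiSym_mul_self {a : ℤ} {b : ℕ} (h : Int.gcd a b = 1) :
    jacobiSym a b * jacobiSym a b = 1 := by
  rw [← sq, jacobiSym.sq_one h]

namespace LocallyGoodFactors

variable {n A B f : ℕ}

theorem gcd_right_eq_one (h : LocallyGoodFactors n A B f) {x y z : ℤ}
    (hg : Int.gcd (Int.gcd y z) x = 1) (hx : x ^ 2 = A * y ^ 2 + B * z ^ 2) : Int.gcd x B = 1 :=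
  gcd_eq_one_of_primes fun p hp hpx hpB => by
    have hpB' := Int.natCast_dvd_natCast.1 hpB
    have hpA : ¬ (p : ℤ) ∣ A := by exact_mod_cast (h.not_dvd_of_dvd hp hpB').1
    have hp' := Nat.prime_iff_prime_int.1 hp
    refine not_dvd_left_coord hp h.mid.squarefree hpB' hg hx (hp'.dvd_of_dvd_pow (n := 2) ?_)
    refine (hp'.dvd_or_dvd (a := (A : ℤ)) ?_).resolve_left hpA
    rw [show (A : ℤ) * y ^ 2 = x ^ 2 - B * z ^ 2 by rw [hx]; ring]
    exact dvd_sub (dvd_pow hpx two_ne_zero) (hpB.mul_right _)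

theorem gcd_coord_eq_one (h : LocallyGoodFactors n A B f) {x y z : ℤ}
    (hg : Int.gcd (Int.gcd y z) x = 1) (hx : x ^ 2 = A * y ^ 2 + B * z ^ 2) : Int.gcd y x = 1 :=
  gcd_eq_one_of_primes fun p hp hpy hpx => by
    have hp' := Nat.prime_iff_prime_int.1 hp
    have : (p : ℤ) ∣ B * z ^ 2 := by
      rw [show (B : ℤ) * z ^ 2 = x ^ 2 - A * y ^ 2 by rw [hx]; ring]
      exact dvd_sub (dvd_pow hpx two_ne_zero) ((dvd_pow hpy two_ne_zero).mul_left _)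
    rcases hp'.dvd_or_dvd this with h' | h'
    · exact not_dvd_left_coord hp h.mid.squarefree (Int.natCast_dvd_natCast.1 h') hg hx hpy
    · exact not_dvd_of_primitive hg hp ⟨hpy, hp'.dvd_of_dvd_pow h', hpx⟩

/-- Modulo x the equation says A y² ≡ −B z², so (A/x) = (−1/x)(B/x); reciprocity inverts the symbols
because A, B ≡ 1 (mod 4). -/
theorem jacobiSym_mul_eq_neg_one (h : LocallyGoodFactors n A B f) {x y z : ℤ}
    (hg : Int.gcd (Int.gcd y z) x = 1) (hx : x ^ 2 = A * y ^ 2 + B * z ^ 2) (hpos : 0 < x) :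
    jacobiSym x A * jacobiSym x B = jacobiSym (-1) x.natAbs := by
  have hA8 := h.left.oneModEight.mod_eight
  have hB8 := h.mid.oneModEight.mod_eight
  have hgB := h.gcd_right_eq_one hg hx
  have hgy := h.gcd_coord_eq_one hg hx
  have hgz := h.swap.gcd_coord_eq_one (x := x) (y := z) (z := y)
    (by rwa [Int.gcd_comm z y]) (by rw [hx]; ring)
  obtain ⟨k, hk⟩ : (8 : ℤ) ∣ A - 1 := by omega
  obtain ⟨l, hl⟩ : (8 : ℤ) ∣ B - 1 := by omega
  have hodd := (parity_of_sq_eq (u := x) (v := y) (w := z)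
    (Int.emod_eq_zero_of_dvd ⟨k * y ^ 2 + l * z ^ 2, by
      linear_combination hx + y ^ 2 * hk + z ^ 2 * hl⟩)
    fun ⟨h1, h2, h3⟩ => not_dvd_of_primitive hg Nat.prime_two
      ⟨Int.dvd_of_emod_eq_zero h2, Int.dvd_of_emod_eq_zero h3, Int.dvd_of_emod_eq_zero h1⟩).1
  obtain ⟨X, rfl⟩ := Int.eq_ofNat_of_zero_le hpos.le
  have hX : Odd X := Nat.odd_iff.2 (by omega)
  have e : jacobiSym (A * y ^ 2) X = jacobiSym (-1 * (B * z ^ 2)) X :=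
    jacobiSym.mod_left' (Int.emod_eq_emod_iff_emod_sub_eq_zero.2
      (Int.emod_eq_zero_of_dvd ⟨X, by linear_combination -hx⟩))
  rw [jacobiSym.mul_left, jacobiSym.mul_left, jacobiSym.mul_left, jacobiSym.sq_one' hgy,
    jacobiSym.sq_one' hgz, mul_one, mul_one,
    jacobiSym.quadratic_reciprocity_one_mod_four (by omega) hX,
    jacobiSym.quadratic_reciprocity_one_mod_four (by omega) hX] at e
  rw [e, mul_assoc, jacobiSym_mul_self hgB, mul_one, Int.natAbs_natCast]

theorem exists_sq_sub_mid (h : LocallyGoodFactors n A B f) : ∃ r : ℤ, (B : ℤ) ∣ r ^ 2 - A :=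
  exists_sq_sub_dvd h.mid.squarefree fun p hp hpB => by
    have : Fact p.Prime := ⟨hp⟩
    have hpA : ¬ (p : ℤ) ∣ A := by exact_mod_cast (h.not_dvd_of_dvd hp hpB).1
    have hl := (isSquare_intCast_iff (h.mid.oneModEight.ne_two hp hpB) hpA).1
      (by exact_mod_cast h.isSquare_left hpB)
    obtain ⟨r, hr⟩ := (legendreSym.eq_one_iff p
      (by rwa [Ne, ZMod.intCast_zmod_eq_zero_iff_dvd])).1 hl
    obtain ⟨r, rfl⟩ := ZMod.intCast_surjective r
    refine ⟨r, (ZMod.intCast_zmod_eq_zero_iff_dvd _ p).1 ?_⟩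
    push_cast at hr ⊢
    rw [hr]; ring

theorem exists_primitive_conic_solution (h : LocallyGoodFactors n A B f) :
    ∃ x y z : ℤ, 0 < x ∧ Int.gcd (Int.gcd y z) x = 1 ∧ x ^ 2 = A * y ^ 2 + B * z ^ 2 := by
  obtain ⟨r, hr⟩ := h.swap.exists_sq_sub_mid
  obtain ⟨s, hs⟩ := h.exists_sq_sub_mid
  obtain ⟨x, y, z, h0, hx⟩ := exists_conic_solution h.squarefree_left_mul_mid hr hs
  have h0' : ((y : ℚ), (z : ℚ), (x : ℚ)) ≠ (0, 0, 0) := fun h => h0 (by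
    simp only [Prod.mk.injEq, Int.cast_eq_zero] at h
    simp [h])
  obtain ⟨k, y', z', x', hk, hg, ey, ez, ex⟩ := exists_primitive_multiple h0'
  have hx' : x' ^ 2 = A * y' ^ 2 + B * z' ^ 2 := by
    have e : (x : ℚ) ^ 2 = A * y ^ 2 + B * z ^ 2 := by exact_mod_cast hx
    rw [ex, ey, ez] at e
    have : (x' : ℚ) ^ 2 = A * y' ^ 2 + B * z' ^ 2 := by
      apply mul_left_cancel₀ (pow_ne_zero 2 hk)
      linear_combination e
    exact_mod_cast this
  refine ⟨|x'|, y', z', abs_pos.2 fun hx0 => ?_, ?_, by rwa [sq_abs]⟩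
  · have hA : (0 : ℤ) < A := by exact_mod_cast Nat.pos_of_ne_zero h.left.oneModEight.1
    have hB : (0 : ℤ) < B := by exact_mod_cast Nat.pos_of_ne_zero h.mid.oneModEight.1
    subst hx0
    have hy : y' = 0 := by
      by_contra hy
      have : 0 < y' ^ 2 := by positivity
      have := sq_nonneg z'
      nlinarith
    have hz : z' = 0 := by
      by_contra hz
      have : 0 < z' ^ 2 := by positivity
      have := sq_nonneg y'
      nlinarith
    subst hy hz
    simp at hg
  · rw [Int.gcd, Int.natAbs_abs]; exact hg

/-- With the auxiliary solution, (c₁/B)(c₂/A) = (x/B)(x/A)(a₁/B)(a₂/A) = (−1/x), and this is also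
(c₂c₂'/A). -/
theorem jacobiSym_eq_conj (h : LocallyGoodFactors n A B f) {a₁ b₁ c₁ a₂ b₂ c₂ a₂' b₂' c₂' : ℤ}
    (ha₁ : 0 < a₁) (hb₁ : 0 < b₁) (hg₁ : Int.gcd (Int.gcd a₁ b₁) c₁ = 1)
    (hc₁ : c₁ ^ 2 = A * a₁ ^ 2 + (B * f : ℕ) * b₁ ^ 2)
    (ha₂ : 0 < a₂) (hb₂ : 0 < b₂) (hg₂ : Int.gcd (Int.gcd a₂ b₂) c₂ = 1)
    (hc₂ : c₂ ^ 2 = B * a₂ ^ 2 + (A * f : ℕ) * b₂ ^ 2)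
    (hb₂' : b₂' ≠ 0) (hg₂' : Int.gcd (Int.gcd a₂' b₂') c₂' = 1)
    (hc₂' : c₂' ^ 2 = B * a₂' ^ 2 + -(A * f : ℕ) * b₂' ^ 2)
    (hdiv : ((A * f : ℕ) : ℤ) ∣ a₂ * c₂' + c₂ * a₂') : jacobiSym c₁ B = jacobiSym c₂' A := by
  obtain ⟨x, y, z, hpos, hg, hx⟩ := h.exists_primitive_conic_solution
  have hg' : Int.gcd (Int.gcd z y) x = 1 := by rwa [Int.gcd_comm z y]
  have hx' : x ^ 2 = B * z ^ 2 + A * y ^ 2 := by rw [hx]; ring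
  have dvdB : (B : ℤ) ∣ (B * f : ℕ) := by push_cast; exact dvd_mul_right _ _
  have dvdA : (A : ℤ) ∣ (A * f : ℕ) := by push_cast; exact dvd_mul_right _ _
  have e1 := jacobiSym_eq_mul_of_conics h.mid.oneModEight h.mid.squarefree dvdB hc₁ hg hx
  have e2 := jacobiSym_eq_mul_of_conics h.left.oneModEight h.left.squarefree dvdA hc₂ hg' hx'
  have e3 := h.jacobiSym_eq_of_two_conics ha₁ hb₁ hg₁ hc₁ ha₂ hb₂ hg₂ hc₂
  have e4 := h.swap.jacobiSym_mul_conj hb₂.ne' hg₂ hc₂ hb₂' hg₂' hc₂' hdiv hg' hx' hpos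
  have e5 := h.jacobiSym_mul_eq_neg_one hg hx hpos
  have q1 := jacobiSym_mul_self (h.swap.gcd_right_eq_one hg' hx')
  have q2 : jacobiSym a₂ A * jacobiSym a₂ A = 1 :=
    jacobiSym_mul_self (gcd_eq_one_of_primes fun p hp hpa hpA =>
      have hpA' := Int.natCast_dvd_natCast.1 hpA
      not_dvd_left_coord hp h.swap.squarefree_mid_mul_right (hpA'.mul_right f) hg₂ hc₂ hpa)
  rw [jacobiSym.mul_left, ← e5, e2] at e4
  rw [e1, e3]
  linear_combination (-(jacobiSym x A) * jacobiSym a₂ A) * e4 -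
    (jacobiSym x B * jacobiSym a₂ A - jacobiSym c₂' A * jacobiSym a₂ A ^ 2) * q1 +
    jacobiSym c₂' A * q2

end LocallyGoodFactors

/-! ### Factorizations of n and the final assembly -/

theorem isSquare_padic_of_primes {p m : ℕ} [Fact p.Prime]
    (h : ∀ q : ℕ, q.Prime → q ∣ m → IsSquare (q : ℚ_[p])) : IsSquare (m : ℚ_[p]) := by
  induction m using induction_on_primes with
  | zero => exact ⟨0, by simp⟩
  | one => exact ⟨1, by simp⟩
  | prime_mul q m hq ih =>
    push_cast
    exact (h q hq (dvd_mul_right _ _)).mul (ih fun r hr hrm => h r hr (hrm.mul_left _))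

/-- A prime p ∣ n not dividing the subproduct divides a d_i outside S, so by the residue hypothesis
every prime factor of the subproduct is a square modulo p. At p = 2 the congruence modulo 8
suffices. -/
theorem locallyGood_prod {ι : Type*} [Fintype ι] {n : ℕ} {d : ι → ℕ} (hn : n = ∏ i, d i)
    (hsq : Squarefree n) (hmod : ∀ p : ℕ, p.Prime → p ∣ n → p % 8 = 1)
    (hleg : ∀ i j, i ≠ j → ∀ (p q : ℕ) [Fact p.Prime] [Fact q.Prime],
      p ∣ d i → q ∣ d j → legendreSym q p = 1) (S : Finset ι) : LocallyGood n (∏ i ∈ S, d i) := by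
  have hdvd : ∏ i ∈ S, d i ∣ n := by
    rw [hn]; exact Finset.prod_dvd_prod_of_subset _ _ _ (Finset.subset_univ S)
  have h8 : OneModEight (∏ i ∈ S, d i) :=
    ⟨ne_zero_of_dvd_ne_zero hsq.ne_zero hdvd, fun p hp hpS => hmod p hp (hpS.trans hdvd)⟩
  refine ⟨h8, hsq.squarefree_of_dvd hdvd, hdvd, fun p hp hpn hpS => ?_⟩
  by_cases h2 : p = 2
  · subst h2; exact h8.isSquare_padic_two
  have hpn : p ∣ n := (hp.out.dvd_mul.1 hpn).resolve_left fun h =>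
    h2 ((Nat.prime_dvd_prime_iff_eq hp.out Nat.prime_two).1 h)
  refine isSquare_padic_of_primes fun q hq hqS => ?_
  have : Fact q.Prime := ⟨hq⟩
  rw [hn, hp.out.prime.dvd_finsetProd_iff] at hpn
  obtain ⟨i, -, hi⟩ := hpn
  obtain ⟨j, hj, hqj⟩ := (hq.prime.dvd_finsetProd_iff _).1 hqS
  have hij : j ≠ i := by
    rintro rfl
    exact hpS (hi.trans (Finset.dvd_prod_of_mem d hj))
  have hpq : ¬ (p : ℤ) ∣ (q : ℤ) := fun h => by
    have := (Nat.prime_dvd_prime_iff_eq hp.out hq).1 (Int.natCast_dvd_natCast.1 h)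
    exact hpS (this ▸ hqS)
  exact_mod_cast (isSquare_intCast_iff h2 hpq).2 (hleg j i hij q p hqj hi)

section Factors

variable {ι : Type*} [Fintype ι] [DecidableEq ι] {n : ℕ} {d : ι → ℕ}

theorem locallyGoodFactors_pair (hn : n = ∏ i, d i) (hsq : Squarefree n)
    (hgood : ∀ S : Finset ι, LocallyGood n (∏ i ∈ S, d i)) {i j : ι} (hij : i ≠ j) :
    LocallyGoodFactors n (d i) (d j) (∏ l ∈ (Finset.univ.erase i).erase j, d l) := by
  have hs : ∀ l, LocallyGood n (d l) := fun l => by simpa using hgood {l}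
  refine ⟨?_, hsq, hs i, hs j, hgood _⟩
  rw [Finset.mul_prod_erase _ d (Finset.mem_erase.2 ⟨hij.symm, Finset.mem_univ j⟩),
    Finset.mul_prod_erase _ d (Finset.mem_univ i), hn]

theorem locallyGoodFactors_single (hn : n = ∏ i, d i) (hsq : Squarefree n)
    (hgood : ∀ S : Finset ι, LocallyGood n (∏ i ∈ S, d i)) (i : ι) :
    LocallyGoodFactors n (n / d i) (d i) 1 := by
  have hs : LocallyGood n (d i) := by simpa using hgood {i}
  have e : n = d i * ∏ l ∈ Finset.univ.erase i, d l := by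
    rw [Finset.mul_prod_erase _ d (Finset.mem_univ i), hn]
  have e' : n / d i = ∏ l ∈ Finset.univ.erase i, d l := by
    conv_lhs => rw [e]
    exact Nat.mul_div_cancel_left _ (Nat.pos_of_ne_zero hs.oneModEight.1)
  exact ⟨by rw [mul_one, Nat.div_mul_cancel hs.dvd], hsq, e' ▸ hgood _, hs, by simpa using hgood ∅⟩

end Factors

theorem LocallyGoodFactors.div_left {n A B f : ℕ} (h : LocallyGoodFactors n A B f) :
    n / A = B * f := by
  conv_lhs => rw [h.eq]
  exact Nat.mul_div_cancel_left _ (Nat.pos_of_ne_zero h.left.oneModEight.1)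

end CongruentCurve

open CongruentCurve

theorem proposition4p2 (k n : ℕ) (d : Fin k → ℕ)
    (hn : n = ∏ i, d i) (hsq : Squarefree n)
    (hmod : ∀ p : ℕ, p.Prime → p ∣ n → p % 8 = 1)
    (h4 : ∀ i, CongruentCurve.classRank (d i) 2 = 1)
    (hleg : ∀ i j, i ≠ j → ∀ (p q : ℕ) [Fact p.Prime] [Fact q.Prime],
      p ∣ d i → q ∣ d j → legendreSym q p = 1)
    (a b c α β γ a' b' c' : Fin k → ℤ)
    (hc : ∀ i, CongruentCurve.IsPrimPosSol (d i) ((n / d i : ℕ) : ℤ) (a i) (b i) (c i))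
    (hγ : ∀ i, CongruentCurve.IsPrimPosSol (d i) (2 * ((n / d i : ℕ) : ℤ)) (α i) (β i) (γ i))
    (hc' : ∀ i, CongruentCurve.IsPrimPosSol (d i) (-((n / d i : ℕ) : ℤ)) (a' i) (b' i) (c' i))
    (hdiv : ∀ i, ((n / d i : ℕ) : ℤ) ∣ a i * γ i + c i * α i)
    (hdiv' : ∀ i, ((n / d i : ℕ) : ℤ) ∣ a i * c' i + c i * a' i) :
    (∀ i j, i ≠ j → CongruentCurve.HasCasselsPairing n
      (CongruentCurve.Lam (d i)) (CongruentCurve.Lam (d j)) (jacobiSym (c i * γ i) (d j))) ∧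
    (∀ i j, i ≠ j → CongruentCurve.HasCasselsPairing n
        (CongruentCurve.Lam (d i)) (CongruentCurve.Lam' (d j)) (jacobiSym (c i) (d j)) ∧
      jacobiSym (c i) (d j) = jacobiSym (c' j) (d i)) ∧
    (∀ i, CongruentCurve.HasCasselsPairing n
        (CongruentCurve.Lam (d i)) (CongruentCurve.Lam' (d i))
        ((-1) ^ CongruentCurve.delta (d i) * jacobiSym (c i) (d i)) ∧
      (-1) ^ CongruentCurve.delta (d i) * jacobiSym (c i) (d i) =
        (-1) ^ CongruentCurve.delta (d i) * jacobiSym (c' i) (d i)) ∧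
    (∀ i j, i ≠ j → CongruentCurve.HasCasselsPairing n
      (CongruentCurve.Lam' (d i)) (CongruentCurve.Lam' (d j))
      (jacobiSym (c i * c' i) (d j))) := by
  have hgood := locallyGood_prod hn hsq hmod hleg
  have hF : ∀ i j, i ≠ j → ∃ f, LocallyGoodFactors n (d i) (d j) f :=
    fun i j hij => ⟨_, locallyGoodFactors_pair hn hsq hgood hij⟩
  -- Off the diagonal n is split as dᵢ · dⱼ · rest; on it as (n/dᵢ) · dᵢ · 1.
  have hS := locallyGoodFactors_single hn hsq hgood
  have hd : ∀ i, LocallyGood n (d i) := fun i => (hS i).mid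
  have he0 : ∀ i, n / d i ≠ 0 := fun i => (hS i).left.oneModEight.1
  have heq : ∀ i, n = d i * (n / d i) := fun i => by
    conv_lhs => rw [(hS i).eq]
    ring
  have hesq : ∀ i (p : ℕ) [Fact p.Prime], p ∣ d i → IsSquare ((n / d i : ℕ) : ℚ_[p]) :=
    fun i p _ => (hS i).isSquare_left
  have mem : ∀ i, Lam (d i) ∈ Sel2 n := fun i => Lam_mem_Sel2 (hd i) (heq i) (hesq i)
  have mem' : ∀ i, Lam' (d i) ∈ Sel2 n := fun i => Lam'_mem_Sel2 (hd i) (heq i) (hesq i)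
  have ex : ∀ i {D' : Fin 3 → ℚˣ} {Λ' : Fin 3 → SqClass}, (∀ l, (D' l : SqClass) = Λ' l) →
      Nonempty (CasselsDatum n (Lam (d i)) Λ') := fun i _ _ hD' =>
    nonempty_casselsDatum_Lam (hd i) (heq i) (he0 i) (hesq i) (hc i).2.1.ne' (hc i).2.2.1.ne'
      (hγ i).2.1.ne' (hγ i).2.2.1.ne' (hc i).2.2.2.2 (hγ i).2.2.2.2 hD'
  have hconj : ∀ i, jacobiSym (c i) (d i) = jacobiSym (c' i) (d i) := fun i =>
    jacobiSym_eq_jacobiSym_conj (hd i).oneModEight (hd i).squarefree (hc i).2.2.2.1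
      (hc i).2.2.2.2 (hc' i).2.2.2.1 (hc' i).2.2.2.2
  refine ⟨fun i j hij => ?_, fun i j hij => ?_, fun i => ?_, fun i j hij => ?_⟩
  · obtain ⟨f, h⟩ := hF i j hij
    refine ⟨mem i, mem j, ex i (mk_lamUnits (hd j).oneModEight.1), fun C => ?_⟩
    obtain ⟨-, -, -, g1, q1⟩ := hc i
    obtain ⟨-, -, -, g2, q2⟩ := hγ i
    rw [h.div_left] at q1 q2
    have := hasPlaceProd_localPairing_Lam_Lam h C g1 q1 g2 q2
    exact ⟨this.finite, this.prod_eq⟩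
  · obtain ⟨f, h⟩ := hF i j hij
    obtain ⟨a1, b1, -, g1, q1⟩ := hc i
    obtain ⟨a2, b2, -, g2, q2⟩ := hc j
    obtain ⟨-, b3, -, g3, q3⟩ := hc' j
    have hdj := hdiv' j
    rw [h.div_left] at q1
    rw [h.swap.div_left] at q2 q3 hdj
    refine ⟨⟨mem i, mem' j, ex i (mk_lamUnits' (hd j).oneModEight.1), fun C => ?_⟩,
      h.jacobiSym_eq_conj a1 b1 g1 q1 a2 b2 g2 q2 b3.ne' g3 q3 hdj⟩
    have := hasPlaceProd_localPairing_Lam_Lam' h C g1 q1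
    exact ⟨this.finite, this.prod_eq⟩
  · refine ⟨⟨mem i, mem' i, ex i (mk_lamUnits' (hd i).oneModEight.1), fun C => ?_⟩, by rw [hconj]⟩
    have := hasPlaceProd_localPairing_self (hS i) C (hc i).2.2.2.1 (hc i).2.2.2.2
    exact ⟨this.finite, this.prod_eq⟩
  · obtain ⟨f, h⟩ := hF i j hij
    have hne := nonempty_casselsDatum_Lam' (hd i) (heq i) (he0 i) (hesq i) (hc i).2.1.ne'
      (hc i).2.2.1.ne' (hc' i).2.1.ne' (hc' i).2.2.1.ne' (hc i).2.2.2.2 (hc' i).2.2.2.2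
      (mk_lamUnits' (hd j).oneModEight.1)
    refine ⟨mem' i, mem' j, hne, fun C => ?_⟩
    obtain ⟨-, -, -, g1, q1⟩ := hc i
    obtain ⟨-, -, -, g2, q2⟩ := hc' i
    rw [h.div_left] at q1 q2
    have := hasPlaceProd_localPairing_Lam'_Lam' h C g1 q1 g2 q2
    exact ⟨this.finite, this.prod_eq⟩
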